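/- Let $\mathcal A$ be a separable (not necessarily unital) $C^*$-algebra with multiplier algebra $M(\mathcal A)$, and let $T$ be a locally compact metric space with a Radon measure $\mu$. Every $\varphi$ in the dual $\mathcal A^*$ is extended to $M(\mathcal A)$ by strict continuity. A field $(b_t)_{t\in T}$ in $M(\mathcal A)$ is weak* measurable if $t\mapsto\varphi(b_t)$ is $\mu$-measurable for every $\varphi\in\mathcal A^*$; it is integrable with integral $b=\int_T b_t\,d\mu(t)\in M(\mathcal A)$ if, for every $\varphi\in\mathcal A^*$, the function $t\mapsto\varphi(b_t)$ is integrable and $\varphi(b)=\int_T\varphi(b_t)\,d\mu(t)$. A unital column field is a weak* measurable field $(a_t)_{t\in T}$ in $M(\mathcal A)$ such that $(a_t^*a_t)$ is integrable with $\int_T a_t^*a_t\,d\mu(t)=\mathbf 1$. Let $K(\mathcal A)$ be the minimal dense ideal of $\mathcal A$. Let $f$ be a convex, continuous real function on an interval $I\subset\mathbb R$, let $(x_t)_{t\in T}$ be a bounded, weak* measurable field of self-adjoint elements of $\mathcal A$ with spectra (computed in $M(\mathcal A)$) contained in $I$, and let $(a_t)_{t\in T}$ be a unital column field in $M(\mathcal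 A)$. Then: (i) The field $(a_t^*x_ta_t)$ is integrable, with a unique integral $y=\int_T a_t^*x_ta_t\,d\mu(t)\in M(\mathcal A)$. If $y\in\mathcal A$ or if $I$ is closed, then the spectrum of $y$ is contained in $I$. If the field $(f(x_t))_{t\in T}$ is bounded (which is automatic if $I$ is closed), then $(a_t^*f(x_t)a_t)$ is integrable, with a unique integral in $M(\mathcal A)$. (ii) Suppose that the spectrum of $y$ is contained in $I$ and that $(a_t^*f(x_t)a_t)$ is integrable. Then $$\varphi\left(f\left(\int_T a_t^*x_ta_t\,d\mu(t)\right)\right)\le\varphi\left(\int_T a_t^*f(x_t)a_t\,d\mu(t)\right)$$ for every positive functional $\varphi\in\mathcal A^*$ that contains $y$ in its centralizer, i.e. $\varphi(xy)=\varphi(yx)$ for all $x\in\mathcal A$. (iii) Suppose in addition that $f\ge 0$ on $I$. Then the same inequality holds in $[0,\infty]$ for every additive, positively homogeneous, lower semicontinuous $\varphi\colon\mathcal A_+\to[0,\infty]$ that is finite on $K(\mathcal A)_+$ and contains $y$ in its centralizer, i.e. $\varphi(xy)=\varphi(yx)$ for all $x\in K(\mathcal A)$. Here $\varphi$ is extended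 linearly to $K(\mathcal A)$, and to positive $m\in M(\mathcal A)$ by $\varphi(m)=\sup\{\varphi(b): b\in\mathcal A,\ 0\le b\le m\}$. -/

import Mathlib

open MeasureTheory Filter Topology
open scoped ENNReal NNReal ComplexOrder MultiplierAlgebra

noncomputable section

namespace CStarJensen

variable {A : Type*} [NonUnitalCStarAlgebra A] [PartialOrder A] [StarOrderedRing A]

/-- The canonical (strictly continuous) extension to the multiplier algebra `M(A)` of a bounded
functional `φ` on the C⋆-algebra `A`: `φ(m) = lim φ(m e)` as `e` runs through the canonical
approximate unit of `A`. -/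
def multExt (φ : StrongDual ℂ A) (m : 𝓜(ℂ, A)) : ℂ :=
  limUnder (CStarAlgebra.approximateUnit A) fun e : A => φ (m.fst e)

/-- `multExt φ` does extend `φ`. -/
theorem multExt_coe (φ : StrongDual ℂ A) (a : A) :
    multExt φ (DoubleCentralizer.coe ℂ a) = φ a := by
  have h := (CStarAlgebra.increasingApproximateUnit A).toIsApproximateUnit
  have := h.neBot
  have h1 : Tendsto (fun e : A => φ ((DoubleCentralizer.coe ℂ a).fst e))
      (CStarAlgebra.approximateUnit A) (𝓝 (φ a)) :=
    (φ.continuous.tendsto a).comp (h.tendsto_mul_left a)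
  exact h1.limUnder_eq

section Fields

variable {T : Type*} [MeasurableSpace T]

/-- Weak* measurability of a field of multipliers: `t ↦ φ(a_t)` is `μ`-measurable for every
`φ` in the dual of `A`. -/
def WeakStarMeasurable (μ : Measure T) (a : T → 𝓜(ℂ, A)) : Prop :=
  ∀ φ : StrongDual ℂ A, AEStronglyMeasurable (fun t => multExt φ (a t)) μ

/-- The field `a` is integrable, and its integral is the multiplier `m`: `φ(m) = ∫ φ(a_t) dμ(t)`
for every `φ` in the dual of `A`. -/
def HasWeakStarIntegral (μ : Measure T) (a : T → 𝓜(ℂ, A)) (m : 𝓜(ℂ, A)) : Prop :=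
  ∀ φ : StrongDual ℂ A, Integrable (fun t => multExt φ (a t)) μ ∧
    multExt φ m = ∫ t, multExt φ (a t) ∂μ

/-- A unital column field: a weak* measurable field in `M(A)` with `∫ a_t⋆ a_t dμ(t) = 1`. -/
structure IsUnitalColumnField (μ : Measure T) (a : T → 𝓜(ℂ, A)) : Prop where
  measurable : WeakStarMeasurable μ a
  integral_eq_one : HasWeakStarIntegral μ (fun t => star (a t) * a t) 1

end Fields

/-- The centralizer of a bounded functional on `A`, as a subset of `M(A)`: the multipliers `y` with
`φ(xy) = φ(yx)` for all `x ∈ A`. Recall that `y.snd x = xy` and `y.fst x = yx`, both in `A`. -/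
def centralizer (φ : StrongDual ℂ A) : Set 𝓜(ℂ, A) := {y | ∀ x : A, φ (y.snd x) = φ (y.fst x)}

/-- The part of the centralizer that lies in `A` is given by the usual formula. -/
theorem coe_mem_centralizer (φ : StrongDual ℂ A) (y : A) :
    DoubleCentralizer.coe ℂ y ∈ centralizer φ ↔ ∀ x : A, φ (x * y) = φ (y * x) :=
  Iff.rfl

variable (A) in
/-- The minimal dense ideal `K(A)` of `A`: the intersection of all the dense two-sided ideals
(not assumed closed). -/
def minDenseIdeal : Submodule ℂ A :=
  sInf {J | Dense (J : Set A) ∧ ∀ x ∈ J, ∀ a : A, a * x ∈ J ∧ x * a ∈ J}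

variable (A) in
/-- A (possibly unbounded) positive functional on `A`: an additive, positively homogeneous map
from the positive cone of `A` to `[0, ∞]`. Only the values at positive elements are meaningful. -/
structure PosFunctional where
  toFun : A → ℝ≥0∞
  map_zero : toFun 0 = 0
  map_add : ∀ a b : A, 0 ≤ a → 0 ≤ b → toFun (a + b) = toFun a + toFun b
  map_smul : ∀ (r : ℝ≥0) (a : A), 0 ≤ a → toFun (((r : ℝ) : ℂ) • a) = r * toFun a

namespace PosFunctional

/-- Lower semicontinuity on the positive cone of `A`. -/
def LowerSemicont (φ : PosFunctional A) : Prop :=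
  LowerSemicontinuousOn φ.toFun {a : A | 0 ≤ a}

/-- Finiteness on (the positive part of) the minimal dense ideal. -/
def FiniteOnMinDenseIdeal (φ : PosFunctional A) : Prop :=
  ∀ x ∈ minDenseIdeal A, 0 ≤ x → φ.toFun x ≠ ∞

/-- `w = p₀ - p₁ + i (p₂ - p₃)` with all the `pᵢ` positive of finite `φ`-value. -/
def IsDecomp (φ : PosFunctional A) (w : A) (p : Fin 4 → A) : Prop :=
  (∀ i, 0 ≤ p i ∧ φ.toFun (p i) ≠ ∞) ∧ w = (p 0 - p 1) + Complex.I • (p 2 - p 3)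

/-- The value `φ(p₀) - φ(p₁) + i (φ(p₂) - φ(p₃))`. -/
def decompValue (φ : PosFunctional A) (p : Fin 4 → A) : ℂ :=
  (((φ.toFun (p 0)).toReal - (φ.toFun (p 1)).toReal : ℝ) : ℂ) +
    Complex.I * (((φ.toFun (p 2)).toReal - (φ.toFun (p 3)).toReal : ℝ) : ℂ)

open Classical in
/-- The linear extension of `φ` to the span of the positive elements at which it is finite
(extended by `0` to the other elements of `A`). -/
def linExt (φ : PosFunctional A) (w : A) : ℂ :=
  if h : ∃ p, φ.IsDecomp w p then φ.decompValue h.choose else 0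

theorem toReal_sub_eq (φ : PosFunctional A) {a b c d : A}
    (ha : 0 ≤ a ∧ φ.toFun a ≠ ∞) (hb : 0 ≤ b ∧ φ.toFun b ≠ ∞)
    (hc : 0 ≤ c ∧ φ.toFun c ≠ ∞) (hd : 0 ≤ d ∧ φ.toFun d ≠ ∞) (h : a - b = c - d) :
    (φ.toFun a).toReal - (φ.toFun b).toReal = (φ.toFun c).toReal - (φ.toFun d).toReal := by
  have h1 : a + d = c + b := by
    have := sub_eq_sub_iff_add_eq_add.mp h
    exact this
  have h2 : φ.toFun a + φ.toFun d = φ.toFun c + φ.toFun b := by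
    rw [← φ.map_add a d ha.1 hd.1, ← φ.map_add c b hc.1 hb.1, h1]
  have h3 := congrArg ENNReal.toReal h2
  rw [ENNReal.toReal_add ha.2 hd.2, ENNReal.toReal_add hc.2 hb.2] at h3
  linarith

/-- The linear extension does not depend on the decomposition. -/
theorem linExt_eq (φ : PosFunctional A) {w : A} {p : Fin 4 → A} (hp : φ.IsDecomp w p) :
    φ.linExt w = φ.decompValue p := by
  have key : ∀ q, φ.IsDecomp w q → φ.decompValue q = φ.decompValue p := by
    intro q hq
    have hs : ∀ r : Fin 4 → A, φ.IsDecomp w r →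
        IsSelfAdjoint (r 0 - r 1) ∧ IsSelfAdjoint (r 2 - r 3) := fun r hr =>
      ⟨(IsSelfAdjoint.of_nonneg (hr.1 0).1).sub (IsSelfAdjoint.of_nonneg (hr.1 1).1),
        (IsSelfAdjoint.of_nonneg (hr.1 2).1).sub (IsSelfAdjoint.of_nonneg (hr.1 3).1)⟩
    have h0 : (q 0 - q 1) + Complex.I • (q 2 - q 3) = (p 0 - p 1) + Complex.I • (p 2 - p 3) :=
      hq.2.symm.trans hp.2
    have h1 : (q 0 - q 1) - Complex.I • (q 2 - q 3) = (p 0 - p 1) - Complex.I • (p 2 - p 3) := by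
      have := congrArg star h0
      simp only [star_add, star_smul, (hs q hq).1.star_eq, (hs q hq).2.star_eq,
        (hs p hp).1.star_eq, (hs p hp).2.star_eq] at this
      simp only [Complex.star_def, Complex.conj_I, neg_smul, ← sub_eq_add_neg] at this
      exact this
    have h2 : q 0 - q 1 = p 0 - p 1 := by
      have h3 : (2 : ℂ) • (q 0 - q 1) = (2 : ℂ) • (p 0 - p 1) := by
        rw [two_smul, two_smul]
        have := congrArg₂ (· + ·) h0 h1
        simpa using this
      exact smul_right_injective A (two_ne_zero (α := ℂ)) h3
    have h4 : q 2 - q 3 = p 2 - p 3 := by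
      rw [h2] at h0
      exact smul_right_injective A Complex.I_ne_zero (add_left_cancel h0)
    unfold decompValue
    rw [φ.toReal_sub_eq (hq.1 0) (hq.1 1) (hp.1 0) (hp.1 1) h2,
      φ.toReal_sub_eq (hq.1 2) (hq.1 3) (hp.1 2) (hp.1 3) h4]
  have h : ∃ p, φ.IsDecomp w p := ⟨p, hp⟩
  rw [linExt, dif_pos h]
  exact key _ h.choose_spec

/-- The centralizer of an unbounded functional, as a subset of `M(A)`: the multipliers `y` with
`φ(xy) = φ(yx)` for all `x ∈ K(A)`. -/
def centralizer (φ : PosFunctional A) : Set 𝓜(ℂ, A) :=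
  {y | ∀ x ∈ minDenseIdeal A, φ.linExt (y.snd x) = φ.linExt (y.fst x)}

/-- The part of the centralizer that lies in `A` is given by the usual formula. -/
theorem coe_mem_centralizer (φ : PosFunctional A) (y : A) :
    DoubleCentralizer.coe ℂ y ∈ φ.centralizer ↔
      ∀ x ∈ minDenseIdeal A, φ.linExt (x * y) = φ.linExt (y * x) :=
  Iff.rfl

/-- The canonical extension of a lower semicontinuous `φ` to the positive cone of `M(A)`:
`φ(m) = sup {φ(b) | b ∈ A, 0 ≤ b ≤ m}`, where `b ≤ m` means `m - b = n⋆ n` for some `n ∈ M(A)`. -/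
def multExt (φ : PosFunctional A) (m : 𝓜(ℂ, A)) : ℝ≥0∞ :=
  ⨆ (b : A) (_ : 0 ≤ b ∧ ∃ n : 𝓜(ℂ, A), m - DoubleCentralizer.coe ℂ b = star n * n), φ.toFun b

end PosFunctional

end CStarJensen

end

/-!
The proof localizes the convexity of `f`. The functional calculus `f(y)` of the integral `y` cannot
be compared with the integral `z` of `a⋆ f(x) a` in the order of `M(A)`, but the affine minorants
of `f` can: if `k s + d ≤ f(s)` on `I`, then `k x_t + d ≤ f(x_t)`, and integrating the compressions
by the unital column field gives `k y + d ≤ z` (`affine_le_integral`). A continuous convex function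
is locally approximated by its affine minorants. With a quadratic partition of unity `∑ hᵢ² = 1`
on the spectrum of `y`, this gives `(hᵢ² (f - ε))(y) ≤ hᵢ(y) z hᵢ(y)` (`exists_partition_cfc_le`).

If a bounded positive functional `φ` has `y` in its centralizer, then `∑ φ(hᵢ(y) z hᵢ(y)) = φ(z)`,
and Jensen's inequality follows (`multExt_cfc_le`).

For an unbounded functional `φ`, the multiplier `z` is replaced by `q = w w⋆`, where
`w = z^{1/2} g` and `g²` runs through an approximate unit whose members have local units. Such `w`
and all their left multiples belong to the minimal dense ideal (`mem_minDenseIdeal_of_mul_eq`), so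
that the form `(m, n) ↦ φ(m q n⋆)` on `M(A)` is finite. Being lower semicontinuous, it is bounded by
Baire's theorem (`exists_ball_toFun_le`). Hence the symmetry of `y` with respect to this form extends
to the functional calculus of `y`, and `∑ φ(hᵢ(y) q hᵢ(y)) ≤ φ(q)` (`PosFunctional.sum_toFun_cfc_le`).
An element `0 ≤ d ≤ f(y)` of `A` is finally approximated in norm by elements below
`∑ hᵢ(y) q hᵢ(y)` (`PosFunctional.exists_near_toFun_le`), and lower semicontinuity at `d` finishes
the argument.

The integrals exist since `φ ↦ ∫ φ(a⋆ X a) dμ` is a bounded linear form on the dual of `A`, by a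
Jordan decomposition of functionals. For `c ∈ A`, the form `φ ↦ ∫ φ(a⋆ X a c) dμ` is the evaluation at
an element of `A` (`exists_weakIntegral_mul`), because the increasing integrals of `c⋆ a⋆ a c` over an
exhaustion of `T` converge in norm, by a noncommutative version of Dini's theorem. These elements
define the multiplier that is the integral. The spectrum of `y` is located by comparing with the
constants below or above all the spectra. When `y` belongs to `A` and a bound is not attained, a
state of `M(A)` that vanishes at the difference restricts to a functional on `A` that would have to
vanish (`notMem_spectrum_of_forall_lt`).
-/

set_option linter.unusedSectionVars false

noncomputable section

namespace CStarJensen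

/-! ### Multipliers -/

section Multiplier

variable {A : Type*} [NonUnitalCStarAlgebra A]

theorem eq_of_forall_mul_left_eq {u v : A} (h : ∀ c, c * u = c * v) : u = v := by
  have h1 : star (u - v) * (u - v) = 0 := by rw [mul_sub, h, sub_self]
  exact sub_eq_zero.mp (CStarRing.star_mul_self_eq_zero_iff _ |>.mp h1)

theorem eq_of_forall_mul_right_eq {u v : A} (h : ∀ c, u * c = v * c) : u = v := by
  have h1 : (u - v) * star (u - v) = 0 := by rw [sub_mul, h, sub_self]
  exact sub_eq_zero.mp (CStarRing.mul_star_self_eq_zero_iff _ |>.mp h1)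

theorem fst_mul (m : 𝓜(ℂ, A)) (a b : A) : m.fst (a * b) = m.fst a * b :=
  eq_of_forall_mul_left_eq fun c => by
    rw [← m.central, ← mul_assoc, m.central, mul_assoc]

theorem snd_mul (m : 𝓜(ℂ, A)) (a b : A) : m.snd (a * b) = a * m.snd b :=
  eq_of_forall_mul_right_eq fun c => by
    rw [m.central, mul_assoc, ← m.central, mul_assoc]

theorem mul_coe (m : 𝓜(ℂ, A)) (a : A) :
    m * DoubleCentralizer.coe ℂ a = DoubleCentralizer.coe ℂ (m.fst a) := by
  refine DoubleCentralizer.ext _ _ _ _ (Prod.ext ?_ ?_)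
  · ext b
    exact fst_mul m a b
  · ext b
    exact m.central b a

theorem coe_mul (m : 𝓜(ℂ, A)) (a : A) :
    DoubleCentralizer.coe ℂ a * m = DoubleCentralizer.coe ℂ (m.snd a) := by
  refine DoubleCentralizer.ext _ _ _ _ (Prod.ext ?_ ?_)
  · ext b
    exact (m.central a b).symm
  · ext b
    exact snd_mul m b a

theorem multiplier_ext {m n : 𝓜(ℂ, A)} (h : ∀ c, m.fst c = n.fst c) : m = n := by
  refine DoubleCentralizer.ext _ _ _ _ (Prod.ext (ContinuousLinearMap.ext h) ?_)
  ext b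
  refine eq_of_forall_mul_right_eq fun c => ?_
  rw [m.central, n.central, h]

theorem coe_inj {a b : A} : DoubleCentralizer.coe ℂ a = DoubleCentralizer.coe ℂ b ↔ a = b := by
  refine ⟨fun h => eq_of_forall_mul_right_eq fun c => ?_, fun h => h ▸ rfl⟩
  exact congrArg (fun m : 𝓜(ℂ, A) => m.fst c) h

theorem coe_star (a : A) :
    DoubleCentralizer.coe ℂ (star a) = star (DoubleCentralizer.coe ℂ a) :=
  map_star (DoubleCentralizer.coeHom (𝕜 := ℂ) (A := A)) a

theorem coe_mul_coe (a b : A) : DoubleCentralizer.coe ℂ (a * b) =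
    DoubleCentralizer.coe ℂ a * DoubleCentralizer.coe ℂ b :=
  map_mul (DoubleCentralizer.coeHom (𝕜 := ℂ) (A := A)) a b

theorem coe_add (a b : A) : DoubleCentralizer.coe ℂ (a + b) =
    DoubleCentralizer.coe ℂ a + DoubleCentralizer.coe ℂ b :=
  map_add (DoubleCentralizer.coeHom (𝕜 := ℂ) (A := A)) a b

theorem coe_sub (a b : A) : DoubleCentralizer.coe ℂ (a - b) =
    DoubleCentralizer.coe ℂ a - DoubleCentralizer.coe ℂ b :=
  map_sub (DoubleCentralizer.coeHom (𝕜 := ℂ) (A := A)) a b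

theorem coe_smul (c : ℂ) (a : A) : DoubleCentralizer.coe ℂ (c • a) =
    c • DoubleCentralizer.coe ℂ a :=
  map_smul (DoubleCentralizer.coeHom (𝕜 := ℂ) (A := A)) c a

theorem coe_zero : DoubleCentralizer.coe ℂ (0 : A) = 0 :=
  map_zero (DoubleCentralizer.coeHom (𝕜 := ℂ) (A := A))

theorem norm_coe (a : A) : ‖DoubleCentralizer.coe ℂ a‖ = ‖a‖ := by
  rw [← DoubleCentralizer.norm_fst, DoubleCentralizer.coe_fst]
  exact ContinuousLinearMap.opNorm_mul_apply ℂ A a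

theorem norm_fst_apply_le (m : 𝓜(ℂ, A)) (a : A) : ‖m.fst a‖ ≤ ‖m‖ * ‖a‖ := by
  rw [← DoubleCentralizer.norm_fst]; exact m.fst.le_opNorm a

theorem star_fst_apply (m : 𝓜(ℂ, A)) (a : A) : star (m.fst a) = (star m).snd (star a) := by
  rw [DoubleCentralizer.star_snd, star_star]

theorem mul_fst_apply (m n : 𝓜(ℂ, A)) (a : A) : (m * n).fst a = m.fst (n.fst a) := rfl

theorem coe_isSelfAdjoint {x : A} (hx : IsSelfAdjoint x) :
    IsSelfAdjoint (DoubleCentralizer.coe ℂ x) := by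
  rw [IsSelfAdjoint, ← coe_star, hx.star_eq]

end Multiplier

/-! ### Functionals are concentrated on the approximate unit -/

section Concentration

variable {A : Type*} [NonUnitalCStarAlgebra A] [PartialOrder A] [StarOrderedRing A]

theorem mul_self_le_self {e : A} (h0 : 0 ≤ e) (h1 : ‖e‖ ≤ 1) : e * e ≤ e := by
  have hs : CFC.sqrt e * CFC.sqrt e = e := CFC.sqrt_mul_sqrt_self e h0
  have hsa : star (CFC.sqrt e) = CFC.sqrt e := (CFC.sqrt_nonneg e).isSelfAdjoint.star_eq
  have h2 := CStarAlgebra.star_left_conjugate_le_norm_smul (a := CFC.sqrt e) (b := e)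
    (hb := h0.isSelfAdjoint)
  rw [hsa, hs] at h2
  have h3 : CFC.sqrt e * e * CFC.sqrt e = e * e := by
    generalize CFC.sqrt e = r at hs
    simp only [← hs, mul_assoc]
  rw [h3] at h2
  refine h2.trans ?_
  have : (0:A) ≤ (1 - ‖e‖) • e := smul_nonneg (by linarith) h0
  rw [sub_smul, one_smul] at this
  exact sub_nonneg.mp this

/-- The norm estimate for the row `(a, b)` times the column `(e, 1 - e)`, which is a contraction as
`e ^ 2 + (1 - e) ^ 2 ≤ 1`. -/
theorem norm_sq_mul_add_sub_mul_le {e : A} (h0 : 0 ≤ e) (h1 : ‖e‖ ≤ 1) (a b : A) :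
    ‖a * e + (b - b * e)‖ ^ 2 ≤ ‖a‖ ^ 2 + ‖b‖ ^ 2 := by
  have hes : star e = e := h0.isSelfAdjoint.star_eq
  set c := a * e + (b - b * e) with hc
  have he : 0 ≤ e - e * e := sub_nonneg.mpr (mul_self_le_self h0 h1)
  set g := a - a * e - b * e with hg
  have key : a * star a + b * star b - c * star c =
      g * star g + (2 : ℕ) • (a * (e - e * e) * star a) + (2 : ℕ) • (b * (e - e * e) * star b) := by
    simp only [hc, hg, star_add, star_sub, star_mul, hes, mul_add, add_mul, mul_sub, sub_mul,
      mul_assoc, smul_sub, two_smul]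
    abel
  have hle : c * star c ≤ a * star a + b * star b := by
    rw [← sub_nonneg, key]
    refine add_nonneg (add_nonneg (mul_star_self_nonneg g) ?_) ?_
    · exact nsmul_nonneg (star_right_conjugate_nonneg he a) 2
    · exact nsmul_nonneg (star_right_conjugate_nonneg he b) 2
  have := CStarAlgebra.norm_le_norm_of_nonneg_of_le (mul_star_self_nonneg c) hle
  rw [sq, ← CStarRing.norm_self_mul_star]
  refine this.trans ((norm_add_le _ _).trans ?_)
  rw [CStarRing.norm_self_mul_star, CStarRing.norm_self_mul_star, sq, sq]

theorem exists_phase (z : ℂ) : ∃ u : ℂ, ‖u‖ = 1 ∧ u * z = ‖z‖ := by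
  rcases eq_or_ne z 0 with rfl | hz
  · exact ⟨1, by simp, by simp⟩
  · have hz' : (‖z‖ : ℂ) ≠ 0 := by simpa using hz
    refine ⟨(starRingEnd ℂ) z / ‖z‖, ?_, ?_⟩
    · simp [hz]
    · rw [div_mul_eq_mul_div, mul_comm, Complex.mul_conj, Complex.normSq_eq_norm_sq]
      push_cast
      field_simp

/-- The real part of `φ` almost attains the norm of `φ` on the unit ball. -/
theorem exists_almost_norming (φ : StrongDual ℂ A) {η : ℝ} (hη : 0 < η) :
    ∃ a : A, ‖a‖ ≤ 1 ∧ ‖φ‖ - η ≤ (φ a).re := by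
  by_contra! h
  have hneg : ∀ a : A, ‖a‖ ≤ 1 → ‖φ a‖ ≤ ‖φ‖ - η := by
    intro a ha
    obtain ⟨u, hu, hu'⟩ := exists_phase (φ a)
    have := (h (u • a) (by rw [norm_smul, hu, one_mul]; exact ha)).le
    rwa [map_smul, smul_eq_mul, hu', Complex.ofReal_re] at this
  have h0 : 0 ≤ ‖φ‖ - η := (norm_nonneg _).trans (hneg 0 (by simp))
  have : ‖φ‖ ≤ ‖φ‖ - η := by
    exact ContinuousLinearMap.opNorm_le_of_unit_norm h0 fun a ha => hneg a ha.le
  linarith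

/-- A bounded functional is concentrated on the canonical approximate unit: `φ` is the norm limit
of the functionals `b ↦ φ(b e)`. Indeed, if `a` in the unit ball almost attains the norm of `φ`,
then so does `a e`, so that `φ` cannot be large at any `b - b e`, as the row `(a, s b)` times the
column `(e, 1 - e)` has norm at most `√(1 + s²)`. -/
theorem eventually_norm_sub_mul_right_le (φ : StrongDual ℂ A) {ε : ℝ} (hε : 0 < ε) :
    ∀ᶠ e in CStarAlgebra.approximateUnit A, ∀ b : A, ‖φ b - φ (b * e)‖ ≤ ε * ‖b‖ := by
  have hl := CStarAlgebra.increasingApproximateUnit A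
  set N := ‖φ‖ with hN
  have hN0 : 0 ≤ N := norm_nonneg _
  set s := ε / (N + 2) with hs
  have hs0 : 0 < s := by positivity
  have hsε : (N + 2) * s = ε := by rw [hs]; field_simp
  obtain ⟨a, ha1, haN⟩ := exists_almost_norming φ (η := s ^ 2) (by positivity)
  have hlim : Tendsto (fun e => (φ (a * e)).re) (CStarAlgebra.approximateUnit A)
      (𝓝 (φ a).re) :=
    (Complex.continuous_re.tendsto _).comp ((φ.continuous.tendsto a).comp (hl.tendsto_mul_left a))
  filter_upwards [hlim.eventually (lt_mem_nhds (sub_lt_self _ (by positivity : 0 < s ^ 2))),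
    hl.eventually_nonneg, hl.eventually_norm] with e h1 h2 h3 b
  have unit : ∀ b : A, ‖b‖ ≤ 1 → ‖φ b - φ (b * e)‖ ≤ ε := by
    intro b hb
    obtain ⟨u, hu, hu'⟩ := exists_phase (φ b - φ (b * e))
    set b' := ((s : ℂ) * u) • b with hb'
    have hnb : ‖b'‖ ≤ s := by
      rw [hb', norm_smul, norm_mul, hu, mul_one, Complex.norm_real, Real.norm_of_nonneg hs0.le]
      nlinarith
    have hφ : φ (b' - b' * e) = (s * ‖φ b - φ (b * e)‖ : ℝ) := by
      rw [hb', smul_mul_assoc, ← smul_sub, map_smul, map_sub, smul_eq_mul, mul_assoc, hu']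
      push_cast; rfl
    have hc := norm_sq_mul_add_sub_mul_le h2 h3 a b'
    have hc1 : ‖a * e + (b' - b' * e)‖ ≤ 1 + s ^ 2 := by
      have : ‖a‖ ^ 2 + ‖b'‖ ^ 2 ≤ 1 + s ^ 2 := by
        have h4 : ‖a‖ ^ 2 ≤ 1 := by nlinarith [norm_nonneg a]
        have h5 : ‖b'‖ ^ 2 ≤ s ^ 2 := pow_le_pow_left₀ (norm_nonneg _) hnb 2
        linarith
      refine le_of_sq_le_sq (by nlinarith [sq_nonneg s]) (by positivity)
    have hc2 : (φ (a * e + (b' - b' * e))).re ≤ N * (1 + s ^ 2) := by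
      refine (Complex.re_le_norm _).trans ((φ.le_opNorm _).trans ?_)
      exact mul_le_mul_of_nonneg_left hc1 hN0
    rw [map_add, hφ, Complex.add_re, Complex.ofReal_re] at hc2
    have : s * ‖φ b - φ (b * e)‖ ≤ s * ε := by
      rw [← hsε]; nlinarith
    exact le_of_mul_le_mul_left this hs0
  rcases eq_or_ne b 0 with rfl | hb
  · simp
  · have hbn : (0 : ℝ) < ‖b‖ := norm_pos_iff.mpr hb
    have h4 := unit (((‖b‖⁻¹ : ℝ) : ℂ) • b) (by
      rw [norm_smul, Complex.norm_real, Real.norm_of_nonneg (by positivity)]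
      field_simp; exact le_rfl)
    rw [smul_mul_assoc, map_smul, map_smul, ← smul_sub, norm_smul, Complex.norm_real,
      Real.norm_of_nonneg (by positivity)] at h4
    rw [inv_mul_le_iff₀ hbn] at h4
    linarith

end Concentration

/-! ### The strictly continuous extension of a functional -/

section Extension

variable {A : Type*} [NonUnitalCStarAlgebra A] [PartialOrder A] [StarOrderedRing A]

/-- The adjoint functional `a ↦ conj (φ (a⋆))`. -/
def conjDual (φ : StrongDual ℂ A) : StrongDual ℂ A :=
  LinearMap.mkContinuous
    { toFun := fun a => (starRingEnd ℂ) (φ (star a))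
      map_add' := fun a b => by simp
      map_smul' := fun c a => by simp } ‖φ‖ fun a => by
    simpa using φ.le_opNorm (star a)

theorem conjDual_apply (φ : StrongDual ℂ A) (a : A) :
    conjDual φ a = (starRingEnd ℂ) (φ (star a)) := rfl

theorem norm_conjDual_le (φ : StrongDual ℂ A) : ‖conjDual φ‖ ≤ ‖φ‖ :=
  LinearMap.mkContinuous_norm_le _ (norm_nonneg _) _

theorem eventually_norm_sub_mul_left_le (φ : StrongDual ℂ A) {ε : ℝ} (hε : 0 < ε) :
    ∀ᶠ e in CStarAlgebra.approximateUnit A, ∀ b : A, ‖φ b - φ (e * b)‖ ≤ ε * ‖b‖ := by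
  have hl := CStarAlgebra.increasingApproximateUnit A
  filter_upwards [eventually_norm_sub_mul_right_le (conjDual φ) hε, hl.eventually_star_eq]
    with e h he b
  have := h (star b)
  rwa [conjDual_apply, conjDual_apply, star_star, star_mul, he, star_star, ← map_sub,
    RCLike.norm_conj, norm_star] at this

theorem tendsto_fst_mul (m : 𝓜(ℂ, A)) (a : A) :
    Tendsto (fun e => m.fst (e * a)) (CStarAlgebra.approximateUnit A) (𝓝 (m.fst a)) :=
  (m.fst.continuous.tendsto a).comp
    ((CStarAlgebra.increasingApproximateUnit A).tendsto_mul_right a)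

/-- The limit that defines `multExt φ m` exists: `φ(m.fst e)` is within `ε * ‖m‖` of
`φ(m.fst (e * e₀))`, which converges, so that the values form a Cauchy filter. -/
theorem tendsto_multExt (φ : StrongDual ℂ A) (m : 𝓜(ℂ, A)) :
    Tendsto (fun e => φ (m.fst e)) (CStarAlgebra.approximateUnit A) (𝓝 (multExt φ m)) := by
  refine tendsto_nhds_limUnder ?_
  refine cauchy_map_iff_exists_tendsto.mp (Metric.cauchy_iff.mpr ⟨inferInstance, fun ε hε => ?_⟩)
  have hl := CStarAlgebra.increasingApproximateUnit A
  obtain ⟨e₀, he₀⟩ := (eventually_norm_sub_mul_right_le φ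
    (ε := ε / (4 * (‖m‖ + 1))) (by positivity)).exists
  have h1 : Tendsto (fun e => φ (m.fst (e * e₀))) (CStarAlgebra.approximateUnit A)
      (𝓝 (φ (m.fst e₀))) := (φ.continuous.tendsto _).comp (tendsto_fst_mul m e₀)
  have h2 : ∀ᶠ e in CStarAlgebra.approximateUnit A,
      dist (φ (m.fst e)) (φ (m.fst e₀)) < ε / 2 := by
    filter_upwards [h1.eventually (Metric.ball_mem_nhds _ (by positivity : 0 < ε / 4)),
      hl.eventually_norm] with e h3 h4
    have h5 := he₀ (m.fst e)
    rw [← fst_mul] at h5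
    have h6 : ε / (4 * (‖m‖ + 1)) * ‖m.fst e‖ ≤ ε / 4 := by
      have : ‖m.fst e‖ ≤ ‖m‖ + 1 := by
        have := norm_fst_apply_le m e
        nlinarith [norm_nonneg m]
      calc ε / (4 * (‖m‖ + 1)) * ‖m.fst e‖ ≤ ε / (4 * (‖m‖ + 1)) * (‖m‖ + 1) := by gcongr
        _ = ε / 4 := by field_simp
    calc dist (φ (m.fst e)) (φ (m.fst e₀))
        ≤ dist (φ (m.fst e)) (φ (m.fst (e * e₀))) + dist (φ (m.fst (e * e₀))) (φ (m.fst e₀)) :=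
          dist_triangle _ _ _
      _ < ε / 4 + ε / 4 := by
          refine add_lt_add_of_le_of_lt ?_ h3
          rw [dist_eq_norm]; exact h5.trans h6
      _ = ε / 2 := by ring
  refine ⟨_, image_mem_map h2, ?_⟩
  rintro _ ⟨x, hx, rfl⟩ _ ⟨y, hy, rfl⟩
  calc _ ≤ dist (φ (m.fst x)) (φ (m.fst e₀)) + dist (φ (m.fst y)) (φ (m.fst e₀)) :=
        dist_triangle_right _ _ _
    _ < ε / 2 + ε / 2 := add_lt_add hx hy
    _ = ε := by ring

theorem norm_multExt_le (φ : StrongDual ℂ A) (m : 𝓜(ℂ, A)) : ‖multExt φ m‖ ≤ ‖φ‖ * ‖m‖ := by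
  refine le_of_tendsto (tendsto_multExt φ m).norm ?_
  filter_upwards [(CStarAlgebra.increasingApproximateUnit A).eventually_norm] with e he
  refine (φ.le_opNorm _).trans (mul_le_mul_of_nonneg_left ?_ (norm_nonneg _))
  exact (norm_fst_apply_le m e).trans (mul_le_of_le_one_right (norm_nonneg _) he)

/-- `multExt φ` as a bounded functional on the multiplier algebra. -/
def multExtCLM (φ : StrongDual ℂ A) : 𝓜(ℂ, A) →L[ℂ] ℂ :=
  LinearMap.mkContinuous
    { toFun := multExt φ
      map_add' := fun m n => by
        refine tendsto_nhds_unique (tendsto_multExt φ (m + n)) ?_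
        simpa using (tendsto_multExt φ m).add (tendsto_multExt φ n)
      map_smul' := fun c m => by
        refine tendsto_nhds_unique (tendsto_multExt φ (c • m)) ?_
        simpa using (tendsto_multExt φ m).const_mul c } ‖φ‖ (norm_multExt_le φ)

theorem multExt_add (φ : StrongDual ℂ A) (m n : 𝓜(ℂ, A)) :
    multExt φ (m + n) = multExt φ m + multExt φ n := (multExtCLM φ).map_add m n

theorem multExt_sub (φ : StrongDual ℂ A) (m n : 𝓜(ℂ, A)) :
    multExt φ (m - n) = multExt φ m - multExt φ n := (multExtCLM φ).map_sub m n

theorem multExt_smul (φ : StrongDual ℂ A) (c : ℂ) (m : 𝓜(ℂ, A)) :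
    multExt φ (c • m) = c * multExt φ m := (multExtCLM φ).map_smul c m

theorem multExt_zero (φ : StrongDual ℂ A) : multExt φ (0 : 𝓜(ℂ, A)) = 0 := (multExtCLM φ).map_zero

theorem continuous_multExt (φ : StrongDual ℂ A) : Continuous (multExt φ) :=
  (multExtCLM φ).continuous

theorem add_multExt (φ ψ : StrongDual ℂ A) (m : 𝓜(ℂ, A)) :
    multExt (φ + ψ) m = multExt φ m + multExt ψ m :=
  tendsto_nhds_unique (tendsto_multExt (φ + ψ) m) ((tendsto_multExt φ m).add (tendsto_multExt ψ m))

theorem smul_multExt (c : ℂ) (φ : StrongDual ℂ A) (m : 𝓜(ℂ, A)) :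
    multExt (c • φ) m = c * multExt φ m :=
  tendsto_nhds_unique (tendsto_multExt (c • φ) m) ((tendsto_multExt φ m).const_mul c)

theorem sub_multExt (φ ψ : StrongDual ℂ A) (m : 𝓜(ℂ, A)) :
    multExt (φ - ψ) m = multExt φ m - multExt ψ m :=
  tendsto_nhds_unique (tendsto_multExt (φ - ψ) m) ((tendsto_multExt φ m).sub (tendsto_multExt ψ m))

/-- Uniform strict continuity of the extension, with the approximate unit on the right. -/
theorem eventually_norm_multExt_sub_right_le (φ : StrongDual ℂ A) {ε : ℝ} (hε : 0 < ε) :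
    ∀ᶠ e in CStarAlgebra.approximateUnit A, ∀ m : 𝓜(ℂ, A),
      ‖multExt φ m - φ (m.fst e)‖ ≤ ε * ‖m‖ := by
  have hl := CStarAlgebra.increasingApproximateUnit A
  filter_upwards [eventually_norm_sub_mul_right_le φ hε] with e he m
  have h1 : Tendsto (fun d => φ (m.fst (d * e))) (CStarAlgebra.approximateUnit A)
      (𝓝 (φ (m.fst e))) := (φ.continuous.tendsto _).comp (tendsto_fst_mul m e)
  refine le_of_tendsto ((tendsto_multExt φ m).sub h1).norm ?_
  filter_upwards [hl.eventually_norm] with d hd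
  rw [fst_mul]
  refine (he (m.fst d)).trans (mul_le_mul_of_nonneg_left ?_ hε.le)
  exact (norm_fst_apply_le m d).trans (mul_le_of_le_one_right (norm_nonneg _) hd)

/-- Uniform strict continuity of the extension, with the approximate unit on the left. -/
theorem eventually_norm_multExt_sub_left_le (φ : StrongDual ℂ A) {ε : ℝ} (hε : 0 < ε) :
    ∀ᶠ e in CStarAlgebra.approximateUnit A, ∀ m : 𝓜(ℂ, A),
      ‖multExt φ m - φ (m.snd e)‖ ≤ ε * ‖m‖ := by
  have hl := CStarAlgebra.increasingApproximateUnit A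
  filter_upwards [eventually_norm_sub_mul_left_le φ hε] with e he m
  have h1 : Tendsto (fun d => φ (m.snd e * d)) (CStarAlgebra.approximateUnit A)
      (𝓝 (φ (m.snd e))) := (φ.continuous.tendsto _).comp (hl.tendsto_mul_left (m.snd e))
  refine le_of_tendsto ((tendsto_multExt φ m).sub h1).norm ?_
  filter_upwards [hl.eventually_norm] with d hd
  rw [m.central]
  refine (he (m.fst d)).trans (mul_le_mul_of_nonneg_left ?_ hε.le)
  exact (norm_fst_apply_le m d).trans (mul_le_of_le_one_right (norm_nonneg _) hd)

/-- Uniform strict continuity of the extension, with the approximate unit on both sides. -/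
theorem eventually_norm_multExt_sub_both_le (φ : StrongDual ℂ A) {ε : ℝ} (hε : 0 < ε) :
    ∀ᶠ e in CStarAlgebra.approximateUnit A, ∀ m : 𝓜(ℂ, A),
      ‖multExt φ m - φ (e * m.fst e)‖ ≤ ε * ‖m‖ := by
  have hl := CStarAlgebra.increasingApproximateUnit A
  filter_upwards [eventually_norm_multExt_sub_right_le φ (half_pos hε),
    eventually_norm_sub_mul_left_le φ (half_pos hε), hl.eventually_norm] with e h1 h2 h3 m
  have h4 := h2 (m.fst e)
  have h5 : ‖m.fst e‖ ≤ ‖m‖ :=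
    (norm_fst_apply_le m e).trans (mul_le_of_le_one_right (norm_nonneg _) h3)
  calc ‖multExt φ m - φ (e * m.fst e)‖
      ≤ ‖multExt φ m - φ (m.fst e)‖ + ‖φ (m.fst e) - φ (e * m.fst e)‖ :=
        norm_sub_le_norm_sub_add_norm_sub _ _ _
    _ ≤ ε / 2 * ‖m‖ + ε / 2 * ‖m‖ := add_le_add (h1 m) (h4.trans (by gcongr))
    _ = ε * ‖m‖ := by ring

theorem tendsto_of_eventually_norm_sub_le {l : Filter A} {F : A → ℂ} {z : ℂ} {C : ℝ} (hC : 0 ≤ C)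
    (h : ∀ ε : ℝ, 0 < ε → ∀ᶠ e in l, ‖z - F e‖ ≤ ε * C) : Tendsto F l (𝓝 z) := by
  rw [Metric.tendsto_nhds]
  intro ε hε
  filter_upwards [h (ε / (C + 1)) (by positivity)] with e he
  rw [dist_comm, dist_eq_norm]
  refine he.trans_lt ?_
  rw [div_mul_eq_mul_div, div_lt_iff₀ (by positivity)]
  nlinarith

theorem tendsto_multExt_left (φ : StrongDual ℂ A) (m : 𝓜(ℂ, A)) :
    Tendsto (fun e => φ (m.snd e)) (CStarAlgebra.approximateUnit A) (𝓝 (multExt φ m)) :=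
  tendsto_of_eventually_norm_sub_le (norm_nonneg m) fun _ hε =>
    (eventually_norm_multExt_sub_left_le φ hε).mono fun _ he => he m

theorem tendsto_multExt_both (φ : StrongDual ℂ A) (m : 𝓜(ℂ, A)) :
    Tendsto (fun e => φ (e * m.fst e)) (CStarAlgebra.approximateUnit A) (𝓝 (multExt φ m)) :=
  tendsto_of_eventually_norm_sub_le (norm_nonneg m) fun _ hε =>
    (eventually_norm_multExt_sub_both_le φ hε).mono fun _ he => he m

theorem multExt_comp_fst (φ : StrongDual ℂ A) (m n : 𝓜(ℂ, A)) :
    multExt (φ.comp n.fst) m = multExt φ (n * m) := rfl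

theorem multExt_comp_snd (φ : StrongDual ℂ A) (m n : 𝓜(ℂ, A)) :
    multExt (φ.comp n.snd) m = multExt φ (m * n) :=
  tendsto_nhds_unique (tendsto_multExt_left (φ.comp n.snd) m) (tendsto_multExt_left φ (m * n))

theorem eq_of_forall_dual {a b : A} (h : ∀ φ : StrongDual ℂ A, φ a = φ b) : a = b :=
  SeparatingDual.eq_iff_forall_dual_eq (R := ℂ) |>.mpr h

/-- The extensions of the functionals on `A` separate the points of `M(A)`. -/
theorem eq_of_forall_multExt {m n : 𝓜(ℂ, A)} (h : ∀ φ : StrongDual ℂ A, multExt φ m = multExt φ n) :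
    m = n := by
  refine multiplier_ext fun c => eq_of_forall_dual fun φ => ?_
  have := h (φ.comp (DoubleCentralizer.coe ℂ c).snd)
  rwa [multExt_comp_snd, multExt_comp_snd, mul_coe, mul_coe, multExt_coe, multExt_coe] at this

end Extension

/-! ### The order of the multiplier algebra and positive functionals -/

section Positivity

variable {A : Type*} [NonUnitalCStarAlgebra A] [PartialOrder A] [StarOrderedRing A]

/-- The usual order of the C⋆-algebra `M(A)`. -/
instance instPartialOrderMultiplier : PartialOrder 𝓜(ℂ, A) := CStarAlgebra.spectralOrder _

instance instStarOrderedRingMultiplier : StarOrderedRing 𝓜(ℂ, A) :=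
  CStarAlgebra.spectralOrderedRing _

theorem mul_fst_star_mul (m : 𝓜(ℂ, A)) (b c : A) :
    star (m.fst b) * m.fst c = star b * (star m * m).fst c := by
  rw [star_fst_apply, (star m).central]; rfl

/-- Compressing a positive multiplier by an element of `A` gives a positive element of `A`. -/
theorem compress_nonneg {m : 𝓜(ℂ, A)} (hm : 0 ≤ m) (b : A) : 0 ≤ star b * m.fst b := by
  obtain ⟨n, rfl⟩ := CStarAlgebra.nonneg_iff_eq_star_mul_self.mp hm
  rw [← mul_fst_star_mul]
  exact star_mul_self_nonneg _

theorem coe_nonneg_iff {b : A} : 0 ≤ DoubleCentralizer.coe ℂ b ↔ 0 ≤ b := by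
  constructor
  · intro h
    have hl := CStarAlgebra.increasingApproximateUnit A
    have h1 : ∀ c : A, 0 ≤ star c * b * c := fun c => by
      rw [mul_assoc]; exact compress_nonneg h c
    have h2 : ∀ᶠ e in CStarAlgebra.approximateUnit A, 0 ≤ e * b * e := by
      filter_upwards [hl.eventually_star_eq] with e he
      have := h1 e
      rwa [he] at this
    have h3 : Tendsto (fun e => e * b * e) (CStarAlgebra.approximateUnit A) (𝓝 b) := by
      rw [tendsto_iff_norm_sub_tendsto_zero]
      have h4 := (tendsto_iff_norm_sub_tendsto_zero.mp (hl.tendsto_mul_right b)).add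
        (tendsto_iff_norm_sub_tendsto_zero.mp (hl.tendsto_mul_left b))
      rw [add_zero] at h4
      refine squeeze_zero' (Eventually.of_forall fun _ => norm_nonneg _) ?_ h4
      filter_upwards [hl.eventually_norm] with e he
      calc ‖e * b * e - b‖ = ‖e * (b * e - b) + (e * b - b)‖ := by
            rw [mul_sub, ← mul_assoc]; congr 1; abel
        _ ≤ ‖e * b - b‖ + ‖b * e - b‖ := by
            rw [add_comm]
            refine (norm_add_le _ _).trans (add_le_add le_rfl ?_)
            exact (norm_mul_le _ _).trans (mul_le_of_le_one_left (norm_nonneg _) he)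
    exact ge_of_tendsto h3 h2
  · intro h
    obtain ⟨c, rfl⟩ := CStarAlgebra.nonneg_iff_eq_star_mul_self.mp h
    rw [coe_mul_coe, coe_star]
    exact star_mul_self_nonneg _

theorem coe_le_coe_iff {a b : A} :
    DoubleCentralizer.coe ℂ a ≤ DoubleCentralizer.coe ℂ b ↔ a ≤ b := by
  rw [← sub_nonneg, ← coe_sub, coe_nonneg_iff, sub_nonneg]

/-- Positivity of a bounded functional. -/
def IsPositive (φ : StrongDual ℂ A) : Prop := ∀ b : A, 0 ≤ b → 0 ≤ φ b

theorem IsPositive.multExt_nonneg {φ : StrongDual ℂ A} (hφ : IsPositive φ) {m : 𝓜(ℂ, A)}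
    (hm : 0 ≤ m) : 0 ≤ multExt φ m := by
  refine ge_of_tendsto (tendsto_multExt_both φ m) ?_
  filter_upwards [(CStarAlgebra.increasingApproximateUnit A).eventually_star_eq] with e he
  refine hφ _ ?_
  have := compress_nonneg hm e
  rwa [he] at this

theorem IsPositive.multExt_mono {φ : StrongDual ℂ A} (hφ : IsPositive φ) {m n : 𝓜(ℂ, A)}
    (hmn : m ≤ n) : multExt φ m ≤ multExt φ n := by
  rw [← sub_nonneg, ← multExt_sub]
  exact hφ.multExt_nonneg (sub_nonneg.mpr hmn)

/-- `a ↦ φ (n⋆ a n)`. -/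
def conjugate (φ : StrongDual ℂ A) (n : 𝓜(ℂ, A)) : StrongDual ℂ A :=
  (φ.comp (star n).fst).comp n.snd

theorem multExt_conjugate (φ : StrongDual ℂ A) (n m : 𝓜(ℂ, A)) :
    multExt (conjugate φ n) m = multExt φ (star n * m * n) := by
  rw [conjugate, multExt_comp_snd, multExt_comp_fst, mul_assoc]

theorem IsPositive.conjugate {φ : StrongDual ℂ A} (hφ : IsPositive φ) (n : 𝓜(ℂ, A)) :
    IsPositive (conjugate φ n) := by
  intro b hb
  rw [← multExt_coe, multExt_conjugate]
  exact hφ.multExt_nonneg (star_left_conjugate_nonneg (coe_nonneg_iff.mpr hb) n)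

/-- A real functional that is positive and dominates the real part of `φ` on the positive cone, by
the Hahn–Banach theorem. -/
theorem exists_real_dominating (φ : StrongDual ℂ A) :
    ∃ g : A →ₗ[ℝ] ℝ, (∀ x, |g x| ≤ ‖φ‖ * ‖x‖) ∧ ∀ c : A, 0 ≤ c → 0 ≤ g c ∧ (φ c).re ≤ g c := by
  -- a linear `g ≤ N` is bounded by `‖φ‖`, and `g (-c) ≤ min 0 (-(φ c).re)` for `0 ≤ c`
  let N : A → ℝ := fun x => ⨅ p : {c : A // 0 ≤ c} × {d : A // 0 ≤ d},
    (‖φ‖ * ‖x + p.1 + p.2‖ - (φ p.1).re)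
  have hle : ∀ c d : A, 0 ≤ c → 0 ≤ d → ‖c‖ ≤ ‖c + d‖ := fun c d hc hd =>
    CStarAlgebra.norm_le_norm_of_nonneg_of_le hc (le_add_of_nonneg_right hd)
  have hlow : ∀ x : A, ∀ p : {c : A // 0 ≤ c} × {d : A // 0 ≤ d},
      -(‖φ‖ * ‖x‖) ≤ ‖φ‖ * ‖x + p.1 + p.2‖ - (φ p.1).re := by
    rintro x ⟨⟨c, hc⟩, ⟨d, hd⟩⟩
    have h1 : (φ c).re ≤ ‖φ‖ * ‖c‖ := (Complex.re_le_norm _).trans (φ.le_opNorm c)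
    have h2 : ‖c‖ ≤ ‖x + c + d‖ + ‖x‖ := by
      refine (hle c d hc hd).trans ?_
      have : c + d = (x + c + d) - x := by abel
      rw [this]
      exact norm_sub_le _ _
    have := mul_le_mul_of_nonneg_left h2 (norm_nonneg φ)
    dsimp only
    linarith
  have hbdd : ∀ x : A, BddBelow (Set.range fun p : {c : A // 0 ≤ c} × {d : A // 0 ≤ d} =>
      (‖φ‖ * ‖x + p.1 + p.2‖ - (φ p.1).re)) := fun x => by
    refine ⟨-(‖φ‖ * ‖x‖), ?_⟩
    rintro _ ⟨p, rfl⟩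
    exact hlow x p
  have : Nonempty ({c : A // 0 ≤ c} × {d : A // 0 ≤ d}) := ⟨⟨0, le_rfl⟩, ⟨0, le_rfl⟩⟩
  have hN : ∀ x c d : A, 0 ≤ c → 0 ≤ d → N x ≤ ‖φ‖ * ‖x + c + d‖ - (φ c).re :=
    fun x c d hc hd => ciInf_le (hbdd x) (⟨c, hc⟩, ⟨d, hd⟩)
  have hhom : ∀ r : ℝ, 0 < r → ∀ x, N (r • x) ≤ r * N x := by
    intro r hr x
    rw [← div_le_iff₀' hr]
    refine le_ciInf ?_
    rintro ⟨⟨c, hc⟩, ⟨d, hd⟩⟩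
    rw [div_le_iff₀' hr]
    refine (hN (r • x) (r • c) (r • d) (smul_nonneg hr.le hc) (smul_nonneg hr.le hd)).trans
      (le_of_eq ?_)
    rw [← smul_add, ← smul_add, norm_smul, Real.norm_of_nonneg hr.le,
      show φ (r • c) = r • φ c from φ.map_smul_of_tower r c,
      Complex.smul_re, smul_eq_mul]
    ring
  obtain ⟨g, -, hg⟩ := exists_extension_of_le_sublinear (⊥ : A →ₗ.[ℝ] ℝ) N
    (fun r hr x => le_antisymm (hhom r hr x) (by
      have := hhom r⁻¹ (inv_pos.mpr hr) (r • x)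
      rw [smul_smul, inv_mul_cancel₀ hr.ne', one_smul] at this
      rwa [← div_eq_inv_mul, le_div_iff₀' hr] at this))
    (fun x y => by
      refine le_ciInf_add_ciInf ?_
      rintro ⟨⟨c, hc⟩, ⟨d, hd⟩⟩ ⟨⟨c', hc'⟩, ⟨d', hd'⟩⟩
      refine (hN (x + y) (c + c') (d + d') (add_nonneg hc hc') (add_nonneg hd hd')).trans ?_
      have : x + y + (c + c') + (d + d') = (x + c + d) + (y + c' + d') := by abel
      rw [this, map_add, Complex.add_re]
      have := mul_le_mul_of_nonneg_left (norm_add_le (x + c + d) (y + c' + d')) (norm_nonneg φ)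
      dsimp only
      linarith)
    (by
      rintro ⟨x, hx⟩
      have hx0 : x = 0 := (Submodule.mem_bot ℝ).mp hx
      subst hx0
      have : (⊥ : A →ₗ.[ℝ] ℝ) ⟨0, hx⟩ = 0 := LinearPMap.map_zero _
      rw [this]
      refine le_ciInf fun p => ?_
      simpa using hlow 0 p)
  have hub : ∀ x, g x ≤ ‖φ‖ * ‖x‖ := fun x => by
    simpa using (hg x).trans (hN x 0 0 le_rfl le_rfl)
  refine ⟨g, fun x => abs_le.mpr ⟨?_, hub x⟩, fun c hc => ⟨?_, ?_⟩⟩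
  · have := hub (-x)
    rw [map_neg, norm_neg] at this
    linarith
  · have := (hg (-c)).trans (hN (-c) 0 c le_rfl hc)
    rw [map_neg] at this
    simp at this
    linarith
  · have := (hg (-c)).trans (hN (-c) c 0 hc le_rfl)
    rw [map_neg] at this
    simp at this
    linarith

open ComplexStarModule in
/-- The complex linear version of `exists_real_dominating`, obtained by precomposing with the real
part of an element. -/
theorem exists_positive_dominating (φ : StrongDual ℂ A) :
    ∃ ψ : StrongDual ℂ A, IsPositive ψ ∧ ‖ψ‖ ≤ ‖φ‖ ∧
      ∀ c : A, 0 ≤ c → ((φ c).re : ℂ) ≤ ψ c := by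
  obtain ⟨g, hg, hpos⟩ := exists_real_dominating φ
  let h : StrongDual ℝ A := LinearMap.mkContinuous
    (g.comp ((selfAdjoint.submodule ℝ A).subtype.comp (realPart : A →ₗ[ℝ] selfAdjoint A))) ‖φ‖
    fun x => (hg _).trans (mul_le_mul_of_nonneg_left (realPart.norm_le x) (norm_nonneg _))
  have hval : ∀ c : A, 0 ≤ c → (h.extendRCLike : StrongDual ℂ A) c = g c := by
    intro c hc
    have h1 : h c = g c := congrArg g hc.isSelfAdjoint.coe_realPart
    have h2 : h (Complex.I • c) = 0 := by
      have : ((ℜ (Complex.I • c) : selfAdjoint A) : A) = 0 := by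
        rw [realPart_I_smul, hc.isSelfAdjoint.imaginaryPart]; simp
      exact (congrArg g this).trans (map_zero g)
    rw [StrongDual.extendRCLike_apply, h1]
    simp [h2]
  refine ⟨h.extendRCLike, fun c hc => ?_, ?_, fun c hc => ?_⟩
  · rw [hval c hc]
    exact_mod_cast (hpos c hc).1
  · rw [StrongDual.norm_extendRCLike]
    exact LinearMap.mkContinuous_norm_le _ (norm_nonneg _) _
  · rw [hval c hc]
    exact_mod_cast (hpos c hc).2

/-- A Jordan decomposition of a bounded functional, with a bound on the norms. The parts are neither
unique nor orthogonal. -/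
theorem exists_jordan_decomposition (φ : StrongDual ℂ A) :
    ∃ p : Fin 4 → StrongDual ℂ A, (∀ i, IsPositive (p i) ∧ ‖p i‖ ≤ 2 * ‖φ‖) ∧
      φ = (p 0 - p 1) + Complex.I • (p 2 - p 3) := by
  have herm : ∀ χ : StrongDual ℂ A, (∀ c : A, 0 ≤ c → ((χ c).re : ℂ) = χ c) →
      ∃ p q : StrongDual ℂ A, (IsPositive p ∧ ‖p‖ ≤ 2 * ‖χ‖) ∧ (IsPositive q ∧ ‖q‖ ≤ 2 * ‖χ‖) ∧
        χ = p - q := by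
    intro χ hχ
    obtain ⟨ψ, h1, h2, h3⟩ := exists_positive_dominating χ
    refine ⟨ψ, ψ - χ, ⟨h1, by linarith [norm_nonneg χ]⟩, ⟨fun c hc => ?_, ?_⟩, by abel⟩
    · have := h3 c hc
      rw [hχ c hc] at this
      exact sub_nonneg.mpr this
    · exact (norm_sub_le _ _).trans (by linarith)
  have hconj : ∀ c : A, 0 ≤ c → conjDual φ c = (starRingEnd ℂ) (φ c) := fun c hc => by
    rw [conjDual_apply, hc.isSelfAdjoint.star_eq]
  have hn := norm_conjDual_le φ
  set χ₁ : StrongDual ℂ A := (2⁻¹ : ℂ) • (φ + conjDual φ) with hχ₁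
  set χ₂ : StrongDual ℂ A := (-Complex.I * 2⁻¹ : ℂ) • (φ - conjDual φ) with hχ₂
  have hn₁ : ‖χ₁‖ ≤ ‖φ‖ := by
    rw [hχ₁, norm_smul, norm_inv, Complex.norm_ofNat]
    linarith [norm_add_le φ (conjDual φ)]
  have hn₂ : ‖χ₂‖ ≤ ‖φ‖ := by
    rw [hχ₂, norm_smul, norm_mul, norm_neg, Complex.norm_I, norm_inv, Complex.norm_ofNat]
    linarith [norm_sub_le φ (conjDual φ)]
  obtain ⟨p₀, p₁, h₀, h₁, h₀₁⟩ := herm χ₁ fun c hc => by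
    change (((2⁻¹ : ℂ) * (φ c + conjDual φ c)).re : ℂ) = (2⁻¹ : ℂ) * (φ c + conjDual φ c)
    rw [hconj c hc]
    apply Complex.ext <;> simp
  obtain ⟨p₂, p₃, h₂, h₃, h₂₃⟩ := herm χ₂ fun c hc => by
    change (((-Complex.I * 2⁻¹ : ℂ) * (φ c - conjDual φ c)).re : ℂ) =
      (-Complex.I * 2⁻¹ : ℂ) * (φ c - conjDual φ c)
    rw [hconj c hc]
    apply Complex.ext <;> simp
  refine ⟨![p₀, p₁, p₂, p₃], fun i => ?_, ?_⟩
  · fin_cases i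
    · exact ⟨h₀.1, h₀.2.trans (by simpa using hn₁)⟩
    · exact ⟨h₁.1, h₁.2.trans (by simpa using hn₁)⟩
    · exact ⟨h₂.1, h₂.2.trans (by simpa using hn₂)⟩
    · exact ⟨h₃.1, h₃.2.trans (by simpa using hn₂)⟩
  · change φ = (p₀ - p₁) + Complex.I • (p₂ - p₃)
    rw [← h₀₁, ← h₂₃]
    ext c
    change φ c = (2⁻¹ : ℂ) * (φ c + conjDual φ c) +
      Complex.I * ((-Complex.I * 2⁻¹ : ℂ) * (φ c - conjDual φ c))
    linear_combination ((2⁻¹ : ℂ) * (φ c - conjDual φ c)) * Complex.I_sq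

/-- The triangle inequality for the value of a Jordan decomposition. -/
theorem norm_jordan_le (w x y z : ℂ) :
    ‖(w - x) + Complex.I * (y - z)‖ ≤ ‖w‖ + ‖x‖ + ‖y‖ + ‖z‖ := by
  refine (norm_add_le _ _).trans ?_
  rw [norm_mul, Complex.norm_I, one_mul]
  linarith [norm_sub_le w x, norm_sub_le y z]

/-- A linear form on the dual of `A` is bounded as soon as it is bounded on positive functionals. -/
theorem norm_le_of_forall_isPositive (F : StrongDual ℂ A →ₗ[ℂ] ℂ) {C : ℝ} (hC : 0 ≤ C)
    (h : ∀ ψ, IsPositive ψ → ‖F ψ‖ ≤ C * ‖ψ‖) (φ : StrongDual ℂ A) :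
    ‖F φ‖ ≤ 8 * C * ‖φ‖ := by
  obtain ⟨p, hp, hφ⟩ := exists_jordan_decomposition φ
  have h1 : ∀ i, ‖F (p i)‖ ≤ 2 * C * ‖φ‖ := fun i => (h _ (hp i).1).trans <| by
    calc C * ‖p i‖ ≤ C * (2 * ‖φ‖) := mul_le_mul_of_nonneg_left (hp i).2 hC
      _ = 2 * C * ‖φ‖ := by ring
  conv_lhs => rw [hφ]
  rw [map_add, map_smul, map_sub, map_sub, smul_eq_mul]
  refine (norm_jordan_le _ _ _ _).trans ?_
  linarith [h1 0, h1 1, h1 2, h1 3]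

theorem eq_zero_of_forall_isPositive {b : A} (h : ∀ ψ : StrongDual ℂ A, IsPositive ψ → ψ b = 0) :
    b = 0 := by
  refine eq_of_forall_dual fun φ => ?_
  obtain ⟨p, hp, hφ⟩ := exists_jordan_decomposition φ
  rw [hφ]
  simp [h _ (hp _).1]

/-- A positive functional, extended to `M(A)`, in bundled form. -/
def IsPositive.toPositiveLinearMap {ψ : StrongDual ℂ A} (hψ : IsPositive ψ) : 𝓜(ℂ, A) →ₚ[ℂ] ℂ :=
  PositiveLinearMap.mk₀ (multExtCLM ψ).toLinearMap fun _ hm => hψ.multExt_nonneg hm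

theorem IsPositive.toPositiveLinearMap_apply {ψ : StrongDual ℂ A} (hψ : IsPositive ψ)
    (m : 𝓜(ℂ, A)) : hψ.toPositiveLinearMap m = multExt ψ m := rfl

/-- The Cauchy–Schwarz inequality for the extension of a positive functional. -/
theorem IsPositive.norm_multExt_star_mul_sq_le {ψ : StrongDual ℂ A} (hψ : IsPositive ψ)
    (m n : 𝓜(ℂ, A)) : ‖multExt ψ (star m * n)‖ ^ 2 ≤
      (multExt ψ (star m * m)).re * (multExt ψ (star n * n)).re := by
  have h := norm_inner_le_norm (𝕜 := ℂ) (hψ.toPositiveLinearMap.toPreGNS m)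
    (hψ.toPositiveLinearMap.toPreGNS n)
  have h1 := fun m => congrArg Complex.re
    (hψ.toPositiveLinearMap.preGNS_norm_sq (hψ.toPositiveLinearMap.toPreGNS m))
  rw [PositiveLinearMap.preGNS_inner_def] at h
  simp only [PositiveLinearMap.ofPreGNS_toPreGNS, hψ.toPositiveLinearMap_apply] at h h1
  have h2 := pow_le_pow_left₀ (norm_nonneg _) h 2
  rw [mul_pow] at h2
  rw [← h1 m, ← h1 n]
  norm_cast

/-- The Cauchy–Schwarz inequality, combined with the inequality of the means with weights `s` and
`s⁻¹`. -/
theorem IsPositive.norm_multExt_star_mul_le {ψ : StrongDual ℂ A} (hψ : IsPositive ψ)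
    (m n : 𝓜(ℂ, A)) {s : ℝ} (hs : 0 < s) : ‖multExt ψ (star m * n)‖ ≤
      s * (multExt ψ (star m * m)).re + s⁻¹ * (multExt ψ (star n * n)).re := by
  have h := hψ.norm_multExt_star_mul_sq_le m n
  have h1 : 0 ≤ (multExt ψ (star m * m)).re :=
    (Complex.nonneg_iff.mp (hψ.multExt_nonneg (star_mul_self_nonneg m))).1
  have h2 : 0 ≤ (multExt ψ (star n * n)).re :=
    (Complex.nonneg_iff.mp (hψ.multExt_nonneg (star_mul_self_nonneg n))).1
  set x := (multExt ψ (star m * m)).re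
  set y := (multExt ψ (star n * n)).re
  refine le_of_sq_le_sq (h.trans ?_) (by positivity)
  have h3 : s * x * (s⁻¹ * y) = x * y := by field_simp
  nlinarith [sq_nonneg (s * x), sq_nonneg (s⁻¹ * y), mul_nonneg h1 h2]

theorem IsPositive.multExt_star {ψ : StrongDual ℂ A} (hψ : IsPositive ψ) (m : 𝓜(ℂ, A)) :
    multExt ψ (star m) = (starRingEnd ℂ) (multExt ψ m) :=
  map_star hψ.toPositiveLinearMap m

theorem IsPositive.multExt_eq_re {ψ : StrongDual ℂ A} (hψ : IsPositive ψ) {m : 𝓜(ℂ, A)}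
    (hm : IsSelfAdjoint m) : multExt ψ m = ((multExt ψ m).re : ℂ) := by
  have := hψ.multExt_star m
  rw [hm.star_eq] at this
  exact (Complex.conj_eq_iff_re.mp this.symm).symm

end Positivity

/-! ### Weak measurability in separable Banach spaces -/

section Pettis

variable {E : Type*} [NormedAddCommGroup E] [NormedSpace ℂ E] [TopologicalSpace.SeparableSpace E]

variable (E) in
/-- The dual of a separable space contains a sequence that separates points. -/
theorem exists_seq_dual_separating :
    ∃ φ : ℕ → StrongDual ℂ E, ∀ x : E, (∀ j, φ j x = 0) → x = 0 := by
  choose g hg1 hg2 using fun x : E => exists_dual_vector'' ℂ x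
  refine ⟨fun j => g (TopologicalSpace.denseSeq E j), fun x hx => ?_⟩
  have key : ∀ j, ‖x‖ ≤ 2 * ‖x - TopologicalSpace.denseSeq E j‖ := by
    intro j
    set d := TopologicalSpace.denseSeq E j
    have h1 : ‖d‖ ≤ ‖d - x‖ := by
      have h2 : g d (d - x) = ‖d‖ := by rw [map_sub, hx j, sub_zero]; exact hg2 d
      have h3 := (g d).le_opNorm (d - x)
      rw [h2] at h3
      simp only [Complex.norm_real, norm_norm] at h3
      exact h3.trans (mul_le_of_le_one_left (norm_nonneg _) (hg1 d))
    rw [norm_sub_rev] at h1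
    linarith [norm_le_norm_add_norm_sub' x d]
  by_contra hne
  have hpos : 0 < ‖x‖ / 3 := by have := norm_pos_iff.mpr hne; positivity
  obtain ⟨y, hy, j, rfl⟩ := Metric.dense_iff.mp (TopologicalSpace.denseRange_denseSeq E) x _ hpos
  have h1 := key j
  rw [Metric.mem_ball, dist_comm, dist_eq_norm] at hy
  linarith [norm_pos_iff.mpr hne]

/-- Pettis' measurability theorem for separable Banach spaces. -/
theorem aestronglyMeasurable_of_forall_dual [CompleteSpace E] {T : Type*} [MeasurableSpace T]
    {μ : Measure T} {g : T → E}
    (h : ∀ φ : StrongDual ℂ E, AEStronglyMeasurable (fun t => φ (g t)) μ) :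
    AEStronglyMeasurable g μ := by
  borelize E
  have := UniformSpace.secondCountable_of_separable E
  obtain ⟨φ, hφ⟩ := exists_seq_dual_separating E
  have hc : Continuous fun (x : E) (j : ℕ) => φ j x := by fun_prop
  have hinj : Function.Injective fun (x : E) (j : ℕ) => φ j x := by
    intro x y hxy
    refine sub_eq_zero.mp (hφ (x - y) fun j => ?_)
    rw [map_sub, sub_eq_zero]
    exact congrFun hxy j
  have hm : AEMeasurable ((fun (x : E) (j : ℕ) => φ j x) ∘ g) μ :=
    aemeasurable_pi_iff.mpr fun j => (h (φ j)).aemeasurable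
  exact ((hc.measurableEmbedding hinj).aemeasurable_comp_iff.mp hm).aestronglyMeasurable

/-- A weakly integrable function `p` is carried by an increasing sequence of sets of finite measure on
which it and another given function `k` are bounded, and therefore Bochner integrable. -/
theorem exists_exhaustion [CompleteSpace E] {T : Type*} [MeasurableSpace T]
    {μ : Measure T} {p k : T → E} (hp : ∀ φ : StrongDual ℂ E, Integrable (fun t => φ (p t)) μ)
    (hk : AEStronglyMeasurable k μ) :
    ∃ S : ℕ → Set T, (∀ n, MeasurableSet (S n)) ∧ Monotone S ∧ (∀ n, IntegrableOn p (S n) μ) ∧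
      (∀ n, IntegrableOn k (S n) μ) ∧ ∀ᵐ t ∂μ, t ∉ ⋃ n, S n → p t = 0 := by
  have hpm : AEStronglyMeasurable p μ :=
    aestronglyMeasurable_of_forall_dual fun φ => (hp φ).aestronglyMeasurable
  obtain ⟨φ, hφ⟩ := exists_seq_dual_separating E
  have hp' := hpm.stronglyMeasurable_mk
  have hk' := hk.stronglyMeasurable_mk
  set p' := hpm.mk p
  set k' := hk.mk k
  -- by Chebyshev's inequality, the sets `B n j` have finite measure
  let B : ℕ → ℕ → Set T := fun n j => {t | (1 : ℝ) / (n + 1) ≤ ‖φ j (p' t)‖}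
  have hBm : ∀ n j, MeasurableSet (B n j) := fun n j =>
    measurableSet_le measurable_const
      ((φ j).continuous.comp_stronglyMeasurable hp').norm.measurable
  have hBfin : ∀ n j, μ (B n j) < ∞ := fun n j => by
    have hi : Integrable (fun t => φ j (p' t)) μ := (hp (φ j)).congr <| by
      filter_upwards [hpm.ae_eq_mk] with t ht
      rw [ht]
    exact hi.measure_norm_ge_lt_top (by positivity)
  let S : ℕ → Set T := fun n =>
    (⋃ j ∈ Finset.range n, B n j) ∩ ({t | ‖p' t‖ ≤ n} ∩ {t | ‖k' t‖ ≤ n})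
  have hSm : ∀ n, MeasurableSet (S n) := fun n =>
    (Finset.measurableSet_biUnion _ fun j _ => hBm n j).inter
      ((measurableSet_le hp'.norm.measurable measurable_const).inter
        (measurableSet_le hk'.norm.measurable measurable_const))
  have hSfin : ∀ n, μ (S n) < ∞ := fun n =>
    (measure_mono Set.inter_subset_left).trans_lt
      (measure_biUnion_lt_top (Finset.finite_toSet _) fun j _ => hBfin n j)
  have hint : ∀ (g g' : T → E), StronglyMeasurable g' → g =ᵐ[μ] g' →
      (∀ n, ∀ t ∈ S n, ‖g' t‖ ≤ n) → ∀ n, IntegrableOn g (S n) μ := by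
    intro g g' hg' hgg' hb n
    have : IntegrableOn g' (S n) μ := by
      refine Measure.integrableOn_of_bounded (M := n) (hSfin n).ne hg'.aestronglyMeasurable ?_
      exact ae_restrict_of_forall_mem (hSm n) (hb n)
    exact this.congr (ae_restrict_of_ae hgg'.symm)
  refine ⟨S, hSm, ?_, hint p p' hp' hpm.ae_eq_mk fun n t ht => ht.2.1,
    hint k k' hk' hk.ae_eq_mk fun n t ht => ht.2.2, ?_⟩
  · intro n m hnm t ht
    obtain ⟨h1, h2, h3⟩ := ht
    have hnm' : (n : ℝ) ≤ m := by exact_mod_cast hnm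
    refine ⟨?_, le_trans (Set.mem_ofPred.mp h2) hnm', le_trans (Set.mem_ofPred.mp h3) hnm'⟩
    simp only [Set.mem_iUnion, Finset.mem_range] at h1 ⊢
    obtain ⟨j, hj, hj'⟩ := h1
    refine ⟨j, by omega, le_trans ?_ (Set.mem_ofPred.mp hj')⟩
    exact one_div_le_one_div_of_le (by positivity) (by linarith)
  · filter_upwards [hpm.ae_eq_mk] with t ht hmem
    rw [ht]
    refine hφ _ fun j => ?_
    by_contra hj
    refine hmem (Set.mem_iUnion.mpr ?_)
    obtain ⟨n₁, hn₁⟩ := exists_nat_one_div_lt (norm_pos_iff.mpr hj)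
    obtain ⟨n₂, hn₂⟩ := exists_nat_ge ‖p' t‖
    obtain ⟨n₃, hn₃⟩ := exists_nat_ge ‖k' t‖
    refine ⟨n₁ + n₂ + n₃ + j + 1, ?_, ?_, ?_⟩
    · simp only [Set.mem_iUnion, Finset.mem_range]
      refine ⟨j, by omega, le_trans ?_ hn₁.le⟩
      refine one_div_le_one_div_of_le (by positivity) ?_
      push_cast
      linarith [Nat.cast_nonneg (α := ℝ) n₂, Nat.cast_nonneg (α := ℝ) n₃,
        Nat.cast_nonneg (α := ℝ) j]
    · refine le_trans hn₂ ?_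
      norm_cast; omega
    · refine le_trans hn₃ ?_
      norm_cast; omega

end Pettis

/-! ### Weak limits in a C⋆-algebra -/

section WeakLimits

variable {A : Type*} [NonUnitalCStarAlgebra A] [PartialOrder A] [StarOrderedRing A]

/-- A noncommutative Dini theorem: a weakly convergent increasing sequence converges in norm, since
by Mazur's theorem its limit is a norm limit of convex combinations. -/
theorem tendsto_of_monotone_of_weak {s : ℕ → A} {l : A} (hs : Monotone s)
    (h : ∀ φ : StrongDual ℂ A, Tendsto (fun n => φ (s n)) atTop (𝓝 (φ l))) :
    Tendsto s atTop (𝓝 l) := by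
  have weak : ∀ C : Set A, Convex ℝ C → IsClosed C → (∀ᶠ n in atTop, s n ∈ C) → l ∈ C := by
    intro C hC hC' hsC
    by_contra hl
    obtain ⟨f, u, hf, hu⟩ := RCLike.geometric_hahn_banach_closed_point (𝕜 := ℂ) hC hC' hl
    have h1 : Tendsto (fun n => (f (s n)).re) atTop (𝓝 (f l).re) :=
      (Complex.continuous_re.tendsto _).comp (h f)
    have h2 : (f l).re ≤ u := le_of_tendsto h1 (hsC.mono fun n hn => (hf _ hn).le)
    exact absurd hu (not_lt.mpr h2)
  have hle : ∀ n, s n ≤ l := fun n =>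
    weak (Set.Ici (s n)) (convex_Ici _) isClosed_Ici
      (eventually_atTop.mpr ⟨n, fun m hm => hs hm⟩)
  rw [Metric.tendsto_atTop]
  intro ε hε
  have h1 : l ∈ closure {x | ∃ n, x ≤ s n} := by
    refine weak _ (Convex.closure ?_) isClosed_closure
      (Eventually.of_forall fun n => subset_closure ⟨n, le_rfl⟩)
    rintro x ⟨n, hn⟩ y ⟨m, hm⟩ a b ha hb hab
    refine ⟨max n m, ?_⟩
    calc a • x + b • y ≤ a • s (max n m) + b • s (max n m) :=
          add_le_add (smul_le_smul_of_nonneg_left (hn.trans (hs (le_max_left _ _))) ha)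
            (smul_le_smul_of_nonneg_left (hm.trans (hs (le_max_right _ _))) hb)
      _ = s (max n m) := by rw [← add_smul, hab, one_smul]
  obtain ⟨x, ⟨n, hn⟩, hx⟩ := Metric.mem_closure_iff.mp h1 ε hε
  refine ⟨n, fun m hm => ?_⟩
  rw [dist_comm, dist_eq_norm]
  rw [dist_eq_norm] at hx
  refine lt_of_le_of_lt ?_ hx
  exact CStarAlgebra.norm_le_norm_of_nonneg_of_le (sub_nonneg.mpr (hle m))
    (sub_le_sub_left (hn.trans (hs hm)) l)

/-- The norm closedness of `A` in its bidual: a linear form on the dual of `A` that is a uniform limit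
of evaluations is an evaluation. -/
theorem exists_eq_apply_of_approx (F : StrongDual ℂ A →ₗ[ℂ] ℂ)
    (h : ∀ ε : ℝ, 0 < ε → ∃ b : A, ∀ φ : StrongDual ℂ A, ‖F φ - φ b‖ ≤ ε * ‖φ‖) :
    ∃ b : A, ∀ φ : StrongDual ℂ A, F φ = φ b := by
  choose! b hb using h
  have hdist : ∀ ε δ : ℝ, 0 < ε → 0 < δ → ‖b ε - b δ‖ ≤ ε + δ := by
    intro ε δ hε hδ
    refine NormedSpace.norm_le_dual_bound ℂ _ (by positivity) fun φ => ?_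
    have : φ (b ε - b δ) = (F φ - φ (b δ)) - (F φ - φ (b ε)) := by rw [map_sub]; ring
    rw [this]
    refine (norm_sub_le _ _).trans ?_
    linarith [hb ε hε φ, hb δ hδ φ]
  have hpos : ∀ n : ℕ, (0 : ℝ) < 1 / ((n : ℝ) + 1) := fun n => by positivity
  have hcau : CauchySeq fun n : ℕ => b (1 / ((n : ℝ) + 1)) := by
    refine cauchySeq_of_le_tendsto_0 (fun N : ℕ => 2 * (1 / ((N : ℝ) + 1))) ?_ ?_
    · intro n m N hn hm
      rw [dist_eq_norm]
      refine (hdist _ _ (hpos n) (hpos m)).trans ?_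
      have h1 : 1 / ((n : ℝ) + 1) ≤ 1 / ((N : ℝ) + 1) :=
        one_div_le_one_div_of_le (by positivity) (by have : (N : ℝ) ≤ n := by exact_mod_cast hn
                                                     linarith)
      have h2 : 1 / ((m : ℝ) + 1) ≤ 1 / ((N : ℝ) + 1) :=
        one_div_le_one_div_of_le (by positivity) (by have : (N : ℝ) ≤ m := by exact_mod_cast hm
                                                     linarith)
      linarith
    · have := (tendsto_one_div_add_atTop_nhds_zero_nat (𝕜 := ℝ)).const_mul 2
      rwa [mul_zero] at this
  obtain ⟨c, hc⟩ := cauchySeq_tendsto_of_complete hcau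
  refine ⟨c, fun φ => ?_⟩
  refine (tendsto_nhds_unique ((φ.continuous.tendsto c).comp hc) ?_).symm
  rw [tendsto_iff_norm_sub_tendsto_zero]
  have h0 := (tendsto_one_div_add_atTop_nhds_zero_nat (𝕜 := ℝ)).mul_const ‖φ‖
  rw [zero_mul] at h0
  refine squeeze_zero (fun _ => norm_nonneg _) (fun n => ?_) h0
  rw [norm_sub_rev]
  exact hb _ (hpos n) φ

end WeakLimits

/-! ### Integrals of compressed fields -/

section WeakIntegral

variable {A : Type*} [NonUnitalCStarAlgebra A] [PartialOrder A] [StarOrderedRing A]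

/-- The sandwich `a⋆ X a` is controlled by `a⋆ a` under positive functionals. -/
theorem IsPositive.norm_multExt_sandwich_le {ψ : StrongDual ℂ A} (hψ : IsPositive ψ)
    {X : 𝓜(ℂ, A)} (hX : IsSelfAdjoint X) {C : ℝ} (hC : ‖X‖ ≤ C) (a : 𝓜(ℂ, A)) :
    ‖multExt ψ (star a * X * a)‖ ≤ C * (multExt ψ (star a * a)).re := by
  have hpos : 0 ≤ (multExt ψ (star a * a)).re :=
    (Complex.nonneg_iff.mp (hψ.multExt_nonneg (star_mul_self_nonneg a))).1
  have hsm : ∀ r : ℝ, (multExt ψ (r • (star a * a))).re = r * (multExt ψ (star a * a)).re := by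
    intro r
    have : r • (star a * a) = (r : ℂ) • (star a * a) := (Complex.coe_smul r _).symm
    rw [this, multExt_smul, Complex.re_ofReal_mul]
  have key : ∀ Y : 𝓜(ℂ, A), IsSelfAdjoint Y →
      (multExt ψ (star a * Y * a)).re ≤ ‖Y‖ * (multExt ψ (star a * a)).re := by
    intro Y hY
    have h := hψ.multExt_mono (CStarAlgebra.star_left_conjugate_le_norm_smul (a := a) (hb := hY))
    rw [← hsm]
    exact (Complex.le_def.mp h).1
  rw [hψ.multExt_eq_re (hX.conjugate' a), Complex.norm_real]
  refine abs_le.mpr ⟨?_, (key X hX).trans (mul_le_mul_of_nonneg_right hC hpos)⟩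
  have h := key (-X) hX.neg
  have h2 : star a * -X * a = (0 : 𝓜(ℂ, A)) - star a * X * a := by simp
  rw [h2, multExt_sub, multExt_zero, zero_sub, Complex.neg_re, norm_neg] at h
  have := mul_le_mul_of_nonneg_right hC hpos
  linarith

variable {T : Type*} [MeasurableSpace T] {μ : Measure T}

/-- Integration of a weakly integrable field, as a linear form on the dual of `A`. -/
def weakIntegral (W : T → 𝓜(ℂ, A)) (hW : ∀ φ, Integrable (fun t => multExt φ (W t)) μ) :
    StrongDual ℂ A →ₗ[ℂ] ℂ where
  toFun φ := ∫ t, multExt φ (W t) ∂μ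
  map_add' φ ψ := by
    simp only [add_multExt]
    exact integral_add (hW φ) (hW ψ)
  map_smul' c φ := by
    simp only [smul_multExt]
    exact integral_const_mul c _

theorem weakIntegral_apply (W : T → 𝓜(ℂ, A))
    (hW : ∀ φ, Integrable (fun t => multExt φ (W t)) μ) (φ : StrongDual ℂ A) :
    weakIntegral W hW φ = ∫ t, multExt φ (W t) ∂μ := rfl

variable {a : T → 𝓜(ℂ, A)} {X : T → 𝓜(ℂ, A)} {C : ℝ}

theorem IsUnitalColumnField.integrable (ha : IsUnitalColumnField μ a) (φ : StrongDual ℂ A) :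
    Integrable (fun t => multExt φ (star (a t) * a t)) μ := (ha.integral_eq_one φ).1

theorem IsUnitalColumnField.integral_re (ha : IsUnitalColumnField μ a) (φ : StrongDual ℂ A) :
    ∫ t, (multExt φ (star (a t) * a t)).re ∂μ = (multExt φ 1).re := by
  rw [(ha.integral_eq_one φ).2]
  exact _root_.integral_re (ha.integrable φ)

theorem IsUnitalColumnField.integral_re_le [Nonempty T] (ha : IsUnitalColumnField μ a)
    (ψ : StrongDual ℂ A) : ∫ t, (multExt ψ (star (a t) * a t)).re ∂μ ≤ ‖ψ‖ := by
  rw [ha.integral_re]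
  refine (Complex.re_le_norm _).trans ((norm_multExt_le ψ 1).trans ?_)
  refine mul_le_of_le_one_right (norm_nonneg _) ?_
  rcases subsingleton_or_nontrivial 𝓜(ℂ, A) with h | h
  · rw [Subsingleton.elim (1 : 𝓜(ℂ, A)) 0, norm_zero]; exact zero_le_one
  · exact norm_one.le

/-- A bounded weak* measurable field, compressed by a unital column field, is weakly integrable. -/
theorem integrable_sandwich (ha : IsUnitalColumnField μ a) (hX : ∀ t, IsSelfAdjoint (X t))
    (hC : ∀ t, ‖X t‖ ≤ C) (hm : WeakStarMeasurable μ fun t => star (a t) * X t * a t)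
    (φ : StrongDual ℂ A) : Integrable (fun t => multExt φ (star (a t) * X t * a t)) μ := by
  obtain ⟨p, hp, hφ⟩ := exists_jordan_decomposition φ
  have h1 : ∀ i, Integrable (fun t => multExt (p i) (star (a t) * X t * a t)) μ := fun i =>
    ((ha.integrable (p i)).re.const_mul C).mono' (hm _) (Eventually.of_forall fun t =>
      (hp i).1.norm_multExt_sandwich_le (hX t) (hC t) (a t))
  have h2 := ((h1 0).sub (h1 1)).add (((h1 2).sub (h1 3)).const_mul Complex.I)
  refine h2.congr (Eventually.of_forall fun t => ?_)
  change _ = multExt φ (star (a t) * X t * a t)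
  conv_rhs => rw [hφ, add_multExt, smul_multExt, sub_multExt, sub_multExt]
  rfl

theorem norm_weakIntegral_sandwich_le [Nonempty T] (ha : IsUnitalColumnField μ a)
    (hX : ∀ t, IsSelfAdjoint (X t)) (hC : ∀ t, ‖X t‖ ≤ C)
    (hW : ∀ φ, Integrable (fun t => multExt φ (star (a t) * X t * a t)) μ) (φ : StrongDual ℂ A) :
    ‖weakIntegral _ hW φ‖ ≤ 8 * C * ‖φ‖ := by
  have hC0 : 0 ≤ C := (norm_nonneg _).trans (hC (Classical.arbitrary T))
  refine norm_le_of_forall_isPositive _ hC0 (fun ψ hψ => ?_) φ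
  rw [weakIntegral_apply]
  calc ‖∫ t, multExt ψ (star (a t) * X t * a t) ∂μ‖
      ≤ ∫ t, C * (multExt ψ (star (a t) * a t)).re ∂μ :=
        norm_integral_le_of_norm_le ((ha.integrable ψ).re.const_mul C)
          (Eventually.of_forall fun t => hψ.norm_multExt_sandwich_le (hX t) (hC t) (a t))
    _ = C * ∫ t, (multExt ψ (star (a t) * a t)).re ∂μ := integral_const_mul _ _
    _ ≤ C * ‖ψ‖ := mul_le_mul_of_nonneg_left (ha.integral_re_le ψ) hC0

/-- The tail estimate: by Cauchy–Schwarz, `ψ(a⋆ X a c)` is controlled by an arbitrarily small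
multiple of `ψ(a⋆ a)` together with a multiple of `ψ(c⋆ a⋆ a c)`. -/
theorem IsPositive.norm_multExt_sandwich_mul_le {ψ : StrongDual ℂ A} (hψ : IsPositive ψ)
    {X : 𝓜(ℂ, A)} (hX : IsSelfAdjoint X) {C : ℝ} (hC : ‖X‖ ≤ C) (a c : 𝓜(ℂ, A)) {s : ℝ}
    (hs : 0 < s) : ‖multExt ψ (star a * X * a * c)‖ ≤ s * (C ^ 2 * (multExt ψ (star a * a)).re) +
      s⁻¹ * (multExt ψ (star c * (star a * a) * c)).re := by
  have h := hψ.norm_multExt_star_mul_le (X * a) (a * c) hs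
  have e1 : star (X * a) * (a * c) = star a * X * a * c := by
    rw [star_mul, hX.star_eq]; noncomm_ring
  have e2 : star (X * a) * (X * a) = star a * (X * X) * a := by
    rw [star_mul, hX.star_eq]; noncomm_ring
  have e3 : star (a * c) * (a * c) = star c * (star a * a) * c := by
    rw [star_mul]; noncomm_ring
  rw [e1, e2, e3] at h
  refine h.trans (add_le_add (mul_le_mul_of_nonneg_left ?_ hs.le) le_rfl)
  refine (Complex.re_le_norm _).trans (hψ.norm_multExt_sandwich_le ?_ ?_ a)
  · rw [IsSelfAdjoint, star_mul, hX.star_eq]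
  · rw [sq]
    exact (norm_mul_le _ _).trans (mul_le_mul hC hC (norm_nonneg _) ((norm_nonneg _).trans hC))

/-- The weak integral of `a⋆ X a c`, for `c ∈ A`, lies in `A`. On the sets `S n` of an exhaustion, it
is a Bochner integral. The contribution of the complement is small uniformly on bounded sets of
functionals: by Cauchy–Schwarz it is controlled by the integral of `c⋆ a⋆ a c` over the complement
of `S n`, which tends to `0` in norm. -/
theorem exists_weakIntegral_mul [TopologicalSpace.SeparableSpace A] [Nonempty T]
    (ha : IsUnitalColumnField μ a) (hX : ∀ t, IsSelfAdjoint (X t)) (hC : ∀ t, ‖X t‖ ≤ C)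
    (hW : ∀ φ, Integrable (fun t => multExt φ (star (a t) * X t * a t)) μ) (c : A) :
    ∃ b : A, ∀ φ : StrongDual ℂ A, ∫ t, φ ((star (a t) * X t * a t).fst c) ∂μ = φ b := by
  set k : T → A := fun t => (star (a t) * X t * a t).fst c with hk
  set p : T → A := fun t => star c * (star (a t) * a t).fst c with hp
  have hC0 : 0 ≤ C := (norm_nonneg _).trans (hC (Classical.arbitrary T))
  have hkφ : ∀ (φ : StrongDual ℂ A) t, φ (k t) =
      multExt φ (star (a t) * X t * a t * DoubleCentralizer.coe ℂ c) := fun φ t => by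
    rw [mul_coe, multExt_coe]
  have hpφ : ∀ (φ : StrongDual ℂ A) t, φ (p t) = multExt φ (star (DoubleCentralizer.coe ℂ c) *
      (star (a t) * a t) * DoubleCentralizer.coe ℂ c) := fun φ t => by
    rw [mul_assoc, mul_coe, ← coe_star, ← coe_mul_coe, multExt_coe]
  have hki : ∀ φ : StrongDual ℂ A, Integrable (fun t => φ (k t)) μ := fun φ =>
    (hW (φ.comp (DoubleCentralizer.coe ℂ c).snd)).congr <| Eventually.of_forall fun t => by
      simp only [hkφ]; rw [multExt_comp_snd]
  have hpc : ∀ (φ : StrongDual ℂ A) t, φ (p t) =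
      multExt (conjugate φ (DoubleCentralizer.coe ℂ c)) (star (a t) * a t) := fun φ t => by
    rw [hpφ, multExt_conjugate]
  have hpi : ∀ φ : StrongDual ℂ A, Integrable (fun t => φ (p t)) μ := fun φ => by
    simp only [hpc]
    exact ha.integrable _
  have hpint : ∀ φ : StrongDual ℂ A, ∫ t, φ (p t) ∂μ = φ (star c * c) := fun φ => by
    simp only [hpc]
    rw [← (ha.integral_eq_one _).2, multExt_conjugate, mul_one, ← coe_star, ← coe_mul_coe,
      multExt_coe]
  obtain ⟨S, hSm, hSmono, hpS, hkS, hSc⟩ := exists_exhaustion hpi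
    (aestronglyMeasurable_of_forall_dual fun φ => (hki φ).aestronglyMeasurable)
  have hp0 : ∀ t, 0 ≤ p t := fun t => compress_nonneg (star_mul_self_nonneg (a t)) c
  -- the integrals of `p` over the sets `S n` increase to `c⋆ c`, in norm
  have hlim : Tendsto (fun n => ∫ t in S n, p t ∂μ) atTop (𝓝 (star c * c)) := by
    refine tendsto_of_monotone_of_weak (fun n m hnm => ?_) fun φ => ?_
    · rw [← sub_nonneg]
      refine (integral_nonneg (μ := μ.restrict (S m \ S n)) hp0).trans_eq ?_
      exact setIntegral_sdiff (hSm n) (hpS m) (hSmono hnm)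
    · have h1 := tendsto_setIntegral_of_monotone (f := fun t => φ (p t)) hSm hSmono
        (hpi φ).integrableOn
      rw [setIntegral_eq_integral_of_ae_compl_eq_zero (by
        filter_upwards [hSc] with t ht h; rw [ht h, map_zero]), hpint] at h1
      refine h1.congr fun n => ?_
      exact φ.integral_comp_comm (hpS n)
  let F : StrongDual ℂ A →ₗ[ℂ] ℂ :=
    { toFun := fun φ => ∫ t, φ (k t) ∂μ
      map_add' := fun φ ψ => integral_add (hki φ) (hki ψ)
      map_smul' := fun r φ => integral_const_mul r _ }
  refine exists_eq_apply_of_approx F fun ε hε => ?_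
  set s : ℝ := ε / (16 * (C ^ 2 + 1)) with hs
  have hs0 : 0 < s := by positivity
  obtain ⟨n, hn⟩ := (Metric.tendsto_atTop.mp hlim (s * (ε / 16)) (by positivity))
  have hn' := hn n le_rfl
  rw [dist_comm, dist_eq_norm] at hn'
  refine ⟨∫ t in S n, k t ∂μ, fun φ => ?_⟩
  let G : StrongDual ℂ A →ₗ[ℂ] ℂ :=
    F - (ContinuousLinearMap.apply ℂ ℂ (∫ t in S n, k t ∂μ)).toLinearMap
  have hG : ∀ φ : StrongDual ℂ A, G φ = ∫ t in (S n)ᶜ, φ (k t) ∂μ := fun φ => by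
    have h1 := integral_add_compl (hSm n) (hki φ)
    have h2 : ∫ t in S n, φ (k t) ∂μ = φ (∫ t in S n, k t ∂μ) := φ.integral_comp_comm (hkS n)
    change (∫ t, φ (k t) ∂μ) - φ (∫ t in S n, k t ∂μ) = _
    rw [← h1, h2]; ring
  have hbound : ∀ ψ, IsPositive ψ → ‖G ψ‖ ≤ ε / 8 * ‖ψ‖ := by
    intro ψ hψ
    rw [hG]
    have hre : ∀ t, (ψ (p t)).re = (multExt ψ (star (DoubleCentralizer.coe ℂ c) *
      (star (a t) * a t) * DoubleCentralizer.coe ℂ c)).re := fun t => by rw [hpφ]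
    have i1 : Integrable (fun t => s * (C ^ 2 * (multExt ψ (star (a t) * a t)).re)) μ :=
      ((ha.integrable ψ).re.const_mul _).const_mul _
    have i2 : Integrable (fun t => s⁻¹ * (ψ (p t)).re) μ := (hpi ψ).re.const_mul _
    have h1 : ‖∫ t in (S n)ᶜ, ψ (k t) ∂μ‖ ≤ ∫ t in (S n)ᶜ,
        (s * (C ^ 2 * (multExt ψ (star (a t) * a t)).re) + s⁻¹ * (ψ (p t)).re) ∂μ := by
      refine norm_integral_le_of_norm_le (i1.add i2).integrableOn (Eventually.of_forall fun t => ?_)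
      rw [hkφ, hre]
      exact hψ.norm_multExt_sandwich_mul_le (hX t) (hC t) (a t) _ hs0
    have h2 : ∫ t in (S n)ᶜ, s * (C ^ 2 * (multExt ψ (star (a t) * a t)).re) ∂μ ≤
        s * (C ^ 2 * ‖ψ‖) := by
      refine (setIntegral_le_integral i1 (Eventually.of_forall fun t => ?_)).trans ?_
      · have := (Complex.nonneg_iff.mp (hψ.multExt_nonneg (star_mul_self_nonneg (a t)))).1
        exact mul_nonneg hs0.le (mul_nonneg (sq_nonneg C) this)
      · rw [integral_const_mul, integral_const_mul]
        have := ha.integral_re_le ψ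
        gcongr
    have h3 : ∫ t in (S n)ᶜ, s⁻¹ * (ψ (p t)).re ∂μ ≤ s⁻¹ * (s * (ε / 16) * ‖ψ‖) := by
      rw [integral_const_mul]
      refine mul_le_mul_of_nonneg_left ?_ (inv_nonneg.mpr hs0.le)
      have h4 : ∫ t in (S n)ᶜ, (ψ (p t)).re ∂μ = (∫ t in (S n)ᶜ, ψ (p t) ∂μ).re :=
        _root_.integral_re (hpi ψ).integrableOn
      have h5 := integral_add_compl (hSm n) (hpi ψ)
      have h6 : ∫ t in S n, ψ (p t) ∂μ = ψ (∫ t in S n, p t ∂μ) := ψ.integral_comp_comm (hpS n)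
      have h7 : ∫ t in (S n)ᶜ, ψ (p t) ∂μ = ψ (star c * c - ∫ t in S n, p t ∂μ) := by
        rw [map_sub, ← h6, ← hpint, ← h5]; ring
      rw [h4, h7]
      refine (Complex.re_le_norm _).trans ((ψ.le_opNorm _).trans ?_)
      rw [mul_comm]
      exact mul_le_mul_of_nonneg_right hn'.le (norm_nonneg _)
    rw [integral_add i1.integrableOn i2.integrableOn] at h1
    refine h1.trans ((add_le_add h2 h3).trans ?_)
    have h8 : s⁻¹ * (s * (ε / 16) * ‖ψ‖) = ε / 16 * ‖ψ‖ := by field_simp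
    have h9 : s * (C ^ 2 * ‖ψ‖) ≤ ε / 16 * ‖ψ‖ := by
      have h10 : s * C ^ 2 ≤ ε / 16 := by
        have : s * (C ^ 2 + 1) = ε / 16 := by rw [hs]; field_simp
        nlinarith
      rw [← mul_assoc]
      exact mul_le_mul_of_nonneg_right h10 (norm_nonneg _)
    rw [h8]; linarith
  have hfin := norm_le_of_forall_isPositive G (by positivity) hbound φ
  have e : 8 * (ε / 8) * ‖φ‖ = ε * ‖φ‖ := by ring
  rw [e] at hfin
  exact hfin

/-- A bounded self-adjoint field `X`, compressed by a unital column field, has an integral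
in `M(A)`. -/
theorem exists_hasWeakStarIntegral [TopologicalSpace.SeparableSpace A] [Nonempty T]
    (ha : IsUnitalColumnField μ a) (hX : ∀ t, IsSelfAdjoint (X t)) (hC : ∀ t, ‖X t‖ ≤ C)
    (hm : WeakStarMeasurable μ fun t => star (a t) * X t * a t) :
    ∃ y, HasWeakStarIntegral μ (fun t => star (a t) * X t * a t) y := by
  have hW := integrable_sandwich ha hX hC hm
  have hC0 : 0 ≤ C := (norm_nonneg _).trans (hC (Classical.arbitrary T))
  have hsa : ∀ t, star (star (a t) * X t * a t) = star (a t) * X t * a t := fun t =>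
    ((hX t).conjugate' (a t)).star_eq
  -- left multiplication by the integral is `L`, right multiplication is `c ↦ (L c⋆)⋆`
  choose L hL using exists_weakIntegral_mul ha hX hC hW
  have hL' : ∀ (φ : StrongDual ℂ A) c, φ (L c) =
      weakIntegral _ hW (φ.comp (DoubleCentralizer.coe ℂ c).snd) := fun φ c => by
    rw [← hL, weakIntegral_apply]
    congr 1
    ext t
    rw [multExt_comp_snd, mul_coe, multExt_coe]
  have hadd : ∀ b c, L (b + c) = L b + L c := fun b c => eq_of_forall_dual fun φ => by
    rw [map_add, hL', hL', hL', ← map_add]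
    congr 1
    ext d
    exact (congrArg φ (mul_add d b c)).trans (map_add φ _ _)
  have hsmul : ∀ (r : ℂ) c, L (r • c) = r • L c := fun r c => eq_of_forall_dual fun φ => by
    rw [map_smul, hL', hL', ← map_smul]
    congr 1
    ext d
    exact (congrArg φ (mul_smul_comm r d c)).trans (map_smul φ _ _)
  have hbound : ∀ c, ‖L c‖ ≤ 8 * C * ‖c‖ := fun c => by
    refine NormedSpace.norm_le_dual_bound ℂ _ (by positivity) fun φ => ?_
    rw [hL']
    refine (norm_weakIntegral_sandwich_le ha hX hC hW _).trans ?_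
    rw [mul_assoc (8 * C)]
    refine mul_le_mul_of_nonneg_left ?_ (by positivity)
    refine ContinuousLinearMap.opNorm_le_bound _ (by positivity) fun b => ?_
    refine (φ.le_opNorm _).trans ?_
    calc ‖φ‖ * ‖b * c‖ ≤ ‖φ‖ * (‖b‖ * ‖c‖) := by gcongr; exact norm_mul_le _ _
      _ = ‖c‖ * ‖φ‖ * ‖b‖ := by ring
  let Lc : A →L[ℂ] A := LinearMap.mkContinuous ⟨⟨L, hadd⟩, hsmul⟩ (8 * C) hbound
  let Rc : A →L[ℂ] A := LinearMap.mkContinuous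
    { toFun := fun c => star (L (star c))
      map_add' := fun b c => by rw [star_add, hadd, star_add]
      map_smul' := fun r c => by rw [star_smul, hsmul, star_smul, star_star]; rfl } (8 * C)
    fun c => by
      change ‖star (L (star c))‖ ≤ _
      rw [norm_star, ← norm_star c]; exact hbound _
  have hcentral : ∀ b c : A, Rc b * c = b * Lc c := fun b c => eq_of_forall_dual fun φ => by
    have e1 : φ (b * L c) = ∫ t, φ (b * (star (a t) * X t * a t).fst c) ∂μ :=
      (hL c (φ.comp (DoubleCentralizer.coe ℂ b).fst)).symm
    have e2 := hL (star b) (conjDual (φ.comp (DoubleCentralizer.coe ℂ c).snd))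
    simp only [conjDual_apply, star_fst_apply, hsa, star_star] at e2
    rw [integral_conj] at e2
    have e3 := (starRingEnd ℂ).injective e2
    change φ (star (L (star b)) * c) = φ (b * L c)
    rw [e1]
    refine e3.symm.trans ?_
    congr 1
    ext t
    exact congrArg φ ((star (a t) * X t * a t).central b c)
  let y : 𝓜(ℂ, A) := ⟨(Lc, Rc), hcentral⟩
  refine ⟨y, fun φ => ⟨hW φ, ?_⟩⟩
  rw [← weakIntegral_apply _ hW]
  refine tendsto_nhds_unique (tendsto_multExt φ y) ?_
  refine tendsto_of_eventually_norm_sub_le (C := 8 * C) (by positivity) fun ε hε => ?_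
  filter_upwards [eventually_norm_sub_mul_right_le φ hε] with e he
  change ‖weakIntegral _ hW φ - φ (L e)‖ ≤ _
  rw [hL', ← map_sub]
  refine (norm_weakIntegral_sandwich_le ha hX hC hW _).trans ?_
  rw [mul_comm]
  refine mul_le_mul_of_nonneg_right ?_ (by positivity)
  exact ContinuousLinearMap.opNorm_le_bound _ hε.le he

end WeakIntegral

/-! ### Measurability of compressed fields -/

section Measurability

variable {A : Type*} [NonUnitalCStarAlgebra A] [PartialOrder A] [StarOrderedRing A]
  [TopologicalSpace.SeparableSpace A] {T : Type*} [MeasurableSpace T] {μ : Measure T}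

theorem WeakStarMeasurable.aestronglyMeasurable_fst {a : T → 𝓜(ℂ, A)}
    (ha : WeakStarMeasurable μ a) (c : A) : AEStronglyMeasurable (fun t => (a t).fst c) μ :=
  aestronglyMeasurable_of_forall_dual fun φ => by
    refine (ha (φ.comp (DoubleCentralizer.coe ℂ c).snd)).congr (Eventually.of_forall fun t => ?_)
    change multExt (φ.comp (DoubleCentralizer.coe ℂ c).snd) (a t) = _
    rw [multExt_comp_snd, mul_coe, multExt_coe]

theorem aestronglyMeasurable_of_weakStarMeasurable_coe {x : T → A}
    (hx : WeakStarMeasurable μ fun t => DoubleCentralizer.coe ℂ (x t)) :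
    AEStronglyMeasurable x μ :=
  aestronglyMeasurable_of_forall_dual fun φ => by
    simpa only [multExt_coe] using hx φ

/-- Strict continuity is uniform on bounded sets, so that `φ(m)` is the limit of `φ(e n * m * e n)`
along a sequence `e n` that does not depend on `m`. -/
theorem weakStarMeasurable_sandwich {a X : T → 𝓜(ℂ, A)} (ha : WeakStarMeasurable μ a)
    (hX : ∀ c, AEStronglyMeasurable (fun t => (X t * a t).fst c) μ) :
    WeakStarMeasurable μ fun t => star (a t) * X t * a t := by
  intro φ
  have hl := CStarAlgebra.increasingApproximateUnit A
  have hex : ∀ n : ℕ, ∃ e : A, star e = e ∧ ∀ m : 𝓜(ℂ, A),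
      ‖multExt φ m - φ (e * m.fst e)‖ ≤ (1 / ((n : ℝ) + 1)) * ‖m‖ := fun n =>
    (hl.eventually_star_eq.and
      (eventually_norm_multExt_sub_both_le φ (ε := 1 / ((n : ℝ) + 1)) (by positivity))).exists
  choose e he1 he2 using hex
  refine aestronglyMeasurable_of_tendsto_ae (u := atTop)
    (f := fun n t => φ (e n * (star (a t) * X t * a t).fst (e n))) (fun n => ?_)
    (Eventually.of_forall fun t => ?_)
  · have h1 : ∀ t, e n * (star (a t) * X t * a t).fst (e n) =
        star ((a t).fst (e n)) * (X t * a t).fst (e n) := fun t => by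
      rw [star_fst_apply, (star (a t)).central, he1]; rfl
    simp only [h1]
    exact φ.continuous.comp_aestronglyMeasurable
      ((ha.aestronglyMeasurable_fst (e n)).star.mul (hX (e n)))
  · rw [tendsto_iff_norm_sub_tendsto_zero]
    have h0 := (tendsto_one_div_add_atTop_nhds_zero_nat (𝕜 := ℝ)).mul_const
      ‖star (a t) * X t * a t‖
    rw [zero_mul] at h0
    refine squeeze_zero (fun _ => norm_nonneg _) (fun n => ?_) h0
    rw [norm_sub_rev]
    exact he2 n _

/-- Polynomials of the field are strictly measurable. -/
theorem aestronglyMeasurable_aeval_mul_fst {x : T → A} {a : T → 𝓜(ℂ, A)}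
    (hx : AEStronglyMeasurable x μ) (ha : WeakStarMeasurable μ a) (p : Polynomial ℝ) (c : A) :
    AEStronglyMeasurable
      (fun t => (Polynomial.aeval (DoubleCentralizer.coe ℂ (x t)) p * a t).fst c) μ := by
  have hpow : ∀ n : ℕ, AEStronglyMeasurable
      (fun t => (DoubleCentralizer.coe ℂ (x t) ^ n * a t).fst c) μ := by
    intro n
    induction n with
    | zero => simpa using ha.aestronglyMeasurable_fst c
    | succ n ih =>
      refine (hx.mul ih).congr (Eventually.of_forall fun t => ?_)
      change _ = (DoubleCentralizer.coe ℂ (x t) ^ (n + 1) * a t).fst c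
      rw [pow_succ', mul_assoc]
      rfl
  induction p using Polynomial.induction_on' with
  | add p q hp hq =>
    refine (hp.add hq).congr (Eventually.of_forall fun t => ?_)
    change _ = (Polynomial.aeval (DoubleCentralizer.coe ℂ (x t)) (p + q) * a t).fst c
    rw [map_add, add_mul]
    rfl
  | monomial n r =>
    refine ((hpow n).const_smul r).congr (Eventually.of_forall fun t => ?_)
    change _ = (Polynomial.aeval (DoubleCentralizer.coe ℂ (x t)) (Polynomial.monomial n r) *
      a t).fst c
    rw [Polynomial.aeval_monomial, ← Algebra.smul_def, smul_mul_assoc]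
    rfl

/-- An interval is exhausted by a sequence of compact subintervals that absorb its compact
subsets. -/
theorem exists_seq_Icc_subset {I : Set ℝ} (hI : I.OrdConnected) (hne : I.Nonempty) :
    ∃ u v : ℕ → ℝ, (∀ n, Set.Icc (u n) (v n) ⊆ I) ∧
      ∀ K ⊆ I, IsCompact K → ∀ᶠ n in atTop, K ⊆ Set.Icc (u n) (v n) := by
  have := hne.to_subtype
  obtain ⟨v, -, hv⟩ := exists_seq_monotone_tendsto_atTop_atTop I
  obtain ⟨u, -, hu⟩ := exists_seq_antitone_tendsto_atTop_atBot I
  refine ⟨fun n => u n, fun n => v n, fun n => hI.out (u n).2 (v n).2, fun K hKI hK => ?_⟩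
  rcases K.eq_empty_or_nonempty with rfl | hKne
  · simp
  obtain ⟨l, hlK, hl⟩ := hK.exists_isLeast hKne
  obtain ⟨m, hmK, hm⟩ := hK.exists_isGreatest hKne
  filter_upwards [hv.eventually_ge_atTop ⟨m, hKI hmK⟩, hu.eventually_le_atBot ⟨l, hKI hlK⟩]
    with n h1 h2 s hs
  exact ⟨le_trans h2 (hl hs), le_trans (hm hs) h1⟩

/-- The interval `I` is exhausted by compact intervals, on which `f` is a uniform limit of
polynomials. -/
theorem weakStarMeasurable_cfc_sandwich {I : Set ℝ} (hI : I.OrdConnected) (hne : I.Nonempty)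
    {f : ℝ → ℝ} (hf : ContinuousOn f I) {x : T → A}
    (hxm : WeakStarMeasurable μ fun t => DoubleCentralizer.coe ℂ (x t))
    (hx : ∀ t, IsSelfAdjoint (x t)) (hxI : ∀ t, spectrum ℝ (DoubleCentralizer.coe ℂ (x t)) ⊆ I)
    {a : T → 𝓜(ℂ, A)} (ha : WeakStarMeasurable μ a) :
    WeakStarMeasurable μ fun t => star (a t) * cfc f (DoubleCentralizer.coe ℂ (x t)) * a t := by
  refine weakStarMeasurable_sandwich ha fun c => ?_
  obtain ⟨u, v, huv, hK⟩ := exists_seq_Icc_subset hI hne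
  choose p hp using fun n : ℕ => exists_polynomial_near_of_continuousOn (u n) (v n) f
    (hf.mono (huv n)) (1 / ((n : ℝ) + 1)) (by positivity)
  refine aestronglyMeasurable_of_tendsto_ae (u := atTop)
    (f := fun n t => (Polynomial.aeval (DoubleCentralizer.coe ℂ (x t)) (p n) * a t).fst c)
    (fun n => aestronglyMeasurable_aeval_mul_fst
      (aestronglyMeasurable_of_weakStarMeasurable_coe hxm) ha (p n) c)
    (Eventually.of_forall fun t => ?_)
  set X := DoubleCentralizer.coe ℂ (x t) with hX
  have hXsa : IsSelfAdjoint X := coe_isSelfAdjoint (hx t)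
  have hlim : Tendsto (fun n => Polynomial.aeval X (p n)) atTop (𝓝 (cfc f X)) := by
    rw [tendsto_iff_norm_sub_tendsto_zero]
    refine squeeze_zero' (Eventually.of_forall fun _ => norm_nonneg _) ?_
      (tendsto_one_div_add_atTop_nhds_zero_nat (𝕜 := ℝ))
    filter_upwards [hK _ (hxI t) (spectrum.isCompact X)] with n hn
    rw [← cfc_polynomial (p n) X, ← cfc_sub _ _ X (by fun_prop) (hf.mono (hxI t))]
    refine norm_cfc_le (by positivity) fun s hs => ?_
    exact (hp n s (hn hs)).le
  rw [tendsto_iff_norm_sub_tendsto_zero] at hlim ⊢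
  have h0 := hlim.mul_const ‖(a t).fst c‖
  rw [zero_mul] at h0
  refine squeeze_zero (fun _ => norm_nonneg _) (fun n => ?_) h0
  refine le_trans (le_of_eq ?_) (norm_fst_apply_le (Polynomial.aeval X (p n) - cfc f X) _)
  rfl

end Measurability

/-! ### Comparison of integrals -/

section Order

variable {A : Type*} [NonUnitalCStarAlgebra A] [PartialOrder A] [StarOrderedRing A]

theorem eq_of_forall_isPositive {m n : 𝓜(ℂ, A)}
    (h : ∀ ψ : StrongDual ℂ A, IsPositive ψ → multExt ψ m = multExt ψ n) : m = n := by
  refine eq_of_forall_multExt fun φ => ?_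
  obtain ⟨p, hp, hφ⟩ := exists_jordan_decomposition φ
  rw [hφ]
  simp only [add_multExt, smul_multExt, sub_multExt, h _ (hp _).1]

/-- Positivity in `M(A)` is detected by the positive functionals on `A`. -/
theorem nonneg_of_forall_isPositive {m : 𝓜(ℂ, A)}
    (h : ∀ ψ : StrongDual ℂ A, IsPositive ψ → 0 ≤ multExt ψ m) : 0 ≤ m := by
  have hsa : IsSelfAdjoint m := eq_of_forall_isPositive fun ψ hψ => by
    rw [hψ.multExt_star]
    exact Complex.conj_eq_iff_im.mpr (Complex.nonneg_iff.mp (h ψ hψ)).2.symm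
  -- testing at `n * b` gives `-(b⋆ n³ b) ≥ 0`, where `n` is the negative part of `m`
  set n := m⁻ with hn
  have hn0 : 0 ≤ n := CFC.negPart_nonneg m
  have hnsa : star n = n := hn0.isSelfAdjoint.star_eq
  have hnm : n * m = -(n * n) := by
    conv_lhs => rw [← CFC.posPart_sub_negPart m hsa, mul_sub, CFC.negPart_mul_posPart]
    rw [zero_sub]
  obtain ⟨k, hk⟩ := CStarAlgebra.nonneg_iff_eq_star_mul_self.mp (CStarAlgebra.pow_nonneg hn0 3)
  have hk0 : k = 0 := by
    refine multiplier_ext fun b => ?_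
    have h1 : star (k.fst b) * k.fst b = 0 := by
      rw [mul_fst_star_mul, ← hk]
      refine eq_zero_of_forall_isPositive fun ψ hψ => le_antisymm ?_ ?_
      · have h2 := h _ (hψ.conjugate (n * DoubleCentralizer.coe ℂ b))
        rw [multExt_conjugate] at h2
        have h3 : star (n * DoubleCentralizer.coe ℂ b) * m * (n * DoubleCentralizer.coe ℂ b) =
            0 - DoubleCentralizer.coe ℂ (star b * (n ^ 3).fst b) := by
          rw [coe_mul_coe, ← mul_coe, coe_star, star_mul, hnsa]
          calc _ = star (DoubleCentralizer.coe ℂ b) * (n * m) * (n * DoubleCentralizer.coe ℂ b) := by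
                noncomm_ring
            _ = _ := by rw [hnm]; noncomm_ring
        rw [h3, multExt_sub, multExt_zero, multExt_coe, zero_sub] at h2
        exact neg_nonneg.mp h2
      · exact hψ _ (compress_nonneg (CStarAlgebra.pow_nonneg hn0 3) b)
    simpa using (CStarRing.star_mul_self_eq_zero_iff _).mp h1
  have h3 : n ^ 3 = 0 := by rw [hk, hk0, mul_zero]
  have h4 : n * n = 0 := by
    rw [← CStarRing.star_mul_self_eq_zero_iff, star_mul, hnsa]
    calc n * n * (n * n) = n ^ 3 * n := by noncomm_ring
      _ = 0 := by rw [h3, zero_mul]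
  have h5 : n = 0 := by
    rw [← CStarRing.star_mul_self_eq_zero_iff, hnsa, h4]
  exact (CFC.negPart_eq_zero_iff m hsa).mp h5

variable {T : Type*} [MeasurableSpace T] {μ : Measure T}

theorem HasWeakStarIntegral.sub {V W : T → 𝓜(ℂ, A)} {v w : 𝓜(ℂ, A)}
    (hV : HasWeakStarIntegral μ V v) (hW : HasWeakStarIntegral μ W w) :
    HasWeakStarIntegral μ (fun t => V t - W t) (v - w) := fun φ => by
  simp only [multExt_sub]
  refine ⟨(hV φ).1.sub (hW φ).1, ?_⟩
  rw [integral_sub (hV φ).1 (hW φ).1, (hV φ).2, (hW φ).2]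

theorem HasWeakStarIntegral.smul {W : T → 𝓜(ℂ, A)} {w : 𝓜(ℂ, A)}
    (hW : HasWeakStarIntegral μ W w) (c : ℂ) :
    HasWeakStarIntegral μ (fun t => c • W t) (c • w) := fun φ => by
  simp only [multExt_smul]
  refine ⟨(hW φ).1.const_mul c, ?_⟩
  rw [integral_const_mul, (hW φ).2]

theorem HasWeakStarIntegral.unique {W : T → 𝓜(ℂ, A)} {v w : 𝓜(ℂ, A)}
    (hv : HasWeakStarIntegral μ W v) (hw : HasWeakStarIntegral μ W w) : v = w :=
  eq_of_forall_multExt fun φ => (hv φ).2.trans (hw φ).2.symm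

theorem HasWeakStarIntegral.nonneg {W : T → 𝓜(ℂ, A)} {w : 𝓜(ℂ, A)}
    (hW : HasWeakStarIntegral μ W w) (h : ∀ t, 0 ≤ W t) : 0 ≤ w :=
  nonneg_of_forall_isPositive fun ψ hψ => by
    rw [(hW ψ).2]
    exact integral_nonneg fun t => hψ.multExt_nonneg (h t)

theorem HasWeakStarIntegral.isSelfAdjoint {W : T → 𝓜(ℂ, A)} {w : 𝓜(ℂ, A)}
    (hW : HasWeakStarIntegral μ W w) (h : ∀ t, IsSelfAdjoint (W t)) : IsSelfAdjoint w :=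
  eq_of_forall_isPositive fun ψ hψ => by
    rw [hψ.multExt_star, (hW ψ).2, ← integral_conj]
    congr 1
    ext t
    rw [← hψ.multExt_star, (h t).star_eq]

theorem algebraMap_real_eq (r : ℝ) : algebraMap ℝ 𝓜(ℂ, A) r = (r : ℂ) • (1 : 𝓜(ℂ, A)) := by
  rw [Algebra.algebraMap_eq_smul_one]
  exact (Complex.coe_smul r (1 : 𝓜(ℂ, A))).symm

theorem cfc_affine {y : 𝓜(ℂ, A)} (hy : IsSelfAdjoint y) (k d : ℝ) :
    cfc (fun s => k * s + d) y = (k : ℂ) • y + (d : ℂ) • (1 : 𝓜(ℂ, A)) := by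
  rw [cfc_add _ (fun s => k * s) (fun _ => d) (by fun_prop) (by fun_prop),
    cfc_const_mul_id k y, cfc_const d y, algebraMap_real_eq]
  congr 1

variable {a : T → 𝓜(ℂ, A)} {X V : T → 𝓜(ℂ, A)} {y v : 𝓜(ℂ, A)}

/-- Affine minorants are preserved by the integral of a unital column field. -/
theorem affine_le_integral (ha : IsUnitalColumnField μ a) (hX : ∀ t, IsSelfAdjoint (X t))
    (hy : HasWeakStarIntegral μ (fun t => star (a t) * X t * a t) y)
    (hv : HasWeakStarIntegral μ (fun t => star (a t) * V t * a t) v) (k d : ℝ)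
    (h : ∀ t, cfc (fun s => k * s + d) (X t) ≤ V t) : cfc (fun s => k * s + d) y ≤ v := by
  have hysa : IsSelfAdjoint y := hy.isSelfAdjoint fun t => (hX t).conjugate' (a t)
  rw [← sub_nonneg, cfc_affine hysa, ← sub_sub]
  refine ((hv.sub (hy.smul k)).sub (ha.integral_eq_one.smul d)).nonneg fun t => ?_
  have h1 := h t
  rw [cfc_affine (hX t), ← sub_nonneg, ← sub_sub] at h1
  refine (star_left_conjugate_nonneg h1 (a t)).trans_eq ?_
  simp only [mul_sub, sub_mul, mul_smul_comm, smul_mul_assoc, mul_one]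

/-- A common lower bound of the spectra is a lower bound of the spectrum of the integral. -/
theorem lower_bound_spectrum_integral (ha : IsUnitalColumnField μ a)
    (hX : ∀ t, IsSelfAdjoint (X t))
    (hy : HasWeakStarIntegral μ (fun t => star (a t) * X t * a t) y) {r : ℝ}
    (h : ∀ t, ∀ s ∈ spectrum ℝ (X t), r ≤ s) : ∀ s ∈ spectrum ℝ y, r ≤ s := by
  have hysa : IsSelfAdjoint y := hy.isSelfAdjoint fun t => (hX t).conjugate' (a t)
  have hr : ∀ Y : 𝓜(ℂ, A), IsSelfAdjoint Y →
      cfc (fun s => 0 * s + r) Y = algebraMap ℝ 𝓜(ℂ, A) r := fun Y hY => by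
    rw [cfc_affine hY, algebraMap_real_eq]; simp
  have := affine_le_integral ha hX hy hy 0 r fun t => by
    rw [hr _ (hX t)]
    exact (algebraMap_le_iff_le_spectrum (ha := hX t)).mpr (h t)
  rw [hr _ hysa] at this
  exact (algebraMap_le_iff_le_spectrum (ha := hysa)).mp this

theorem HasWeakStarIntegral.neg_sandwich
    (hy : HasWeakStarIntegral μ (fun t => star (a t) * X t * a t) y) :
    HasWeakStarIntegral μ (fun t => star (a t) * (-X t) * a t) (-y) := by
  have := hy.smul (-1)
  simpa using this

/-- A common upper bound of the spectra is an upper bound of the spectrum of the integral. -/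
theorem upper_bound_spectrum_integral (ha : IsUnitalColumnField μ a)
    (hX : ∀ t, IsSelfAdjoint (X t))
    (hy : HasWeakStarIntegral μ (fun t => star (a t) * X t * a t) y) {r : ℝ}
    (h : ∀ t, ∀ s ∈ spectrum ℝ (X t), s ≤ r) : ∀ s ∈ spectrum ℝ y, s ≤ r := by
  intro s hs
  have := lower_bound_spectrum_integral (r := -r) ha (fun t => (hX t).neg) hy.neg_sandwich
    (fun t s hs => by
      rw [← spectrum.neg_eq, Set.mem_neg] at hs
      linarith [h t _ hs]) (-s) (by rwa [← spectrum.neg_eq, Set.neg_mem_neg])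
  linarith

end Order

/-! ### States that vanish at a positive element -/

section State

variable {B : Type*} [CStarAlgebra B] [PartialOrder B] [StarOrderedRing B]

open ComplexStarModule in
/-- If a positive element `w` is not invertible, then some state vanishes at it, by the Hahn–Banach
theorem. -/
theorem exists_state_eq_zero {w : B} (hw : 0 ≤ w) (h0 : (0 : ℝ) ∈ spectrum ℝ w) :
    ∃ ρ : B →ₚ[ℂ] ℂ, ρ 1 = 1 ∧ ρ w = 0 := by
  -- `x ↦ sInf (R x)` is sublinear, as `r + c w ≥ 0` forces `r ≥ 0`; a linear functional below it is
  -- a state, and it vanishes at `w` because `0 ∈ R w` and `w ≥ 0`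
  let R : B → Set ℝ := fun x => {r | ∃ c : ℝ, (ℜ x : B) ≤ algebraMap ℝ B r + c • w}
  have hlow : ∀ x, ∀ r ∈ R x, -‖x‖ ≤ r := by
    rintro x r ⟨c, hc⟩
    have h1 : -algebraMap ℝ B ‖(ℜ x : B)‖ ≤ ℜ x := (ℜ x).2.neg_algebraMap_norm_le_self
    have h2 : 0 ≤ algebraMap ℝ B (r + ‖(ℜ x : B)‖) + c • w := by
      rw [map_add]
      have := sub_nonneg.mpr (h1.trans hc)
      refine this.trans_eq ?_
      abel
    have h3 : r + ‖(ℜ x : B)‖ ∈ spectrum ℝ (algebraMap ℝ B (r + ‖(ℜ x : B)‖) + c • w) := by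
      have h4 : (0 : ℝ) ∈ spectrum ℝ (c • w) := by
        rw [spectrum.zero_mem_iff] at h0 ⊢
        intro hu
        rcases eq_or_ne c 0 with rfl | hc0
        · rw [zero_smul, isUnit_zero_iff] at hu
          refine h0 ?_
          rw [show w = 1 by rw [← one_mul w, ← hu, zero_mul]]
          exact isUnit_one
        · exact h0 ((isUnit_smul_iff (Units.mk0 c hc0) w).mp hu)
      have := spectrum.add_mem_add_iff (r := (0 : ℝ)) (s := r + ‖(ℜ x : B)‖) (a := c • w)
      rw [zero_add] at this
      exact this.mpr h4
    have h5 := spectrum_nonneg_of_nonneg h2 h3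
    have h6 : ‖(ℜ x : B)‖ ≤ ‖x‖ := realPart.norm_le x
    linarith
  have hup : ∀ x, ‖x‖ ∈ R x := fun x => ⟨0, by
    rw [zero_smul, add_zero]
    refine (ℜ x).2.le_algebraMap_norm_self.trans ?_
    exact algebraMap_mono B (realPart.norm_le x)⟩
  have hbdd : ∀ x, BddBelow (R x) := fun x => ⟨-‖x‖, hlow x⟩
  let N : B → ℝ := fun x => sInf (R x)
  have hN : ∀ x r, r ∈ R x → N x ≤ r := fun x r hr => csInf_le (hbdd x) hr
  have hhom : ∀ r : ℝ, 0 < r → ∀ x, N (r • x) ≤ r * N x := by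
    intro r hr x
    rw [← div_le_iff₀' hr]
    refine le_csInf ⟨_, hup x⟩ ?_
    rintro q ⟨c, hc⟩
    rw [div_le_iff₀' hr]
    refine hN _ _ ⟨r * c, ?_⟩
    have := smul_le_smul_of_nonneg_left hc hr.le
    rw [map_smul]
    refine this.trans_eq ?_
    rw [smul_add, smul_smul, map_mul, Algebra.smul_def]
  obtain ⟨g, -, hg⟩ := exists_extension_of_le_sublinear (⊥ : B →ₗ.[ℝ] ℝ) N
    (fun r hr x => le_antisymm (hhom r hr x) (by
      have := hhom r⁻¹ (inv_pos.mpr hr) (r • x)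
      rw [smul_smul, inv_mul_cancel₀ hr.ne', one_smul] at this
      rwa [← div_eq_inv_mul, le_div_iff₀' hr] at this))
    (fun x y => by
      rw [← sub_le_iff_le_add]
      refine le_csInf ⟨_, hup x⟩ ?_
      rintro q ⟨c, hc⟩
      rw [sub_le_comm]
      refine le_csInf ⟨_, hup y⟩ ?_
      rintro r ⟨d, hd⟩
      rw [sub_le_iff_le_add]
      refine hN _ _ ⟨d + c, ?_⟩
      rw [map_add]
      refine (add_le_add hc hd).trans_eq ?_
      rw [map_add, add_smul]; abel)
    (by
      rintro ⟨x, hx⟩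
      have hx0 : x = 0 := (Submodule.mem_bot ℝ).mp hx
      subst hx0
      have : (⊥ : B →ₗ.[ℝ] ℝ) ⟨0, hx⟩ = 0 := LinearPMap.map_zero _
      rw [this]
      refine le_csInf ⟨_, hup 0⟩ fun r hr => ?_
      simpa using hlow 0 r hr)
  have hgN : ∀ x r, r ∈ R x → g x ≤ r := fun x r hr => (hg x).trans (hN x r hr)
  have hpos : ∀ c : B, 0 ≤ c → 0 ≤ g c := fun c hc => by
    have := hgN (-c) 0 ⟨0, by
      rw [map_neg, zero_smul, map_zero, add_zero]
      simpa [hc.isSelfAdjoint.coe_realPart] using hc⟩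
    rw [map_neg] at this
    linarith
  have h1 : g 1 = 1 := by
    refine le_antisymm (hgN 1 1 ⟨0, by simp⟩) ?_
    have := hgN (-1) (-1) ⟨0, by simp⟩
    rw [map_neg] at this
    linarith
  have hw0 : g w = 0 := by
    refine le_antisymm (hgN w 0 ⟨1, ?_⟩) (hpos w hw)
    simp [hw.isSelfAdjoint.coe_realPart]
  let h : Module.Dual ℝ B := g.comp ((selfAdjoint.submodule ℝ B).subtype.comp
    (realPart : B →ₗ[ℝ] selfAdjoint B))
  have hval : ∀ c : B, 0 ≤ c → (h.extendRCLike : Module.Dual ℂ B) c = g c := by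
    intro c hc
    have h1 : h c = g c := congrArg g hc.isSelfAdjoint.coe_realPart
    have h2 : h (Complex.I • c) = 0 := by
      have : ((ℜ (Complex.I • c) : selfAdjoint B) : B) = 0 := by
        rw [realPart_I_smul, hc.isSelfAdjoint.imaginaryPart]; simp
      exact (congrArg g this).trans (map_zero g)
    rw [Module.Dual.extendRCLike_apply, h1]
    simp [h2]
  refine ⟨PositiveLinearMap.mk₀ h.extendRCLike fun c hc => ?_, ?_, ?_⟩
  · rw [hval c hc]; exact_mod_cast hpos c hc
  · change (h.extendRCLike : Module.Dual ℂ B) 1 = 1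
    rw [hval 1 zero_le_one, h1]; rfl
  · change (h.extendRCLike : Module.Dual ℂ B) w = 0
    rw [hval w hw, hw0]; rfl

/-- The Cauchy–Schwarz inequality: a positive functional that vanishes at a positive element `w`
vanishes on the left ideal generated by `w`. -/
theorem map_mul_eq_zero_of_nonneg (ρ : B →ₚ[ℂ] ℂ) {w : B} (hw : 0 ≤ w) (h0 : ρ w = 0) (b : B) :
    ρ (b * w) = 0 := by
  have hsq : ρ (star w * w) = 0 := by
    have h1 : star w * w ≤ ‖w‖ • w := by
      set s := CFC.sqrt w
      have hs : s * s = w := CFC.sqrt_mul_sqrt_self w hw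
      have hss : star s = s := (CFC.sqrt_nonneg w).isSelfAdjoint.star_eq
      have := CStarAlgebra.star_left_conjugate_le_norm_smul (a := s) (b := w)
        (hb := hw.isSelfAdjoint)
      rw [hss, hs] at this
      rw [hw.isSelfAdjoint.star_eq]
      refine le_trans (le_of_eq ?_) this
      rw [← hs]; simp only [mul_assoc]
    have h2 : ρ (‖w‖ • w) = 0 := by
      rw [show ‖w‖ • w = (‖w‖ : ℂ) • w from (Complex.coe_smul _ w).symm, map_smul, h0, smul_zero]
    refine le_antisymm ?_ (map_nonneg ρ (star_mul_self_nonneg w))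
    rw [← h2]
    exact OrderHomClass.mono ρ h1
  have h := norm_inner_le_norm (𝕜 := ℂ) (ρ.toPreGNS (star b)) (ρ.toPreGNS w)
  have h1 := ρ.preGNS_norm_sq (ρ.toPreGNS w)
  rw [PositiveLinearMap.ofPreGNS_toPreGNS, hsq] at h1
  have h2 : ‖ρ.toPreGNS w‖ = 0 := by
    have : ‖ρ.toPreGNS w‖ ^ 2 = 0 := by exact_mod_cast h1
    exact pow_eq_zero_iff two_ne_zero |>.mp this
  rw [h2, mul_zero, PositiveLinearMap.preGNS_inner_def] at h
  simpa using h

end State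

/-! ### The spectrum of the integral -/

section Spectrum

variable {A : Type*} [NonUnitalCStarAlgebra A] [PartialOrder A] [StarOrderedRing A]

theorem exists_pos_add_le_of_isCompact {K : Set ℝ} (hK : IsCompact K) {s : ℝ}
    (h : ∀ r ∈ K, s < r) : ∃ ε > 0, ∀ r ∈ K, s + ε ≤ r := by
  rcases K.eq_empty_or_nonempty with rfl | hne
  · exact ⟨1, one_pos, by simp⟩
  · obtain ⟨m, hm, hmin⟩ := hK.exists_isLeast hne
    exact ⟨m - s, sub_pos.mpr (h m hm), fun r hr => by linarith [hmin hr]⟩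

theorem sub_algebraMap_nonneg {Y : 𝓜(ℂ, A)} (hY : IsSelfAdjoint Y) {r : ℝ}
    (h : ∀ s ∈ spectrum ℝ Y, r ≤ s) : 0 ≤ Y - algebraMap ℝ 𝓜(ℂ, A) r :=
  sub_nonneg.mpr ((algebraMap_le_iff_le_spectrum (ha := hY)).mpr h)

variable {T : Type*} [MeasurableSpace T] {μ : Measure T} {a : T → 𝓜(ℂ, A)}

/-- If the integral lies in `A`, a strict lower bound `s` of all the spectra does not belong to its
spectrum: a state of `M(A)` that vanishes at `y - s` restricts to a positive functional on `A` whose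
extension vanishes at `a⋆ a` almost everywhere, hence at `1`. -/
theorem notMem_spectrum_of_forall_lt [Nontrivial 𝓜(ℂ, A)] [Nonempty T]
    (ha : IsUnitalColumnField μ a) {x : T → A} (hx : ∀ t, IsSelfAdjoint (x t)) {b : A}
    (hy : HasWeakStarIntegral μ (fun t => star (a t) * DoubleCentralizer.coe ℂ (x t) * a t)
      (DoubleCentralizer.coe ℂ b)) {s : ℝ}
    (h : ∀ t, ∀ r ∈ spectrum ℝ (DoubleCentralizer.coe ℂ (x t)), s < r) :
    s ∉ spectrum ℝ (DoubleCentralizer.coe ℂ b) := by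
  intro hs
  have hX := fun t => coe_isSelfAdjoint (hx t)
  set X := fun t => DoubleCentralizer.coe ℂ (x t) with hXdef
  set y := DoubleCentralizer.coe ℂ b with hydef
  have hysa : IsSelfAdjoint y := hy.isSelfAdjoint fun t => (hX t).conjugate' (a t)
  have hys := lower_bound_spectrum_integral ha hX hy fun t r hr => (h t r hr).le
  set w := y - algebraMap ℝ 𝓜(ℂ, A) s with hw
  have hw0 : 0 ≤ w := sub_algebraMap_nonneg hysa hys
  have h0 : (0 : ℝ) ∈ spectrum ℝ w := by
    rw [spectrum.zero_mem_iff, hw]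
    intro hu
    refine hs (spectrum.mem_resolventSet_iff.mpr ?_)
    rw [← neg_sub]
    exact hu.neg
  obtain ⟨ρ, hρ1, hρw⟩ := exists_state_eq_zero hw0 h0
  let φ : StrongDual ℂ A :=
    ⟨ρ.toLinearMap.comp (DoubleCentralizer.coeHom (𝕜 := ℂ) (A := A) : A →ₗ[ℂ] 𝓜(ℂ, A)), by
      have h1 : Continuous ρ := map_continuous ρ
      have h2 : Continuous fun a : A => DoubleCentralizer.coe ℂ a := by
        refine AddMonoidHomClass.continuous_of_bound
          (DoubleCentralizer.coeHom (𝕜 := ℂ) (A := A)) 1 fun a => ?_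
        rw [one_mul]; exact (norm_coe a).le
      exact h1.comp h2⟩
  have hφ : ∀ c, φ c = ρ (DoubleCentralizer.coe ℂ c) := fun c => rfl
  have hφpos : IsPositive φ := fun c hc => map_nonneg ρ (coe_nonneg_iff.mpr hc)
  have hφw : multExt φ w = 0 := by
    refine tendsto_nhds_unique (tendsto_multExt_left φ w) (tendsto_const_nhds.congr fun e => ?_)
    rw [hφ, ← coe_mul, map_mul_eq_zero_of_nonneg ρ hw0 hρw]
  have hint : HasWeakStarIntegral μ
      (fun t => star (a t) * (X t - algebraMap ℝ 𝓜(ℂ, A) s) * a t) w := by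
    have := hy.sub (ha.integral_eq_one.smul (s : ℂ))
    rw [hw, algebraMap_real_eq]
    simpa only [mul_sub, sub_mul, mul_smul_comm, smul_mul_assoc, mul_one] using this
  have hXs : ∀ t, 0 ≤ X t - algebraMap ℝ 𝓜(ℂ, A) s := fun t =>
    sub_algebraMap_nonneg (hX t) fun r hr => (h t r hr).le
  have hnn : ∀ t, 0 ≤ multExt φ (star (a t) * (X t - algebraMap ℝ 𝓜(ℂ, A) s) * a t) := fun t =>
    hφpos.multExt_nonneg (star_left_conjugate_nonneg (hXs t) (a t))
  have hae : ∀ᵐ t ∂μ, multExt φ (star (a t) * a t) = 0 := by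
    have h1 : ∫ t, (multExt φ (star (a t) * (X t - algebraMap ℝ 𝓜(ℂ, A) s) * a t)).re ∂μ = 0 := by
      have h2 := (hint φ).2
      rw [hφw] at h2
      have h3 := _root_.integral_re (hint φ).1
      simp only [RCLike.re_eq_complex_re] at h3
      rw [h3, ← h2]; rfl
    have h2 := (integral_eq_zero_iff_of_nonneg
      (fun t => (Complex.nonneg_iff.mp (hnn t)).1) (hint φ).1.re).mp h1
    filter_upwards [h2] with t ht
    have ht0 : multExt φ (star (a t) * (X t - algebraMap ℝ 𝓜(ℂ, A) s) * a t) = 0 :=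
      Complex.ext ht (Complex.nonneg_iff.mp (hnn t)).2.symm
    obtain ⟨ε, hε, hεs⟩ := exists_pos_add_le_of_isCompact (spectrum.isCompact (X t)) (h t)
    have h3 := star_left_conjugate_nonneg (sub_algebraMap_nonneg (hX t) hεs) (a t)
    have h4 : star (a t) * (X t - algebraMap ℝ 𝓜(ℂ, A) (s + ε)) * a t =
        star (a t) * (X t - algebraMap ℝ 𝓜(ℂ, A) s) * a t - (ε : ℂ) • (star (a t) * a t) := by
      rw [map_add, algebraMap_real_eq ε]
      simp only [mul_sub, sub_mul, mul_add, add_mul, mul_smul_comm, smul_mul_assoc, mul_one]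
      abel
    have h5 := hφpos.multExt_nonneg h3
    rw [h4, multExt_sub, ht0, multExt_smul, zero_sub] at h5
    have h6 := hφpos.multExt_nonneg (star_mul_self_nonneg (a t))
    have h7 := neg_nonneg.mp h5
    rw [Complex.nonpos_iff, Complex.re_ofReal_mul] at h7
    rw [Complex.nonneg_iff] at h6
    refine Complex.ext ?_ h6.2.symm
    rw [Complex.zero_re]
    nlinarith [h7.1, h6.1]
  have hφ1 : multExt φ 1 = 0 := by
    rw [(ha.integral_eq_one φ).2, integral_congr_ae hae]
    simp
  have hφ0 : ∀ c, φ c = 0 := by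
    intro c
    have h1 := hφpos.norm_multExt_star_mul_sq_le 1 (DoubleCentralizer.coe ℂ c)
    rw [star_one, one_mul, one_mul, hφ1, Complex.zero_re, zero_mul, multExt_coe] at h1
    have := pow_eq_zero_iff two_ne_zero |>.mp (le_antisymm h1 (sq_nonneg _))
    exact norm_eq_zero.mp this
  have hs0 : s = 0 := by
    have h1 : ρ w = φ b - s := by
      rw [hw, map_sub, hφ, algebraMap_real_eq, map_smul, hρ1]
      simp [hydef]
    rw [hρw, hφ0, zero_sub] at h1
    have := neg_eq_zero.mp h1.symm
    exact_mod_cast this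
  -- as `s = 0`, the element `x t` is invertible in `M(A)`, so that `1` lies in `A` and `ρ 1 = 0`
  obtain ⟨t⟩ := ‹Nonempty T›
  have hunit : IsUnit (X t) := by
    by_contra hu
    have := h t 0 (spectrum.zero_mem_iff ℝ |>.mpr hu)
    rw [hs0] at this
    exact lt_irrefl _ this
  obtain ⟨u, hu⟩ := hunit
  have h1 : (1 : 𝓜(ℂ, A)) = DoubleCentralizer.coe ℂ (((↑u⁻¹ : 𝓜(ℂ, A))).snd (x t)) := by
    rw [← coe_mul, ← u.mul_inv, hu]
  rw [h1, ← hφ, hφ0] at hρ1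
  exact zero_ne_one hρ1

/-- If the integral `y` lies in `A`, or if the interval is closed, then the spectrum of `y` stays in
the interval. For closed intervals, it suffices to compare with the common bounds of the spectra. -/
theorem spectrum_integral_subset [Nontrivial 𝓜(ℂ, A)] [Nonempty T] {I : Set ℝ}
    (hI : I.OrdConnected) (ha : IsUnitalColumnField μ a) {x : T → A}
    (hx : ∀ t, IsSelfAdjoint (x t))
    (hxI : ∀ t, spectrum ℝ (DoubleCentralizer.coe ℂ (x t)) ⊆ I) {y : 𝓜(ℂ, A)}
    (hy : HasWeakStarIntegral μ (fun t => star (a t) * DoubleCentralizer.coe ℂ (x t) * a t) y)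
    (h : (∃ b : A, DoubleCentralizer.coe ℂ b = y) ∨ IsClosed I) : spectrum ℝ y ⊆ I := by
  have hX := fun t => coe_isSelfAdjoint (hx t)
  intro s hs
  by_contra hsI
  have hside : (∀ r ∈ I, s < r) ∨ ∀ r ∈ I, r < s := by
    by_contra! hc
    obtain ⟨⟨r, hr, hrs⟩, q, hq, hqs⟩ := hc
    exact hsI (hI.out hr hq ⟨hrs, hqs⟩)
  rcases h with ⟨b, rfl⟩ | hcl
  · rcases hside with hlt | hgt
    · exact notMem_spectrum_of_forall_lt ha hx hy (fun t r hr => hlt r (hxI t hr)) hs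
    · have hneg : ∀ c : A, -DoubleCentralizer.coe ℂ c = DoubleCentralizer.coe ℂ (-c) := fun c => by
        rw [← zero_sub, ← zero_sub c, coe_sub, coe_zero]
      have hy' := hy.neg_sandwich
      simp only [hneg] at hy'
      refine notMem_spectrum_of_forall_lt (s := -s) ha (fun t => (hx t).neg) hy' (fun t r hr => ?_) ?_
      · rw [← hneg, ← spectrum.neg_eq, Set.mem_neg] at hr
        linarith [hgt _ (hxI t hr)]
      · rwa [← hneg, ← spectrum.neg_eq, Set.neg_mem_neg]
  · obtain ⟨ε, hε, hball⟩ := Metric.isOpen_iff.mp hcl.isOpen_compl s hsI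
    have hfar : ∀ r ∈ I, ε ≤ |r - s| := fun r hr => by
      by_contra! hc
      exact hball (Metric.mem_ball.mpr (by rwa [Real.dist_eq])) hr
    rcases hside with hlt | hgt
    · have := lower_bound_spectrum_integral (r := s + ε) ha hX hy (fun t r hr => by
        have h1 := hfar r (hxI t hr)
        rw [abs_of_pos (sub_pos.mpr (hlt r (hxI t hr)))] at h1
        linarith) s hs
      linarith
    · have := upper_bound_spectrum_integral (r := s - ε) ha hX hy (fun t r hr => by
        have h1 := hfar r (hxI t hr)
        rw [abs_of_neg (sub_neg.mpr (hgt r (hxI t hr)))] at h1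
        linarith) s hs
      linarith

end Spectrum

/-! ### Affine minorants and partitions of unity -/

section Convex

variable {I : Set ℝ} {f : ℝ → ℝ}

/-- A continuous convex function on an interval is the supremum of its affine minorants, also at
the end points of the interval and for intervals that are not closed. -/
theorem exists_affine_minorant_of_lt (hf : ConvexOn ℝ I f) (hfc : ContinuousOn f I) {x a : ℝ}
    (hx : x ∈ I) (ha : a < f x) :
    ∃ k d : ℝ, (∀ s ∈ I, k * s + d ≤ f s) ∧ a < k * x + d := by
  obtain ⟨b, hab, hb⟩ := exists_between ha
  have hnot : (x, a) ∉ closure {p : ℝ × ℝ | p.1 ∈ I ∧ f p.1 ≤ p.2} := by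
    obtain ⟨U, hU, hUx, hUI⟩ := mem_nhdsWithin.mp (hfc x hx (lt_mem_nhds hb))
    rw [mem_closure_iff]
    intro h
    obtain ⟨p, ⟨hp1, hp2⟩, hp3, hp4⟩ := h (U ×ˢ Set.Iio b) (hU.prod isOpen_Iio) ⟨hUx, hab⟩
    exact absurd (lt_of_le_of_lt hp4 hp2) (not_lt.mpr (le_of_lt (hUI ⟨hp1, hp3⟩)))
  obtain ⟨L, u, hLx, hL⟩ := geometric_hahn_banach_point_closed
    hf.convex_epigraph.closure isClosed_closure hnot
  have hLe : ∀ s t : ℝ, L (s, t) = s * L (1, 0) + t * L (0, 1) := fun s t => by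
    rw [← smul_eq_mul, ← smul_eq_mul, ← map_smul, ← map_smul, ← map_add]
    simp
  have hlow : ∀ s ∈ I, u < s * L (1, 0) + f s * L (0, 1) := fun s hs => by
    rw [← hLe]
    exact hL _ (subset_closure ⟨hs, le_rfl⟩)
  rw [hLe] at hLx
  have hβ : 0 < L (0, 1) := by
    by_contra! hc
    have := hlow x hx
    nlinarith
  refine ⟨-(L (1, 0) / L (0, 1)), u / L (0, 1), fun s hs => ?_, ?_⟩
  · have h1 := hlow s hs
    have : -(L (1, 0) / L (0, 1)) * s + u / L (0, 1) = (u - s * L (1, 0)) / L (0, 1) := by ring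
    rw [this, div_le_iff₀ hβ]
    linarith
  · have : -(L (1, 0) / L (0, 1)) * x + u / L (0, 1) = (u - x * L (1, 0)) / L (0, 1) := by ring
    rw [this, lt_div_iff₀ hβ]
    linarith

/-- On a compact set on which `g < f`, a partition of unity `∑ i, h i ^ 2` localizes the estimate
`g ≤ k i * s + d i` by affine minorants of `f`. -/
theorem exists_partition_affine (hf : ConvexOn ℝ I f) (hfc : ContinuousOn f I) {C : Set ℝ}
    (hC : IsCompact C) (hCI : C ⊆ I) {g : ℝ → ℝ} (hg : Continuous g) (hgf : ∀ s ∈ C, g s < f s) :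
    ∃ (N : Finset ℝ) (h : ℝ → ℝ → ℝ) (k d : ℝ → ℝ), (∀ i, Continuous (h i)) ∧
      (∀ i ∈ N, ∀ s ∈ I, k i * s + d i ≤ f s) ∧ (∀ s, ∑ i ∈ N, h i s ^ 2 ≤ 1) ∧
      (∀ s ∈ C, ∑ i ∈ N, h i s ^ 2 = 1) ∧
      ∀ i ∈ N, ∀ s, h i s ^ 2 * g s ≤ h i s ^ 2 * (k i * s + d i) := by
  have hex : ∀ x : ℝ, ∃ k d : ℝ, x ∈ C → (∀ s ∈ I, k * s + d ≤ f s) ∧ g x < k * x + d := by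
    intro x
    by_cases hx : x ∈ C
    · obtain ⟨k, d, h1, h2⟩ := exists_affine_minorant_of_lt hf hfc (hCI hx) (hgf x hx)
      exact ⟨k, d, fun _ => ⟨h1, h2⟩⟩
    · exact ⟨0, 0, fun h => absurd h hx⟩
  choose k d hkd using hex
  let U : ℝ → Set ℝ := fun i => {s | g s < k i * s + d i}
  have hU : ∀ i, IsOpen (U i) := fun i => isOpen_lt hg (by fun_prop)
  obtain ⟨N, hNC⟩ := hC.elim_nhds_subcover' (fun x _ => U x)
    fun x hx => (hU x).mem_nhds (hkd x hx).2
  classical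
  let N' : Finset ℝ := N.image Subtype.val
  obtain ⟨ρ, hρ⟩ := PartitionOfUnity.exists_isSubordinate hC.isClosed (fun i : N' => U i)
    (fun i => hU i) (by
      intro s hs
      obtain ⟨x, hx, hsx⟩ := Set.mem_iUnion₂.mp (hNC hs)
      exact Set.mem_iUnion.mpr ⟨⟨x, Finset.mem_image_of_mem _ hx⟩, hsx⟩)
  have hsum : ∀ s, ∑ i ∈ N', (if hi : i ∈ N' then Real.sqrt (ρ ⟨i, hi⟩ s) else 0) ^ 2 =
      ∑ᶠ i, ρ i s := by
    intro s
    rw [finsum_eq_sum_of_fintype, ← Finset.sum_coe_sort N']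
    refine Finset.sum_congr rfl fun i _ => ?_
    rw [dif_pos i.2, Real.sq_sqrt (ρ.nonneg _ _)]
  -- the functions `h i` are the square roots of a partition of unity
  refine ⟨N', fun i s => if hi : i ∈ N' then Real.sqrt (ρ ⟨i, hi⟩ s) else 0, k, d, fun i => ?_,
    fun i hi => ?_, fun s => ?_, fun s hs => ?_, fun i hi s => ?_⟩
  · by_cases hi : i ∈ N'
    · simp only [dif_pos hi]
      exact Real.continuous_sqrt.comp (ρ ⟨i, hi⟩).continuous
    · simp only [dif_neg hi]
      exact continuous_const
  · obtain ⟨x, -, rfl⟩ := Finset.mem_image.mp hi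
    exact (hkd x x.2).1
  · rw [hsum]; exact ρ.sum_le_one s
  · rw [hsum]; exact ρ.sum_eq_one hs
  · simp only [dif_pos hi]
    by_cases hs : ρ ⟨i, hi⟩ s = 0
    · simp [hs]
    · exact mul_le_mul_of_nonneg_left
        (hρ ⟨i, hi⟩ (subset_tsupport _ (Function.mem_support.mpr hs))).le (sq_nonneg _)

/-- A continuous function on a closed set of reals extends continuously (Tietze). -/
theorem exists_continuous_eqOn {C : Set ℝ} (hC : IsClosed C) (hfc : ContinuousOn f C) :
    ∃ g : ℝ → ℝ, Continuous g ∧ Set.EqOn g f C := by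
  obtain ⟨g, hg⟩ := ContinuousMap.exists_restrict_eq hC
    (⟨C.domRestrict f, continuousOn_iff_continuous_domRestrict.mp hfc⟩ : C(C, ℝ))
  exact ⟨g, g.continuous, fun s hs => congrArg (fun k : C(C, ℝ) => k ⟨s, hs⟩) hg⟩

end Convex

/-! ### Local estimates in the functional calculus -/

section FunctionalCalculus

variable {B : Type*} [CStarAlgebra B]

/-- The functional calculus of `y` stays in every closed real subspace that contains the powers
of `y`. -/
theorem cfc_mem_of_pow_mem {S : Submodule ℝ B} (hS : IsClosed (S : Set B)) {y : B}
    (hy : IsSelfAdjoint y) (hpow : ∀ n : ℕ, y ^ n ∈ S) {h : ℝ → ℝ}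
    (hh : ContinuousOn h (spectrum ℝ y)) : cfc h y ∈ S := by
  obtain ⟨g, hg, hgh⟩ := exists_continuous_eqOn (spectrum.isClosed y) hh
  rw [← cfc_congr hgh]
  obtain ⟨R, hR⟩ := (spectrum.isCompact (𝕜 := ℝ) y).isBounded.subset_closedBall 0
  rw [Real.closedBall_eq_Icc] at hR
  have hmem : ∀ p : Polynomial ℝ, cfc p.eval y ∈ S := fun p => by
    rw [cfc_polynomial p y, Polynomial.aeval_eq_sum_range]
    exact S.sum_mem fun i _ => S.smul_mem _ (hpow i)
  refine hS.closure_subset (Metric.mem_closure_iff.mpr fun ε hε => ?_)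
  obtain ⟨p, hp⟩ := exists_polynomial_near_of_continuousOn (0 - R) (0 + R) g hg.continuousOn (ε / 2)
    (half_pos hε)
  refine ⟨_, hmem p, lt_of_le_of_lt ?_ (half_lt_self hε)⟩
  rw [dist_comm, dist_eq_norm, ← cfc_sub _ _ y (by fun_prop) (by fun_prop)]
  exact norm_cfc_le (half_pos hε).le fun s hs => (hp s (hR hs)).le

variable [PartialOrder B] [StarOrderedRing B]

/-- If `v` dominates the values at `y` of all affine minorants of `f`, then it dominates `g(y)` for
`g < f`, locally with respect to a suitable partition of unity `∑ i, h i ^ 2`. -/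
theorem exists_partition_cfc_le {I : Set ℝ} {f : ℝ → ℝ} (hf : ConvexOn ℝ I f)
    (hfc : ContinuousOn f I) {y v : B}
    (hv : ∀ k d : ℝ, (∀ s ∈ I, k * s + d ≤ f s) → cfc (fun s => k * s + d) y ≤ v)
    {C : Set ℝ} (hC : IsCompact C) (hCI : C ⊆ I) {g : ℝ → ℝ} (hg : Continuous g)
    (hgf : ∀ s ∈ C, g s < f s) :
    ∃ (N : Finset ℝ) (h : ℝ → ℝ → ℝ), (∀ i, Continuous (h i)) ∧
      (∀ s, ∑ i ∈ N, h i s ^ 2 ≤ 1) ∧ (∀ s ∈ C, ∑ i ∈ N, h i s ^ 2 = 1) ∧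
      ∀ i ∈ N, cfc (fun s => h i s ^ 2 * g s) y ≤ cfc (h i) y * v * cfc (h i) y := by
  obtain ⟨N, h, k, d, hh, hkd, h1, h2, h3⟩ := exists_partition_affine hf hfc hC hCI hg hgf
  refine ⟨N, h, hh, h1, h2, fun i hi => ?_⟩
  have hhi := hh i
  refine le_trans (cfc_mono fun s _ => h3 i hi s) ?_
  refine le_trans (le_of_eq ?_) (IsSelfAdjoint.conjugate_le_conjugate (hv _ _ (hkd i hi))
    (IsSelfAdjoint.cfc (f := h i) (a := y)))
  rw [← cfc_mul _ _ y (by fun_prop) (by fun_prop), ← cfc_mul _ _ y (by fun_prop) (by fun_prop)]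
  congr 1
  ext s
  ring

end FunctionalCalculus

/-! ### Jensen's inequality for bounded functionals -/

section Bounded

variable {A : Type*} [NonUnitalCStarAlgebra A] [PartialOrder A] [StarOrderedRing A]

theorem multExt_sum (φ : StrongDual ℂ A) {ι : Type*} (N : Finset ι) (m : ι → 𝓜(ℂ, A)) :
    multExt φ (∑ i ∈ N, m i) = ∑ i ∈ N, multExt φ (m i) :=
  map_sum (multExtCLM φ) m N

/-- Membership in the centralizer extends from multiplication by elements of `A` to multiplication
by multipliers. -/
theorem multExt_mul_comm_of_mem_centralizer {φ : StrongDual ℂ A} {y : 𝓜(ℂ, A)}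
    (hy : y ∈ centralizer φ) (m : 𝓜(ℂ, A)) : multExt φ (m * y) = multExt φ (y * m) := by
  have h : φ.comp y.snd = φ.comp y.fst := ContinuousLinearMap.ext hy
  rw [← multExt_comp_snd, ← multExt_comp_fst, h]

/-- The centralizer is invariant under the functional calculus. -/
theorem multExt_mul_cfc_comm {φ : StrongDual ℂ A} {y : 𝓜(ℂ, A)} (hysa : IsSelfAdjoint y)
    (hy : y ∈ centralizer φ) {h : ℝ → ℝ} (hh : ContinuousOn h (spectrum ℝ y)) (m : 𝓜(ℂ, A)) :
    multExt φ (m * cfc h y) = multExt φ (cfc h y * m) := by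
  let S : Submodule ℝ 𝓜(ℂ, A) :=
    { carrier := {c | ∀ m, multExt φ (m * c) = multExt φ (c * m)}
      add_mem' := fun {a b} ha hb m => by
        rw [mul_add, add_mul, multExt_add, multExt_add, ha, hb]
      zero_mem' := fun m => by rw [mul_zero, zero_mul]
      smul_mem' := fun r c hc m => by
        have : r • c = (r : ℂ) • c := (Complex.coe_smul r c).symm
        rw [this, mul_smul_comm, smul_mul_assoc, multExt_smul, multExt_smul, hc] }
  have hS : IsClosed (S : Set 𝓜(ℂ, A)) := by
    have : (S : Set 𝓜(ℂ, A)) = ⋂ m, {c | multExt φ (m * c) = multExt φ (c * m)} := by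
      ext c
      exact Set.mem_iInter (s := fun m => {c | multExt φ (m * c) = multExt φ (c * m)}).symm
    rw [this]
    exact isClosed_iInter fun m => isClosed_eq
      ((continuous_multExt φ).comp (continuous_const.mul continuous_id))
      ((continuous_multExt φ).comp (continuous_id.mul continuous_const))
  refine cfc_mem_of_pow_mem hS hysa (fun n => ?_) hh m
  induction n with
  | zero => intro m; rw [pow_zero, mul_one, one_mul]
  | succ n ih =>
    intro m
    rw [pow_succ, ← mul_assoc, multExt_mul_comm_of_mem_centralizer hy, ← mul_assoc, ih, mul_assoc]

/-- Jensen's inequality for a bounded positive functional whose centralizer contains `y`. -/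
theorem multExt_cfc_le {I : Set ℝ} {f : ℝ → ℝ} (hf : ConvexOn ℝ I f) (hfc : ContinuousOn f I)
    {y v : 𝓜(ℂ, A)} (hysa : IsSelfAdjoint y) (hyI : spectrum ℝ y ⊆ I)
    (hv : ∀ k d : ℝ, (∀ s ∈ I, k * s + d ≤ f s) → cfc (fun s => k * s + d) y ≤ v)
    {φ : StrongDual ℂ A} (hφ : IsPositive φ) (hy : y ∈ centralizer φ) :
    multExt φ (cfc f y) ≤ multExt φ v := by
  obtain ⟨g, hg, hgf⟩ := exists_continuous_eqOn (spectrum.isClosed y) (hfc.mono hyI)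
  rw [← cfc_congr hgf]
  have key : ∀ ε : ℝ, 0 < ε → multExt φ (cfc g y) - (ε : ℂ) * multExt φ 1 ≤ multExt φ v := by
    intro ε hε
    obtain ⟨N, h, hh, -, h1, hle⟩ := exists_partition_cfc_le hf hfc hv (spectrum.isCompact y)
      hyI (g := fun s => g s - ε) (by fun_prop) (fun s hs => by rw [hgf hs]; linarith)
    have hsum : ∀ u : ℝ → ℝ, Continuous u →
        cfc u y = ∑ i ∈ N, cfc (fun s => h i s ^ 2 * u s) y := fun u hu => by
      rw [← cfc_sum (fun i s => h i s ^ 2 * u s) y N fun i _ => by have := hh i; fun_prop]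
      refine cfc_congr fun s hs => ?_
      simp only [Finset.sum_apply, ← Finset.sum_mul, h1 s hs, one_mul]
    have hv' : multExt φ v = ∑ i ∈ N, multExt φ (cfc (h i) y * v * cfc (h i) y) := by
      have hone := hsum (fun _ => 1) continuous_const
      rw [cfc_const_one ℝ y] at hone
      conv_lhs => rw [← one_mul v, hone, Finset.sum_mul, multExt_sum]
      refine Finset.sum_congr rfl fun i _ => ?_
      have hi := hh i
      rw [multExt_mul_cfc_comm hysa hy hi.continuousOn, ← mul_assoc,
        ← cfc_mul _ _ y (by fun_prop) (by fun_prop)]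
      congr 3
      ext s
      ring
    have hg' : multExt φ (cfc g y) - (ε : ℂ) * multExt φ 1 =
        ∑ i ∈ N, multExt φ (cfc (fun s => h i s ^ 2 * (g s - ε)) y) := by
      rw [← multExt_sum, ← hsum (fun s => g s - ε) (by fun_prop),
        cfc_sub g (fun _ => ε) y (by fun_prop) (by fun_prop), cfc_const ε y, multExt_sub,
        algebraMap_real_eq, multExt_smul]
    rw [hv', hg']
    exact Finset.sum_le_sum fun i hi => hφ.multExt_mono (hle i hi)
  have hlim : Tendsto (fun ε : ℝ => multExt φ (cfc g y) - (ε : ℂ) * multExt φ 1) (𝓝[>] 0)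
      (𝓝 (multExt φ (cfc g y))) := by
    have : Continuous fun ε : ℝ => multExt φ (cfc g y) - (ε : ℂ) * multExt φ 1 := by fun_prop
    have h2 := this.tendsto 0
    rw [Complex.ofReal_zero, zero_mul, sub_zero] at h2
    exact h2.mono_left nhdsWithin_le_nhds
  exact le_of_tendsto hlim (eventually_mem_nhdsWithin.mono fun ε hε => key ε hε)

end Bounded

/-! ### The minimal dense ideal -/

section MinDenseIdeal

variable {A : Type*} [NonUnitalCStarAlgebra A] [PartialOrder A] [StarOrderedRing A]

/-- An element with a local unit lies in every dense ideal `J`: if `x ∈ J` is close to the local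
unit `e`, then `1 - e + x` is invertible, and `r * (1 - e + x) = r * x`. -/
theorem mem_minDenseIdeal_of_mul_eq {r e : A} (h : r * e = r) : r ∈ minDenseIdeal A := by
  refine Submodule.mem_sInf.mpr ?_
  rintro J ⟨hJ, hJA⟩
  obtain ⟨x, hx, hxe⟩ := Metric.dense_iff.mp hJ e 1 one_pos
  have hlt : ‖DoubleCentralizer.coe ℂ (e - x)‖ < 1 := by
    rw [norm_coe, ← dist_eq_norm, dist_comm]
    exact hx
  obtain ⟨u, hu⟩ := isUnit_one_sub_of_norm_lt_one hlt
  set v : 𝓜(ℂ, A) := ↑u⁻¹ with hv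
  have h1 : (1 - DoubleCentralizer.coe ℂ (e - x)) * v = 1 := by rw [← hu, hv, u.mul_inv]
  have h2 : v = 1 + DoubleCentralizer.coe ℂ (v.snd (e - x)) := by
    rw [← coe_mul, ← h1]
    noncomm_ring
  have h3 : DoubleCentralizer.coe ℂ r * (1 - DoubleCentralizer.coe ℂ (e - x)) =
      DoubleCentralizer.coe ℂ (r * x) := by
    rw [mul_sub, mul_one, ← coe_mul_coe, ← coe_sub, mul_sub, h, sub_sub_cancel]
  have h4 : r = r * x + r * x * v.snd (e - x) := by
    rw [← coe_inj, coe_add, coe_mul_coe (r * x), ← h3]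
    calc DoubleCentralizer.coe ℂ r =
          DoubleCentralizer.coe ℂ r * ((1 - DoubleCentralizer.coe ℂ (e - x)) * v) := by
          rw [h1, mul_one]
      _ = DoubleCentralizer.coe ℂ r * ((1 - DoubleCentralizer.coe ℂ (e - x)) *
          (1 + DoubleCentralizer.coe ℂ (v.snd (e - x)))) := by rw [← h2]
      _ = _ := by noncomm_ring
  rw [h4]
  have h5 : r * x ∈ J := (hJA x hxe r).1
  exact J.add_mem h5 (hJA _ h5 _).2

/-- The minimal dense ideal is a right ideal. -/
theorem mul_mem_minDenseIdeal {x : A} (hx : x ∈ minDenseIdeal A) (a : A) :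
    x * a ∈ minDenseIdeal A := by
  refine Submodule.mem_sInf.mpr fun J hJ => ?_
  exact (hJ.2 x (Submodule.mem_sInf.mp hx J hJ) a).2

/-- The approximate unit can be replaced by elements `g * g` with local units. -/
theorem exists_local_unit {ι : Type*} (N : Finset ι) (a : ι → A) {ε : ℝ} (hε : 0 < ε) :
    ∃ g u : A, IsSelfAdjoint g ∧ g * u = g ∧ ‖g‖ ≤ 1 ∧ ∀ i ∈ N, ‖a i * (g * g) - a i‖ ≤ ε := by
  have hl := CStarAlgebra.increasingApproximateUnit A
  have hev : ∀ᶠ e in CStarAlgebra.approximateUnit A, ∀ i ∈ N, ‖a i * e - a i‖ ≤ ε / 2 := by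
    refine (N.eventually_all).mpr fun i _ => ?_
    have := tendsto_iff_norm_sub_tendsto_zero.mp (hl.tendsto_mul_left (a i))
    exact this.eventually_le_const (half_pos hε)
  obtain ⟨e, he, he0, he1⟩ := (hev.and (hl.eventually_nonneg.and hl.eventually_norm)).exists
  set R := ∑ i ∈ N, ‖a i‖ with hR
  have hR0 : 0 ≤ R := Finset.sum_nonneg fun _ _ => norm_nonneg _
  obtain ⟨δ, hδ, hδR⟩ : ∃ δ : ℝ, 0 < δ ∧ R * δ ≤ ε / 2 := by
    refine ⟨ε / 2 / (R + 1), by positivity, ?_⟩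
    rw [mul_div_assoc', div_le_iff₀ (by positivity)]
    nlinarith
  have hspec : ∀ s ∈ quasispectrum ℝ e, 0 ≤ s ∧ s ≤ 1 := fun s hs =>
    ⟨quasispectrum_nonneg_of_nonneg e he0 s hs,
      (le_abs_self s).trans ((NonUnitalIsometricContinuousFunctionalCalculus.norm_quasispectrum_le
        e hs he0.isSelfAdjoint).trans he1)⟩
  refine ⟨cfcₙ (fun s => Real.sqrt (max (s - δ) 0)) e, cfcₙ (fun s => min (max (s / δ) 0) 1) e,
    IsSelfAdjoint.cfcₙ, ?_, ?_, fun i hi => ?_⟩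
  · rw [← cfcₙ_mul _ _ e (by fun_prop) (by simp [hδ.le]) (by fun_prop) (by simp)]
    refine cfcₙ_congr fun s hs => ?_
    rcases le_total s δ with h | h
    · simp [max_eq_right (sub_nonpos.mpr h)]
    · have : 1 ≤ s / δ := (one_le_div hδ).mpr h
      simp [max_eq_left (zero_le_one.trans this), min_eq_right this]
  · refine norm_cfcₙ_le fun s hs => ?_
    rw [Real.norm_of_nonneg (Real.sqrt_nonneg _)]
    exact Real.sqrt_le_one.mpr (max_le (by linarith [(hspec s hs).2]) zero_le_one)
  · have h1 : ‖cfcₙ (fun s => Real.sqrt (max (s - δ) 0)) e *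
        cfcₙ (fun s => Real.sqrt (max (s - δ) 0)) e - e‖ ≤ δ := by
      rw [← cfcₙ_mul _ _ e (by fun_prop) (by simp [hδ.le]) (by fun_prop) (by simp [hδ.le])]
      nth_rewrite 2 [← cfcₙ_id' ℝ e he0.isSelfAdjoint]
      rw [← cfcₙ_sub _ _ e (by fun_prop) (by simp [hδ.le]) (by fun_prop) (by simp)]
      refine norm_cfcₙ_le fun s hs => ?_
      rw [Real.mul_self_sqrt (le_max_right _ _), Real.norm_eq_abs, abs_le]
      have := (hspec s hs).1
      constructor
      · linarith [le_max_left (s - δ) 0]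
      · rcases max_cases (s - δ) 0 with h | h <;> linarith [h.1]
    set p := cfcₙ (fun s => Real.sqrt (max (s - δ) 0)) e
    have h2 : a i * (p * p) - a i = a i * (p * p - e) + (a i * e - a i) := by noncomm_ring
    have h3 : ‖a i‖ ≤ R := Finset.single_le_sum (fun _ _ => norm_nonneg _) hi
    rw [h2]
    calc _ ≤ ‖a i‖ * ‖p * p - e‖ + ‖a i * e - a i‖ :=
          (norm_add_le _ _).trans (add_le_add_left (norm_mul_le _ _) _)
      _ ≤ R * δ + ε / 2 := add_le_add (mul_le_mul h3 h1 (norm_nonneg _) hR0) (he i hi)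
      _ ≤ ε := by linarith

end MinDenseIdeal

/-! ### The linear extension of an unbounded functional -/

namespace PosFunctional

variable {A : Type*} [NonUnitalCStarAlgebra A] [PartialOrder A] [StarOrderedRing A]
  (φ : PosFunctional A)

theorem mono {a b : A} (ha : 0 ≤ a) (hab : a ≤ b) : φ.toFun a ≤ φ.toFun b := by
  have := φ.map_add a (b - a) ha (sub_nonneg.mpr hab)
  rw [add_sub_cancel] at this
  rw [this]
  exact le_self_add

theorem map_sum {ι : Type*} (N : Finset ι) (a : ι → A) (ha : ∀ i ∈ N, 0 ≤ a i) :
    φ.toFun (∑ i ∈ N, a i) = ∑ i ∈ N, φ.toFun (a i) := by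
  classical
  induction N using Finset.induction_on with
  | empty => simp [φ.map_zero]
  | insert i N hi ih =>
    rw [Finset.sum_insert hi, Finset.sum_insert hi, φ.map_add _ _ (ha i (by simp))
      (Finset.sum_nonneg fun j hj => ha j (by simp [hj])),
      ih fun j hj => ha j (by simp [hj])]

variable {φ}

theorem IsDecomp.add {v w : A} {p q : Fin 4 → A} (hp : φ.IsDecomp v p) (hq : φ.IsDecomp w q) :
    φ.IsDecomp (v + w) (p + q) := by
  refine ⟨fun i => ⟨add_nonneg (hp.1 i).1 (hq.1 i).1, ?_⟩, ?_⟩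
  · rw [Pi.add_apply, φ.map_add _ _ (hp.1 i).1 (hq.1 i).1]
    exact ENNReal.add_ne_top.mpr ⟨(hp.1 i).2, (hq.1 i).2⟩
  · rw [hp.2, hq.2]
    simp only [Pi.add_apply, smul_sub, smul_add]
    abel

theorem IsDecomp.I_smul {w : A} {p : Fin 4 → A} (hp : φ.IsDecomp w p) :
    φ.IsDecomp (Complex.I • w) ![p 3, p 2, p 0, p 1] := by
  refine ⟨fun i => ?_, ?_⟩
  · fin_cases i
    exacts [hp.1 3, hp.1 2, hp.1 0, hp.1 1]
  · rw [hp.2, smul_add, smul_smul, Complex.I_mul_I, neg_one_smul]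
    change _ = p 3 - p 2 + Complex.I • (p 0 - p 1)
    abel

theorem IsDecomp.neg {w : A} {p : Fin 4 → A} (hp : φ.IsDecomp w p) :
    φ.IsDecomp (-w) ![p 1, p 0, p 3, p 2] := by
  refine ⟨fun i => ?_, ?_⟩
  · fin_cases i
    exacts [hp.1 1, hp.1 0, hp.1 3, hp.1 2]
  · rw [hp.2]
    change _ = p 1 - p 0 + Complex.I • (p 3 - p 2)
    rw [← neg_sub (p 2), smul_neg]
    abel

theorem IsDecomp.star {w : A} {p : Fin 4 → A} (hp : φ.IsDecomp w p) :
    φ.IsDecomp (star w) ![p 0, p 1, p 3, p 2] := by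
  refine ⟨fun i => ?_, ?_⟩
  · fin_cases i
    exacts [hp.1 0, hp.1 1, hp.1 3, hp.1 2]
  · have hs : ∀ i, Star.star (p i) = p i := fun i => (hp.1 i).1.isSelfAdjoint.star_eq
    rw [hp.2]
    change _ = p 0 - p 1 + Complex.I • (p 3 - p 2)
    rw [star_add, star_smul, star_sub, star_sub, hs, hs, hs, hs, ← neg_sub (p 2), smul_neg,
      Complex.star_def, Complex.conj_I, neg_smul]

theorem IsDecomp.real_smul {w : A} {p : Fin 4 → A} (hp : φ.IsDecomp w p) (r : ℝ≥0) :
    φ.IsDecomp (((r : ℝ) : ℂ) • w) (fun i => ((r : ℝ) : ℂ) • p i) := by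
  refine ⟨fun i => ⟨?_, ?_⟩, ?_⟩
  · beta_reduce
    rw [Complex.coe_smul]
    exact smul_nonneg r.2 (hp.1 i).1
  · rw [φ.map_smul r _ (hp.1 i).1]
    exact ENNReal.mul_ne_top ENNReal.coe_ne_top (hp.1 i).2
  · rw [hp.2]
    simp only [smul_add, smul_sub, smul_comm (Complex.I)]

theorem linExt_add {v w : A} (hv : ∃ p, φ.IsDecomp v p) (hw : ∃ q, φ.IsDecomp w q) :
    φ.linExt (v + w) = φ.linExt v + φ.linExt w := by
  obtain ⟨p, hp⟩ := hv
  obtain ⟨q, hq⟩ := hw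
  rw [φ.linExt_eq hp, φ.linExt_eq hq, φ.linExt_eq (hp.add hq)]
  have h : ∀ i, (φ.toFun (p i + q i)).toReal = (φ.toFun (p i)).toReal + (φ.toFun (q i)).toReal :=
    fun i => by
      rw [φ.map_add _ _ (hp.1 i).1 (hq.1 i).1, ENNReal.toReal_add (hp.1 i).2 (hq.1 i).2]
  simp only [decompValue, Pi.add_apply, h]
  push_cast
  ring

theorem linExt_I_smul {w : A} (hw : ∃ p, φ.IsDecomp w p) :
    φ.linExt (Complex.I • w) = Complex.I * φ.linExt w := by
  obtain ⟨p, hp⟩ := hw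
  rw [φ.linExt_eq hp, φ.linExt_eq hp.I_smul]
  change (((φ.toFun (p 3)).toReal - (φ.toFun (p 2)).toReal : ℝ) : ℂ) +
    Complex.I * (((φ.toFun (p 0)).toReal - (φ.toFun (p 1)).toReal : ℝ) : ℂ) = _
  rw [decompValue]
  push_cast
  linear_combination -((φ.toFun (p 2)).toReal - (φ.toFun (p 3)).toReal : ℂ) * Complex.I_mul_I

theorem linExt_neg {w : A} (hw : ∃ p, φ.IsDecomp w p) : φ.linExt (-w) = -φ.linExt w := by
  obtain ⟨p, hp⟩ := hw
  rw [φ.linExt_eq hp, φ.linExt_eq hp.neg]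
  change (((φ.toFun (p 1)).toReal - (φ.toFun (p 0)).toReal : ℝ) : ℂ) +
    Complex.I * (((φ.toFun (p 3)).toReal - (φ.toFun (p 2)).toReal : ℝ) : ℂ) = _
  rw [decompValue]
  push_cast
  ring

theorem linExt_star {w : A} (hw : ∃ p, φ.IsDecomp w p) :
    φ.linExt (star w) = (starRingEnd ℂ) (φ.linExt w) := by
  obtain ⟨p, hp⟩ := hw
  rw [φ.linExt_eq hp, φ.linExt_eq hp.star]
  change (((φ.toFun (p 0)).toReal - (φ.toFun (p 1)).toReal : ℝ) : ℂ) +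
    Complex.I * (((φ.toFun (p 3)).toReal - (φ.toFun (p 2)).toReal : ℝ) : ℂ) = _
  rw [decompValue, _root_.map_add, _root_.map_mul, Complex.conj_I, Complex.conj_ofReal,
    Complex.conj_ofReal]
  push_cast
  ring

theorem linExt_nnreal_smul {w : A} (hw : ∃ p, φ.IsDecomp w p) (r : ℝ≥0) :
    φ.linExt (((r : ℝ) : ℂ) • w) = (r : ℝ) * φ.linExt w := by
  obtain ⟨p, hp⟩ := hw
  rw [φ.linExt_eq hp, φ.linExt_eq (hp.real_smul r)]
  have h : ∀ i, (φ.toFun (((r : ℝ) : ℂ) • p i)).toReal = r * (φ.toFun (p i)).toReal := fun i => by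
    rw [φ.map_smul r _ (hp.1 i).1, ENNReal.toReal_mul, ENNReal.coe_toReal]
  simp only [decompValue, h]
  push_cast
  ring

theorem exists_isDecomp_real_smul {w : A} (hw : ∃ p, φ.IsDecomp w p) (r : ℝ) :
    (∃ p, φ.IsDecomp ((r : ℂ) • w) p) ∧ φ.linExt ((r : ℂ) • w) = r * φ.linExt w := by
  obtain ⟨p, hp⟩ := hw
  rcases le_total 0 r with h | h
  · lift r to ℝ≥0 using h
    exact ⟨⟨_, hp.real_smul r⟩, linExt_nnreal_smul ⟨p, hp⟩ r⟩
  · obtain ⟨t, rfl⟩ : ∃ t : ℝ, r = -t := ⟨-r, by ring⟩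
    have ht : 0 ≤ t := by linarith
    lift t to ℝ≥0 using ht
    rw [Complex.ofReal_neg, neg_smul, linExt_neg ⟨_, hp.real_smul t⟩, linExt_nnreal_smul ⟨p, hp⟩]
    exact ⟨⟨_, (hp.real_smul t).neg⟩, by ring⟩

theorem linExt_smul {w : A} (hw : ∃ p, φ.IsDecomp w p) (c : ℂ) :
    φ.linExt (c • w) = c * φ.linExt w := by
  have h1 := exists_isDecomp_real_smul hw c.re
  have h2 := exists_isDecomp_real_smul hw c.im
  have h3 : c • w = (c.re : ℂ) • w + Complex.I • ((c.im : ℂ) • w) := by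
    rw [smul_smul, ← add_smul, mul_comm Complex.I, Complex.re_add_im]
  obtain ⟨p, hp⟩ := h2.1
  rw [h3, linExt_add h1.1 ⟨_, hp.I_smul⟩, h1.2, linExt_I_smul h2.1, h2.2, ← mul_assoc,
    mul_comm Complex.I, ← add_mul, Complex.re_add_im]

theorem linExt_of_nonneg {w : A} (hw : 0 ≤ w) (h : φ.toFun w ≠ ∞) :
    φ.linExt w = ((φ.toFun w).toReal : ℂ) := by
  have h0 : φ.toFun 0 ≠ ∞ := by rw [φ.map_zero]; exact ENNReal.zero_ne_top
  have hp : φ.IsDecomp w ![w, 0, 0, 0] := by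
    refine ⟨fun i => ?_, ?_⟩
    · fin_cases i
      exacts [⟨hw, h⟩, ⟨le_rfl, h0⟩, ⟨le_rfl, h0⟩, ⟨le_rfl, h0⟩]
    · change w = w - 0 + Complex.I • (0 - 0)
      simp
  rw [φ.linExt_eq hp]
  change (((φ.toFun w).toReal - (φ.toFun 0).toReal : ℝ) : ℂ) +
    Complex.I * (((φ.toFun 0).toReal - (φ.toFun 0).toReal : ℝ) : ℂ) = _
  simp [φ.map_zero]

/-- Polarization: the decomposition of `c * star d` into the four elements `x * star x / 4` with
`x = c ± d` and `x = c ± i d`. -/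
theorem isDecomp_mul_star {c d : A} (h : ∀ k : ℂ, φ.toFun ((c + k • d) * star (c + k • d)) ≠ ∞) :
    φ.IsDecomp (c * star d) (fun i => (((4⁻¹ : ℝ≥0) : ℝ) : ℂ) •
      ((c + (![1, -1, Complex.I, -Complex.I] i : ℂ) • d) *
        star (c + (![1, -1, Complex.I, -Complex.I] i : ℂ) • d))) := by
  refine ⟨fun i => ⟨?_, ?_⟩, ?_⟩
  · beta_reduce
    rw [Complex.coe_smul]
    exact smul_nonneg (NNReal.coe_nonneg _) (mul_star_self_nonneg _)
  · rw [φ.map_smul _ _ (mul_star_self_nonneg _)]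
    exact ENNReal.mul_ne_top ENNReal.coe_ne_top (h _)
  · rw [← smul_sub, ← smul_sub, smul_comm Complex.I, ← smul_add, eq_comm]
    have h4 : ((((4⁻¹ : ℝ≥0) : ℝ) : ℂ)) * 4 = 1 := by push_cast; norm_num
    rw [← one_smul ℂ (c * star d), ← h4, mul_smul]
    congr 1
    simp only [Matrix.cons_val, star_add, star_smul, add_mul, mul_add, smul_mul_assoc,
      mul_smul_comm, smul_sub, smul_add, smul_smul, star_neg, Complex.star_def,
      Complex.conj_I]
    match_scalars <;> ring_nf <;> norm_num [Complex.I_sq]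

end PosFunctional

/-! ### The quadratic form of an unbounded functional -/

namespace PosFunctional

variable {A : Type*} [NonUnitalCStarAlgebra A] [PartialOrder A] [StarOrderedRing A]
  {φ : PosFunctional A}

theorem toFun_mul_star_ne_top (hK : φ.FiniteOnMinDenseIdeal) {c u : A} (h : c * u = c) :
    φ.toFun (c * star c) ≠ ∞ :=
  hK _ (mul_mem_minDenseIdeal (mem_minDenseIdeal_of_mul_eq h) _) (mul_star_self_nonneg _)

theorem exists_isDecomp_mul_star (hK : φ.FiniteOnMinDenseIdeal) {c d u : A} (hc : c * u = c)
    (hd : d * u = d) : ∃ p, φ.IsDecomp (c * star d) p :=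
  ⟨_, isDecomp_mul_star fun k => toFun_mul_star_ne_top hK (u := u) (by
    rw [add_mul, smul_mul_assoc, hc, hd])⟩

/-- Local units survive multiplication by multipliers on the other side. -/
theorem fst_mul_eq {w u : A} (h : w * u = w) (m : 𝓜(ℂ, A)) : m.fst w * u = m.fst w := by
  rw [← fst_mul, h]

/-- The weak parallelogram inequality. -/
theorem toFun_sub_mul_star_le (a b : A) : φ.toFun ((a - b) * star (a - b)) ≤
    (φ.toFun (a * star a) + φ.toFun (a * star a)) +
      (φ.toFun (b * star b) + φ.toFun (b * star b)) := by
  have hn := fun c : A => mul_star_self_nonneg c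
  rw [← φ.map_add _ _ (hn a) (hn a), ← φ.map_add _ _ (hn b) (hn b),
    ← φ.map_add _ _ (add_nonneg (hn a) (hn a)) (add_nonneg (hn b) (hn b))]
  refine φ.mono (hn _) (sub_nonneg.mp ?_)
  refine (hn (a + b)).trans_eq ?_
  simp only [star_add, star_sub]
  noncomm_ring

/-- By Baire's theorem, the finite lower semicontinuous quadratic form `m ↦ φ(m w w⋆ m⋆)` on
`M(A)` is bounded on a neighbourhood of `0`. -/
theorem exists_ball_toFun_le (hφ : φ.LowerSemicont) (hK : φ.FiniteOnMinDenseIdeal) {w u : A}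
    (hw : w * u = w) : ∃ r > 0, ∃ C : ℝ≥0, ∀ m : 𝓜(ℂ, A), ‖m‖ ≤ r →
      φ.toFun (m.fst w * star (m.fst w)) ≤ C := by
  have hcont : Continuous fun m : 𝓜(ℂ, A) => m.fst w * star (m.fst w) := by
    have : Continuous fun m : 𝓜(ℂ, A) => m.fst w := by
      let L : 𝓜(ℂ, A) →ₗ[ℂ] A :=
        { toFun := fun m => m.fst w, map_add' := fun _ _ => rfl, map_smul' := fun _ _ => rfl }
      exact AddMonoidHomClass.continuous_of_bound L ‖w‖ fun m => by
        rw [mul_comm]; exact norm_fst_apply_le m w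
    exact this.mul this.star
  have hlsc : LowerSemicontinuous fun m : 𝓜(ℂ, A) => φ.toFun (m.fst w * star (m.fst w)) := by
    rw [← lowerSemicontinuousOn_univ_iff]
    exact LowerSemicontinuousOn.comp (g := fun m : 𝓜(ℂ, A) => m.fst w * star (m.fst w)) hφ
      hcont.continuousOn fun m _ => mul_star_self_nonneg _
  obtain ⟨k, m₀, hm₀⟩ := nonempty_interior_of_iUnion_of_closed
    (f := fun k : ℕ => {m : 𝓜(ℂ, A) | φ.toFun (m.fst w * star (m.fst w)) ≤ k})
    (fun k => hlsc.isClosed_preimage (k : ℝ≥0∞))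
    (Set.eq_univ_of_forall fun m => by
      obtain ⟨k, hk⟩ := ENNReal.exists_nat_gt (toFun_mul_star_ne_top hK (fst_mul_eq hw m))
      exact Set.mem_iUnion.mpr ⟨k, hk.le⟩)
  obtain ⟨r, hr, hball⟩ := Metric.isOpen_iff.mp isOpen_interior m₀ hm₀
  have hk : ∀ m ∈ Metric.ball m₀ r, φ.toFun (m.fst w * star (m.fst w)) ≤ k := fun m hm => by
    have := interior_subset (hball hm)
    exact this
  refine ⟨r / 2, half_pos hr, k + k + (k + k), fun m hm => ?_⟩
  have h1 : m.fst w = (m₀ + m).fst w - m₀.fst w := by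
    change _ = m₀.fst w + m.fst w - m₀.fst w
    abel
  have h2 := hk (m₀ + m) (by
    rw [Metric.mem_ball, dist_eq_norm, add_sub_cancel_left]
    exact hm.trans_lt (half_lt_self hr))
  have h3 := hk m₀ (Metric.mem_ball_self hr)
  rw [h1]
  refine (toFun_sub_mul_star_le _ _).trans ?_
  push_cast
  exact add_le_add (add_le_add h2 h2) (add_le_add h3 h3)

theorem norm_decompValue_le {p : Fin 4 → A} {C : ℝ} (hp : ∀ i, (φ.toFun (p i)).toReal ≤ C) :
    ‖φ.decompValue p‖ ≤ 4 * C := by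
  have h : ∀ i, ‖((φ.toFun (p i)).toReal : ℂ)‖ ≤ C := fun i => by
    rw [Complex.norm_of_nonneg ENNReal.toReal_nonneg]
    exact hp i
  rw [decompValue]
  push_cast
  refine (norm_jordan_le _ _ _ _).trans ?_
  linarith [h 0, h 1, h 2, h 3]

section Form

variable {w u : A}

/-- The linear functional `m ↦ φ(m w d⋆)` on `M(A)`, for `w` and `d` with a common local unit. -/
def formLeft (hK : φ.FiniteOnMinDenseIdeal) (hw : w * u = w)
    {d : A} (hd : d * u = d) : 𝓜(ℂ, A) →ₗ[ℂ] ℂ where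
  toFun m := φ.linExt (m.fst w * star d)
  map_add' m n := by
    rw [← linExt_add (exists_isDecomp_mul_star hK (fst_mul_eq hw m) hd)
      (exists_isDecomp_mul_star hK (fst_mul_eq hw n) hd), ← add_mul]
    rfl
  map_smul' c m := by
    rw [RingHom.id_apply, smul_eq_mul,
      ← linExt_smul (exists_isDecomp_mul_star hK (fst_mul_eq hw m) hd), ← smul_mul_assoc]
    rfl

theorem formLeft_apply (hK : φ.FiniteOnMinDenseIdeal) (hw : w * u = w)
    {d : A} (hd : d * u = d) (m : 𝓜(ℂ, A)) :
    formLeft hK hw hd m = φ.linExt (m.fst w * star d) := rfl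

theorem continuous_formLeft (hK : φ.FiniteOnMinDenseIdeal) (hw : w * u = w)
    (hφ : φ.LowerSemicont) {d : A} (hd : d * u = d) :
    Continuous (formLeft hK hw hd) := by
  obtain ⟨r, hr, C, hC⟩ := exists_ball_toFun_le hφ hK hw
  have hd4 : ∀ k : ℂ, ‖k‖ = 1 → (k • d) * star (k • d) = d * star d := fun k hk => by
    rw [star_smul, smul_mul_smul_comm, Complex.star_def, Complex.mul_conj, Complex.normSq_eq_norm_sq,
      hk]
    simp
  set D := φ.toFun (d * star d) with hD
  have hDt : D ≠ ∞ := toFun_mul_star_ne_top hK hd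
  have hQ : ∀ m : 𝓜(ℂ, A), ‖m‖ ≤ r → ∀ k : ℂ, ‖k‖ = 1 →
      φ.toFun ((m.fst w + k • d) * star (m.fst w + k • d)) ≤ C + C + (D + D) := fun m hm k hk => by
    have h1 := toFun_sub_mul_star_le (φ := φ) (m.fst w) ((-k) • d)
    rw [hd4 _ (by rwa [norm_neg]), neg_smul, sub_neg_eq_add] at h1
    exact h1.trans (add_le_add (add_le_add (hC m hm) (hC m hm)) le_rfl)
  have hE : (C : ℝ≥0∞) + C + (D + D) ≠ ∞ := by simp [hDt]
  refine AddMonoidHomClass.continuous_of_bound (formLeft hK hw hd)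
    (4 * ((C : ℝ≥0∞) + C + (D + D)).toReal / r)
    ((formLeft hK hw hd).bound_of_ball_bound' hr _ fun m hm => ?_)
  rw [mem_closedBall_zero_iff] at hm
  rw [formLeft_apply, φ.linExt_eq (isDecomp_mul_star fun k => toFun_mul_star_ne_top hK (u := u) (by
    rw [add_mul, smul_mul_assoc, fst_mul_eq hw, hd]))]
  refine norm_decompValue_le fun i => ENNReal.toReal_mono hE ?_
  rw [φ.map_smul _ _ (mul_star_self_nonneg _)]
  refine (mul_le_of_le_one_left zero_le ?_).trans (hQ m hm _ ?_)
  · rw [← ENNReal.coe_one, ENNReal.coe_le_coe]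
    exact inv_le_one_of_one_le₀ (by norm_num)
  · fin_cases i <;> simp

/-- The form `(m, n) ↦ φ(m w w⋆ n⋆)` is hermitian. -/
theorem linExt_form_symm (hK : φ.FiniteOnMinDenseIdeal) (hw : w * u = w)
    (m n : 𝓜(ℂ, A)) : φ.linExt (m.fst w * star (n.fst w)) =
    (starRingEnd ℂ) (φ.linExt (n.fst w * star (m.fst w))) := by
  rw [← linExt_star (exists_isDecomp_mul_star hK (fst_mul_eq hw n) (fst_mul_eq hw m)), star_mul,
    star_star]

/-- The functional calculus of an element `y` of the centralizer is symmetric with respect to the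
form `(m, n) ↦ φ(m w w⋆ n⋆)`. -/
theorem linExt_cfc_comm (hK : φ.FiniteOnMinDenseIdeal) (hw : w * u = w)
    (hφ : φ.LowerSemicont) {y : 𝓜(ℂ, A)} (hysa : IsSelfAdjoint y)
    (hy : y ∈ φ.centralizer) {h : ℝ → ℝ} (hh : ContinuousOn h (spectrum ℝ y)) (m n : 𝓜(ℂ, A)) :
    φ.linExt ((cfc h y * m).fst w * star (n.fst w)) =
      φ.linExt (m.fst w * star ((cfc h y * n).fst w)) := by
  have hl : ∀ m n, φ.linExt (m.fst w * star (n.fst w)) = formLeft hK hw (fst_mul_eq hw n) m :=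
    fun _ _ => rfl
  -- the second condition is stated with a conjugate, which turns it into a condition on the first
  -- argument of the form, in which it is continuous
  let S : Submodule ℝ 𝓜(ℂ, A) :=
    { carrier := {c | ∀ m n, formLeft hK hw (fst_mul_eq hw n) (c * m) =
        (starRingEnd ℂ) (formLeft hK hw (fst_mul_eq hw m) (c * n))}
      add_mem' := fun {a b} ha hb m n => by
        rw [add_mul, add_mul, _root_.map_add, _root_.map_add, ha, hb, _root_.map_add]
      zero_mem' := fun m n => by simp
      smul_mem' := fun r c hc m n => by
        have : r • c = (r : ℂ) • c := (Complex.coe_smul r c).symm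
        rw [this, smul_mul_assoc, smul_mul_assoc, _root_.map_smul, _root_.map_smul, hc,
          smul_eq_mul, smul_eq_mul, _root_.map_mul (starRingEnd ℂ), Complex.conj_ofReal] }
  have hS : IsClosed (S : Set 𝓜(ℂ, A)) := by
    have : (S : Set 𝓜(ℂ, A)) = ⋂ m, ⋂ n, {c | formLeft hK hw (fst_mul_eq hw n) (c * m) =
        (starRingEnd ℂ) (formLeft hK hw (fst_mul_eq hw m) (c * n))} := by
      ext c
      simp only [Set.mem_iInter]
      rfl
    rw [this]
    refine isClosed_iInter fun m => isClosed_iInter fun n => isClosed_eq ?_ ?_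
    · exact (continuous_formLeft hK hw hφ _).comp (continuous_id.mul continuous_const)
    · exact Complex.continuous_conj.comp
        ((continuous_formLeft hK hw hφ _).comp (continuous_id.mul continuous_const))
  have hyS : ∀ m n : 𝓜(ℂ, A), φ.linExt ((y * m).fst w * star (n.fst w)) =
      φ.linExt (m.fst w * star ((y * n).fst w)) := fun m n => by
    have h1 := hy (m.fst w * star (n.fst w)) (mul_mem_minDenseIdeal
      (mem_minDenseIdeal_of_mul_eq (fst_mul_eq hw m)) _)
    rw [fst_mul, snd_mul] at h1
    rw [mul_fst_apply, mul_fst_apply, star_fst_apply y, hysa.star_eq, h1]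
  have hmem : cfc h y ∈ S := by
    refine cfc_mem_of_pow_mem hS hysa (fun k => ?_) hh
    induction k with
    | zero =>
      intro m n
      rw [pow_zero, one_mul, one_mul, ← hl, ← hl]
      exact linExt_form_symm hK hw m n
    | succ k ih =>
      intro m n
      rw [pow_succ, mul_assoc, ih, ← hl, ← linExt_form_symm hK hw, hyS,
        linExt_form_symm hK hw, ← mul_assoc, ← pow_succ', pow_succ]
      rfl
  rw [hl, hmem m n, ← hl, ← linExt_form_symm hK hw]

/-- Compressing by a quadratic partition of unity in the functional calculus of `y` does not
increase the value of `φ`. -/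
theorem sum_toFun_cfc_le (hK : φ.FiniteOnMinDenseIdeal) (hw : w * u = w)
    (hφ : φ.LowerSemicont) {y : 𝓜(ℂ, A)} (hysa : IsSelfAdjoint y)
    (hy : y ∈ φ.centralizer) {N : Finset ℝ} {h : ℝ → ℝ → ℝ} (hh : ∀ i, Continuous (h i))
    (h1 : ∀ s, ∑ i ∈ N, h i s ^ 2 ≤ 1) :
    ∑ i ∈ N, φ.toFun ((cfc (h i) y).fst w * star ((cfc (h i) y).fst w)) ≤
      φ.toFun (w * star w) := by
  set F := formLeft hK hw hw with hF
  have hval : ∀ k : ℝ → ℝ, Continuous k → F (cfc k y * cfc k y) =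
      ((φ.toFun ((cfc k y).fst w * star ((cfc k y).fst w))).toReal : ℂ) := fun k hk => by
    have := linExt_cfc_comm hK hw hφ hysa hy hk.continuousOn (cfc k y) 1
    rw [mul_one] at this
    rw [hF, formLeft_apply]
    refine Eq.trans this ?_
    exact linExt_of_nonneg (mul_star_self_nonneg _) (toFun_mul_star_ne_top hK (fst_mul_eq hw _))
  have hsum : Continuous fun s => ∑ i ∈ N, h i s ^ 2 :=
    continuous_finsetSum _ fun i _ => (hh i).pow 2
  -- `h0` completes the functions `h i` to a quadratic partition of unity
  let h0 : ℝ → ℝ := fun s => Real.sqrt (1 - ∑ i ∈ N, h i s ^ 2)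
  have hh0 : Continuous h0 := Real.continuous_sqrt.comp (continuous_const.sub hsum)
  have hone : (1 : 𝓜(ℂ, A)) = cfc h0 y * cfc h0 y + ∑ i ∈ N, cfc (h i) y * cfc (h i) y := by
    have hmul : ∀ k : ℝ → ℝ, Continuous k → cfc k y * cfc k y = cfc (fun s => k s ^ 2) y :=
      fun k hk => by
        rw [← cfc_mul k k y hk.continuousOn hk.continuousOn]
        congr 1
        ext s
        ring
    rw [hmul h0 hh0, Finset.sum_congr rfl fun i _ => hmul (h i) (hh i),
      ← cfc_sum (fun i s => h i s ^ 2) y N fun i _ => ((hh i).pow 2).continuousOn,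
      Finset.sum_fn, ← cfc_add y (fun s => h0 s ^ 2) (fun s => ∑ i ∈ N, h i s ^ 2)
        (hh0.pow 2).continuousOn hsum.continuousOn,
      ← cfc_const_one ℝ y]
    refine cfc_congr fun s _ => ?_
    simp only [h0]
    rw [Real.sq_sqrt (sub_nonneg.mpr (h1 s))]
    ring
  have h2 : F 1 = ((φ.toFun (w * star w)).toReal : ℂ) := by
    rw [hF, formLeft_apply]
    exact linExt_of_nonneg (mul_star_self_nonneg _) (toFun_mul_star_ne_top hK hw)
  rw [hone, _root_.map_add, _root_.map_sum, hval h0 hh0,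
    Finset.sum_congr rfl fun i _ => hval (h i) (hh i)] at h2
  have h3 : ∑ i ∈ N, (φ.toFun ((cfc (h i) y).fst w * star ((cfc (h i) y).fst w))).toReal ≤
      (φ.toFun (w * star w)).toReal := by
    have h4 : (φ.toFun ((cfc h0 y).fst w * star ((cfc h0 y).fst w))).toReal +
        ∑ i ∈ N, (φ.toFun ((cfc (h i) y).fst w * star ((cfc (h i) y).fst w))).toReal =
        (φ.toFun (w * star w)).toReal := by exact_mod_cast h2
    rw [← h4]
    exact le_add_of_nonneg_left ENNReal.toReal_nonneg
  have hfin : ∀ i ∈ N, φ.toFun ((cfc (h i) y).fst w * star ((cfc (h i) y).fst w)) ≠ ∞ :=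
    fun i _ => toFun_mul_star_ne_top hK (fst_mul_eq hw _)
  rw [← ENNReal.toReal_sum hfin] at h3
  exact (ENNReal.toReal_le_toReal (ENNReal.sum_ne_top.mpr hfin)
    (toFun_mul_star_ne_top hK hw)).mp h3

end Form

end PosFunctional

/-! ### Resolvents of positive elements -/

section Resolvent

variable {B : Type*} [CStarAlgebra B] [PartialOrder B] [StarOrderedRing B]

/-- For `0 ≤ v ≤ t` with `t` invertible, `v t⁻¹ v ≤ v`; here `r = t⁻¹` is written as `p * p` with
`p = t ^ (-1/2)`. -/
theorem mul_mul_self_le_of_le {v t p : B} (hv : 0 ≤ v) (hvt : v ≤ t) (hp : IsSelfAdjoint p)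
    (hpt : p * t * p = 1) : v * (p * p) * v ≤ v := by
  nontriviality B
  set s := CFC.sqrt v with hs
  have hss : s * s = v := CFC.sqrt_mul_sqrt_self v hv
  have hsa : star s = s := (CFC.sqrt_nonneg v).isSelfAdjoint.star_eq
  have h1 : star (s * p) * (s * p) ≤ 1 := by
    rw [star_mul, hsa, hp.star_eq, ← hpt, ← mul_assoc, mul_assoc p s s, hss]
    exact hp.conjugate_le_conjugate hvt
  have h2 : ‖star (s * p)‖ ≤ 1 := by
    rw [norm_star]
    have h3 := (CStarAlgebra.norm_le_one_iff_of_nonneg _ (star_mul_self_nonneg (s * p))).mpr h1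
    rw [CStarRing.norm_star_mul_self] at h3
    nlinarith [norm_nonneg (s * p)]
  have h4 : (s * p) * star (s * p) ≤ 1 := by
    refine (CStarAlgebra.norm_le_one_iff_of_nonneg _ (mul_star_self_nonneg (s * p))).mp ?_
    rw [CStarRing.norm_self_mul_star, ← norm_star]
    exact mul_le_one₀ h2 (norm_nonneg _) h2
  have h5 := star_left_conjugate_le_conjugate h4 s
  rw [star_mul, hsa, hp.star_eq, mul_one, hss] at h5
  refine le_trans (le_of_eq ?_) h5
  rw [← hss]
  simp only [mul_assoc]

/-- An inverse and an inverse square root of `δ + v` for positive `v`. -/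
theorem exists_inv_sqrt {v : B} (hv : 0 ≤ v) {δ : ℝ} (hδ : 0 < δ) :
    ∃ p : B, IsSelfAdjoint p ∧ p * (algebraMap ℝ B δ + v) * p = 1 ∧
      p * p * (algebraMap ℝ B δ + v) = 1 ∧ ‖p‖ ^ 2 ≤ δ⁻¹ := by
  set t := algebraMap ℝ B δ + v with ht
  have htsa : IsSelfAdjoint t := (IsSelfAdjoint.algebraMap B (IsSelfAdjoint.all δ)).add
    hv.isSelfAdjoint
  have hspec : ∀ s ∈ spectrum ℝ t, δ ≤ s :=
    (algebraMap_le_iff_le_spectrum (ha := htsa)).mp (le_add_of_nonneg_right hv)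
  let k : ℝ → ℝ := fun s => (Real.sqrt s)⁻¹
  have hk : ContinuousOn k (spectrum ℝ t) := Real.continuous_sqrt.continuousOn.inv₀ fun s hs =>
    (Real.sqrt_pos.mpr (hδ.trans_le (hspec s hs))).ne'
  have hkk : ∀ s ∈ spectrum ℝ t, k s * k s * s = 1 := fun s hs => by
    have hs0 : 0 < s := hδ.trans_le (hspec s hs)
    have h1 : Real.sqrt s ≠ 0 := (Real.sqrt_pos.mpr hs0).ne'
    have h2 := Real.mul_self_sqrt hs0.le
    calc k s * k s * s = k s * k s * (Real.sqrt s * Real.sqrt s) := by rw [h2]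
      _ = 1 := by simp only [k]; field_simp
  have hid : cfc (fun s : ℝ => s) t = t := cfc_id' ℝ t
  have hidc : ContinuousOn (fun s : ℝ => s) (spectrum ℝ t) := continuousOn_id
  have hkid : ContinuousOn (fun s => k s * s) (spectrum ℝ t) := hk.mul hidc
  have hone : cfc (fun s => k s * k s * s) t = 1 := by
    rw [← cfc_const_one ℝ t]
    exact cfc_congr hkk
  have hcont : ContinuousOn (fun s => k s * k s) (spectrum ℝ t) := hk.mul hk
  refine ⟨cfc k t, IsSelfAdjoint.cfc, ?_, ?_, ?_⟩
  · nth_rewrite 2 [← hid]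
    rw [← cfc_mul _ _ t hk hidc, ← cfc_mul _ _ t hkid hk, ← hone]
    congr 1
    ext s
    ring
  · nth_rewrite 3 [← hid]
    rw [← cfc_mul _ _ t hk hk, ← cfc_mul _ _ t hcont hidc, ← hone]
  · have h1 : ‖cfc k t‖ ≤ (Real.sqrt δ)⁻¹ := norm_cfc_le (by positivity) fun s hs => by
      rw [Real.norm_of_nonneg (by positivity)]
      exact inv_anti₀ (Real.sqrt_pos.mpr hδ) (Real.sqrt_le_sqrt (hspec s hs))
    calc ‖cfc k t‖ ^ 2 ≤ ((Real.sqrt δ)⁻¹) ^ 2 := by gcongr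
      _ = δ⁻¹ := by rw [inv_pow, Real.sq_sqrt hδ.le]

end Resolvent

/-! ### Jensen's inequality for unbounded functionals -/

namespace PosFunctional

variable {A : Type*} [NonUnitalCStarAlgebra A] [PartialOrder A] [StarOrderedRing A]
  {φ : PosFunctional A}

theorem toFun_le_multExt {b : A} {m : 𝓜(ℂ, A)} (hb : 0 ≤ b) (h : DoubleCentralizer.coe ℂ b ≤ m) :
    φ.toFun b ≤ φ.multExt m :=
  le_iSup₂_of_le b ⟨hb, CStarAlgebra.nonneg_iff_eq_star_mul_self.mp (sub_nonneg.mpr h)⟩ le_rfl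

/-- An upper bound of `φ` on the elements of `A` between `0` and `m`, in the order of `M(A)`, bounds
`φ.multExt m`. -/
theorem multExt_le {m : 𝓜(ℂ, A)} {X : ℝ≥0∞}
    (h : ∀ b : A, 0 ≤ b → DoubleCentralizer.coe ℂ b ≤ m → φ.toFun b ≤ X) : φ.multExt m ≤ X :=
  iSup₂_le fun b hb => h b hb.1
    (sub_nonneg.mp (CStarAlgebra.nonneg_iff_eq_star_mul_self.mpr hb.2))

/-- If `0 ≤ b ^ 2 ≤ δ + ∑ i, hᵢ(y) v hᵢ(y)` for a quadratic partition of unity `hᵢ`, then `b` is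
within `δ + √δ` of elements `c` such that the value of `φ` at `c⋆ c` is at most `φ(v)`. -/
theorem exists_near_toFun_le (hφ : φ.LowerSemicont) (hK : φ.FiniteOnMinDenseIdeal)
    {y v : 𝓜(ℂ, A)} (hysa : IsSelfAdjoint y) (hy : y ∈ φ.centralizer) (hv : 0 ≤ v) {N : Finset ℝ}
    {h : ℝ → ℝ → ℝ} (hh : ∀ i, Continuous (h i)) (h1 : ∀ s, ∑ i ∈ N, h i s ^ 2 ≤ 1) {b : A}
    (hbsa : IsSelfAdjoint b) {δ : ℝ} (hδ : 0 < δ)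
    (hb : DoubleCentralizer.coe ℂ (b * b) ≤ algebraMap ℝ 𝓜(ℂ, A) δ +
      ∑ i ∈ N, cfc (h i) y * v * cfc (h i) y) :
    ∃ c : A, ‖c - b‖ ≤ δ + Real.sqrt δ ∧ φ.toFun (star c * c) ≤ φ.multExt v := by
  set H : ℝ → 𝓜(ℂ, A) := fun i => cfc (h i) y with hH
  have hHsa : ∀ i, star (H i) = H i := fun i => (IsSelfAdjoint.cfc (f := h i) (a := y)).star_eq
  set s := CFC.sqrt v with hs
  have hss : s * s = v := CFC.sqrt_mul_sqrt_self v hv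
  have hsa : star s = s := (CFC.sqrt_nonneg v).isSelfAdjoint.star_eq
  set V := ∑ i ∈ N, H i * v * H i with hV
  have hV0 : 0 ≤ V := Finset.sum_nonneg fun i _ => by
    have := star_left_conjugate_nonneg hv (H i)
    rwa [hHsa] at this
  obtain ⟨p, hp, hptp, hppt, hpn⟩ := exists_inv_sqrt hV0 hδ
  set t := algebraMap ℝ 𝓜(ℂ, A) δ + V with ht
  set β := DoubleCentralizer.coe ℂ b with hβ
  have hβsa : star β = β := (coe_isSelfAdjoint hbsa).star_eq
  set R := ∑ i ∈ N, ‖s * H i‖ with hR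
  have hR0 : 0 ≤ R := Finset.sum_nonneg fun _ _ => norm_nonneg _
  obtain ⟨ε, hε, hεR⟩ : ∃ ε : ℝ, 0 < ε ∧ ε * R ≤ δ := by
    refine ⟨δ / (R + 1), by positivity, ?_⟩
    rw [div_mul_eq_mul_div, div_le_iff₀ (by positivity)]
    nlinarith
  obtain ⟨g, u, hg, hgu, hg1, hga⟩ :=
    exists_local_unit N (fun i => (p * p * H i * s).snd b) hε
  have hgg : DoubleCentralizer.coe ℂ (g * g) ≤ 1 := by
    rcases subsingleton_or_nontrivial 𝓜(ℂ, A) with _ | _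
    · exact (Subsingleton.elim _ _).le
    refine (CStarAlgebra.norm_le_one_iff_of_nonneg _ (coe_nonneg_iff.mpr hg.mul_self_nonneg)).mp ?_
    rw [norm_coe]
    exact (norm_mul_le _ _).trans (mul_le_one₀ hg1 (norm_nonneg _) hg1)
  set γ := DoubleCentralizer.coe ℂ (g * g) with hγ
  set w := s.fst g with hw
  have hwu : w * u = w := fst_mul_eq hgu s
  have hcoew : ∀ m : 𝓜(ℂ, A), DoubleCentralizer.coe ℂ (m.fst w * star (m.fst w)) =
      m * (s * γ * s) * star m := fun m => by
    rw [coe_mul_coe, coe_star, ← mul_coe, hw, ← mul_coe, star_mul, star_mul, hsa, ← coe_star,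
      hg.star_eq, hγ, coe_mul_coe]
    simp only [mul_assoc]
  -- the element `e` of `A` approximates `V` from below, and `c = b * (p * p) * e`, which is close
  -- to `b * (p * p) * V`, has `c⋆ c ≤ e`
  set e := ∑ i ∈ N, (H i).fst w * star ((H i).fst w) with he
  have he0 : 0 ≤ e := Finset.sum_nonneg fun i _ => mul_star_self_nonneg _
  have hcoee : DoubleCentralizer.coe ℂ e = ∑ i ∈ N, H i * (s * γ * s) * H i := by
    have : DoubleCentralizer.coe ℂ e =
        ∑ i ∈ N, DoubleCentralizer.coe ℂ ((H i).fst w * star ((H i).fst w)) :=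
      _root_.map_sum (DoubleCentralizer.coeHom (𝕜 := ℂ) (A := A)) _ _
    rw [this]
    exact Finset.sum_congr rfl fun i _ => by rw [hcoew, hHsa]
  have hsgs : s * γ * s ≤ v := by
    have := star_left_conjugate_le_conjugate hgg s
    rwa [hsa, mul_one, hss] at this
  have heV : DoubleCentralizer.coe ℂ e ≤ V := by
    rw [hcoee]
    refine Finset.sum_le_sum fun i _ => ?_
    have := star_left_conjugate_le_conjugate hsgs (H i)
    rwa [hHsa] at this
  have het : DoubleCentralizer.coe ℂ e ≤ t :=
    heV.trans (le_add_of_nonneg_left (algebraMap_nonneg _ hδ.le))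
  have hpp : star (p * p) = p * p := by rw [star_mul, hp.star_eq]
  have hc : DoubleCentralizer.coe ℂ ((p * p).snd b * e) =
      β * (p * p) * DoubleCentralizer.coe ℂ e := by
    rw [coe_mul_coe, ← coe_mul (p * p) b]
  refine ⟨(p * p).snd b * e, ?_, ?_⟩
  · have h2 : DoubleCentralizer.coe ℂ ((p * p).snd b * e - b) =
        ∑ i ∈ N, (DoubleCentralizer.coe ℂ ((p * p * H i * s).snd b * (g * g) -
          (p * p * H i * s).snd b)) * (s * H i) - (δ : ℂ) • (β * (p * p)) := by
      have h3 : β = (δ : ℂ) • (β * (p * p)) + β * (p * p) * V := by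
        conv_lhs => rw [← mul_one β, ← hppt, ht, algebraMap_real_eq]
        rw [mul_add, mul_add, mul_smul_comm, mul_one, mul_smul_comm, mul_assoc β]
      rw [coe_sub, hc, show DoubleCentralizer.coe ℂ b = _ from h3]
      rw [← sub_sub, sub_right_comm, ← mul_sub, hcoee, hV, ← Finset.sum_sub_distrib,
        Finset.mul_sum]
      congr 1
      refine Finset.sum_congr rfl fun i _ => ?_
      rw [coe_sub, coe_mul_coe, ← coe_mul, ← hss]
      simp only [mul_sub, sub_mul, mul_assoc]
      rfl
    have h3 : ‖β * (p * p)‖ ^ 2 ≤ δ⁻¹ := by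
      have h4 : star (β * (p * p)) * (β * (p * p)) ≤ p * p := by
        have h5 := star_left_conjugate_le_conjugate hb (p * p)
        rw [hpp, hppt, one_mul, coe_mul_coe] at h5
        refine le_trans (le_of_eq ?_) h5
        rw [star_mul, hpp, hβsa]
        simp only [mul_assoc]
        rfl
      have h5 := CStarAlgebra.norm_le_norm_of_nonneg_of_le (star_mul_self_nonneg _) h4
      rw [CStarRing.norm_star_mul_self, ← sq] at h5
      exact h5.trans ((norm_mul_le p p).trans ((sq ‖p‖).symm.le.trans hpn))
    have h4 : δ * ‖β * (p * p)‖ ≤ Real.sqrt δ := by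
      refine Real.le_sqrt_of_sq_le ?_
      calc (δ * ‖β * (p * p)‖) ^ 2 = δ ^ 2 * ‖β * (p * p)‖ ^ 2 := by ring
        _ ≤ δ ^ 2 * δ⁻¹ := by gcongr
        _ = δ := by field_simp
    rw [← norm_coe, h2]
    refine (norm_sub_le _ _).trans (add_le_add ?_ ?_)
    · calc _ ≤ ∑ i ∈ N, ε * ‖s * H i‖ := norm_sum_le_of_le _ fun i hi =>
            (norm_mul_le _ _).trans
              (mul_le_mul_of_nonneg_right ((norm_coe _).trans_le (hga i hi)) (norm_nonneg _))
        _ ≤ δ := by rw [← Finset.mul_sum]; exact hεR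
    · rw [norm_smul, Complex.norm_of_nonneg hδ.le]
      exact h4
  · have h2 : star ((p * p).snd b * e) * ((p * p).snd b * e) ≤ e := by
      have h3 := star_left_conjugate_le_conjugate
        (star_left_conjugate_le_conjugate hb (p * p)) (DoubleCentralizer.coe ℂ e)
      have hesa : star (DoubleCentralizer.coe ℂ e) = DoubleCentralizer.coe ℂ e :=
        (coe_isSelfAdjoint he0.isSelfAdjoint).star_eq
      rw [hpp, hppt, one_mul, coe_mul_coe, hesa] at h3
      rw [← coe_le_coe_iff, coe_mul_coe, coe_star, hc]
      refine le_trans (le_of_eq ?_)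
        (h3.trans (mul_mul_self_le_of_le (coe_nonneg_iff.mpr he0) het hp hptp))
      rw [star_mul, star_mul, hpp, hβsa, hesa]
      simp only [mul_assoc]
      rfl
    calc φ.toFun (star ((p * p).snd b * e) * ((p * p).snd b * e)) ≤ φ.toFun e :=
          φ.mono (star_mul_self_nonneg _) h2
      _ = ∑ i ∈ N, φ.toFun ((H i).fst w * star ((H i).fst w)) :=
          φ.map_sum N _ fun i _ => mul_star_self_nonneg _
      _ ≤ φ.toFun (w * star w) := sum_toFun_cfc_le hK hwu hφ hysa hy hh h1
      _ ≤ φ.multExt v := by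
          refine toFun_le_multExt (mul_star_self_nonneg _) ?_
          have := hcoew 1
          rw [one_mul, star_one, mul_one] at this
          exact this.trans_le hsgs

/-- Jensen's inequality for an unbounded lower semicontinuous functional whose centralizer
contains `y`. -/
theorem multExt_cfc_le {I : Set ℝ} {f : ℝ → ℝ} (hf : ConvexOn ℝ I f) (hfc : ContinuousOn f I)
    (hf0 : ∀ s ∈ I, 0 ≤ f s) {y v : 𝓜(ℂ, A)} (hysa : IsSelfAdjoint y) (hyI : spectrum ℝ y ⊆ I)
    (hv : ∀ k d : ℝ, (∀ s ∈ I, k * s + d ≤ f s) → cfc (fun s => k * s + d) y ≤ v)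
    (hφ : φ.LowerSemicont) (hK : φ.FiniteOnMinDenseIdeal) (hy : y ∈ φ.centralizer) :
    φ.multExt (cfc f y) ≤ φ.multExt v := by
  obtain ⟨g, hg, hgf⟩ := exists_continuous_eqOn (spectrum.isClosed y) (hfc.mono hyI)
  rw [← cfc_congr hgf]
  have hv0 : 0 ≤ v := by
    refine le_trans (le_of_eq ?_) (hv 0 0 fun s hs => by simpa using hf0 s hs)
    simp
  refine multExt_le fun d hd hdg => ?_
  set b := CFC.sqrt d with hb
  have hbb : b * b = d := CFC.sqrt_mul_sqrt_self d hd
  have hbsa : IsSelfAdjoint b := (CFC.sqrt_nonneg d).isSelfAdjoint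
  have key : ∀ δ : ℝ, 0 < δ →
      ∃ c : A, ‖c - b‖ ≤ δ + Real.sqrt δ ∧ φ.toFun (star c * c) ≤ φ.multExt v := by
    intro δ hδ
    -- `max (g - δ) 0` is smaller than `f` where `g ≥ δ`, and it vanishes elsewhere
    obtain ⟨N, h, hh, h1, h2, hle⟩ := exists_partition_cfc_le hf hfc hv
      ((spectrum.isCompact (𝕜 := ℝ) y).inter_right (isClosed_le continuous_const hg))
      (fun s hs => hyI hs.1) (C := spectrum ℝ y ∩ {s | δ ≤ g s})
      (g := fun s => max (g s - δ) 0) (by fun_prop) (fun s hs => by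
        rw [← hgf hs.1]
        have : δ ≤ g s := hs.2
        exact max_lt (by linarith) (by linarith))
    refine exists_near_toFun_le hφ hK hysa hy hv0 hh h1 hbsa hδ ?_
    rw [hbb, ← sub_le_iff_le_add']
    refine le_trans ?_ (Finset.sum_le_sum hle)
    rw [← cfc_sum (fun i s => h i s ^ 2 * max (g s - δ) 0) y N
      fun i _ => by have := hh i; fun_prop]
    refine (sub_le_sub_right hdg _).trans ?_
    rw [← cfc_const δ y, ← cfc_sub g (fun _ => δ) y (by fun_prop) (by fun_prop), Finset.sum_fn]
    refine cfc_mono (fun s hs => ?_) (by fun_prop) (Continuous.continuousOn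
      (continuous_finsetSum _ fun i _ => by have := hh i; fun_prop))
    rw [← Finset.sum_mul]
    rcases le_or_gt δ (g s) with hδs | hδs
    · rw [h2 s ⟨hs, hδs⟩, one_mul]
      exact le_max_left _ _
    · rw [max_eq_right (by linarith), mul_zero]
      linarith
  by_contra! hlt
  have hlsc := hφ d hd _ hlt
  obtain ⟨U, hU, hdU, hUφ⟩ := mem_nhdsWithin.mp hlsc
  have hcont : Continuous fun c : A => star c * c := by fun_prop
  have hbU : star b * b ∈ U := by rwa [hbsa.star_eq, hbb]
  obtain ⟨η, hη, hηU⟩ := Metric.isOpen_iff.mp (hU.preimage hcont) b hbU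
  have hlim : Tendsto (fun δ : ℝ => δ + Real.sqrt δ) (𝓝[>] 0) (𝓝 0) := by
    have : Continuous fun δ : ℝ => δ + Real.sqrt δ := by fun_prop
    simpa using (this.tendsto 0).mono_left nhdsWithin_le_nhds
  obtain ⟨δ, hδη, hδ⟩ := ((hlim.eventually_lt_const hη).and eventually_mem_nhdsWithin).exists
  obtain ⟨c, hcb, hc⟩ := key δ hδ
  have hcU : star c * c ∈ U := hηU (Metric.mem_ball.mpr (by
    rw [dist_eq_norm]; exact hcb.trans_lt hδη))
  exact absurd (hUφ ⟨hcU, star_mul_self_nonneg c⟩) (not_lt.mpr hc)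

end PosFunctional

/-! ### Degenerate cases -/

section Trivial

variable {A : Type*} [NonUnitalCStarAlgebra A] [PartialOrder A] [StarOrderedRing A]
  {T : Type*} [MeasurableSpace T] {μ : Measure T}

/-- If `A` is trivial, then so is `M(A)`, and every field is integrable. -/
theorem hasWeakStarIntegral_of_subsingleton [Subsingleton 𝓜(ℂ, A)] (W : T → 𝓜(ℂ, A))
    (m : 𝓜(ℂ, A)) : HasWeakStarIntegral μ W m := fun φ => by
  have h : ∀ n : 𝓜(ℂ, A), multExt φ n = 0 := fun n => by
    rw [Subsingleton.elim n 0, multExt_zero]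
  simp [h]

/-- If `M(A)` is nontrivial, then a unital column field lives on a nonempty space. -/
theorem IsUnitalColumnField.nonempty [Nontrivial 𝓜(ℂ, A)] {a : T → 𝓜(ℂ, A)}
    (ha : IsUnitalColumnField μ a) : Nonempty T := by
  by_contra hT
  rw [not_nonempty_iff] at hT
  refine one_ne_zero (α := 𝓜(ℂ, A)) (eq_of_forall_multExt fun φ => ?_)
  rw [(ha.integral_eq_one φ).2, multExt_zero, integral_of_isEmpty]

end Trivial

end CStarJensen

end

open CStarJensen in
theorem corollary9 {A : Type*} [NonUnitalCStarAlgebra A] [PartialOrder A] [StarOrderedRing A]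
    [TopologicalSpace.SeparableSpace A]
    {T : Type*} [MetricSpace T] [LocallyCompactSpace T] [MeasurableSpace T] [BorelSpace T]
    (μ : Measure T) [μ.Regular]
    (I : Set ℝ) (f : ℝ → ℝ) (hf : ConvexOn ℝ I f) (hfc : ContinuousOn f I)
    (x : T → A) (hxm : WeakStarMeasurable μ fun t => DoubleCentralizer.coe ℂ (x t))
    (hxsa : ∀ t, IsSelfAdjoint (x t))
    (hxI : ∀ t, spectrum ℝ (DoubleCentralizer.coe ℂ (x t)) ⊆ I)
    (hxb : ∃ C : ℝ, ∀ t, ‖x t‖ ≤ C)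
    (a : T → 𝓜(ℂ, A)) (ha : IsUnitalColumnField μ a) :
    (∃! y : 𝓜(ℂ, A),
      HasWeakStarIntegral μ (fun t => star (a t) * DoubleCentralizer.coe ℂ (x t) * a t) y) ∧
    ((∃ C : ℝ, ∀ t, ‖cfc f (DoubleCentralizer.coe ℂ (x t))‖ ≤ C) →
      ∃! z : 𝓜(ℂ, A), HasWeakStarIntegral μ
        (fun t => star (a t) * cfc f (DoubleCentralizer.coe ℂ (x t)) * a t) z) ∧
    ∀ y : 𝓜(ℂ, A),
      HasWeakStarIntegral μ (fun t => star (a t) * DoubleCentralizer.coe ℂ (x t) * a t) y →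
      ((∃ b : A, DoubleCentralizer.coe ℂ b = y) ∨ IsClosed I → spectrum ℝ y ⊆ I) ∧
      (spectrum ℝ y ⊆ I →
        ∀ z : 𝓜(ℂ, A),
          HasWeakStarIntegral μ
            (fun t => star (a t) * cfc f (DoubleCentralizer.coe ℂ (x t)) * a t) z →
          (∀ φ : StrongDual ℂ A, (∀ b : A, 0 ≤ b → 0 ≤ φ b) → y ∈ centralizer φ →
            multExt φ (cfc f y) ≤ multExt φ z) ∧
          ((∀ s ∈ I, 0 ≤ f s) →
            ∀ φ : PosFunctional A, φ.LowerSemicont → φ.FiniteOnMinDenseIdeal →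
              y ∈ φ.centralizer →
              φ.multExt (cfc f y) ≤ φ.multExt z)) := by
  rcases subsingleton_or_nontrivial 𝓜(ℂ, A) with _ | _
  · refine ⟨⟨0, hasWeakStarIntegral_of_subsingleton _ _, fun _ _ => Subsingleton.elim _ _⟩,
      fun _ => ⟨0, hasWeakStarIntegral_of_subsingleton _ _, fun _ _ => Subsingleton.elim _ _⟩,
      fun y _ => ⟨fun _ => ?_, fun _ z _ => ⟨fun φ _ _ => ?_, fun _ φ _ _ _ => ?_⟩⟩⟩
    · rw [spectrum.of_subsingleton]
      exact Set.empty_subset I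
    · rw [Subsingleton.elim (cfc f y) z]
    · rw [Subsingleton.elim (cfc f y) z]
  have hT : Nonempty T := ha.nonempty
  have hX := fun t => coe_isSelfAdjoint (hxsa t)
  have hI : I.OrdConnected := hf.1.ordConnected
  have hne : I.Nonempty := by
    obtain ⟨t⟩ := hT
    obtain ⟨s, hs⟩ :=
      ContinuousFunctionalCalculus.spectrum_nonempty (R := ℝ) (DoubleCentralizer.coe ℂ (x t)) (hX t)
    exact ⟨s, hxI t hs⟩
  refine ⟨?_, ?_, fun y hy => ⟨spectrum_integral_subset hI ha hxsa hxI hy, fun hyI z hz => ?_⟩⟩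
  · obtain ⟨C, hC⟩ := hxb
    have hm := weakStarMeasurable_cfc_sandwich hI hne continuousOn_id hxm hxsa hxI ha.measurable
    have hid : ∀ t, cfc (id : ℝ → ℝ) (DoubleCentralizer.coe ℂ (x t)) =
        DoubleCentralizer.coe ℂ (x t) := fun t => cfc_id ℝ _ (hX t)
    simp only [hid] at hm
    obtain ⟨y, hy⟩ := exists_hasWeakStarIntegral ha hX (fun t => (norm_coe _).trans_le (hC t)) hm
    exact ⟨y, hy, fun _ h => h.unique hy⟩
  · rintro ⟨C, hC⟩
    obtain ⟨z, hz⟩ := exists_hasWeakStarIntegral ha (fun t => IsSelfAdjoint.cfc) hC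
      (weakStarMeasurable_cfc_sandwich hI hne hfc hxm hxsa hxI ha.measurable)
    exact ⟨z, hz, fun _ h => h.unique hz⟩
  · have hysa : IsSelfAdjoint y := hy.isSelfAdjoint fun t => (hX t).conjugate' (a t)
    have hle : ∀ k d : ℝ, (∀ s ∈ I, k * s + d ≤ f s) → cfc (fun s => k * s + d) y ≤ z :=
      fun k d hkd => affine_le_integral ha hX hy hz k d fun t =>
        cfc_mono (fun s hs => hkd s (hxI t hs)) (by fun_prop) (hfc.mono (hxI t))
    exact ⟨fun φ hφ hyφ => multExt_cfc_le hf hfc hysa hyI hle hφ hyφ,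
      fun hf0 φ hφ hK hyφ => PosFunctional.multExt_cfc_le hf hfc hf0 hysa hyI hle hφ hK hyφ⟩
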